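/- Let $\theta\in(0,\frac{\pi}{2})$ and let $$\Omega_\theta=\Big\{(x_1,x_2)\in\mathbb{R}^2:\ x_1\tan\theta<|x_2|<\Big(x_1+\frac{\pi}{\sin\theta}\Big)\tan\theta\Big\},\qquad \Omega_\theta^+=\{(x_1,x_2)\in\Omega_\theta:\ x_2>0\}.$$ For an open set $U\subset\mathbb{R}^2$ and a part $\Gamma$ of its boundary, let $V$ be the space of all $u\in H^1(U)$ with $u=0$ on $\Gamma$ (the closure in $H^1(U)$ of the restrictions to $U$ of the functions of $C_c^\infty(\mathbb{R}^2)$ whose support does not meet $\Gamma$). The positive Laplacian on $U$ with Dirichlet conditions on $\Gamma$ and Neumann conditions on the rest of the boundary is the unbounded operator $A$ on the complex Hilbert space $L^2(U)$ associated with the form $b(u,v)=\int_U\nabla u\cdot\overline{\nabla v}$ on $V$: one has $u\in\mathsf{Dom}(A)$ and $Au=f$ if and only if $u\in V$, $f\in L^2(U)$ and $b(u,v)=\langle f,v\rangle_{L^2(U)}$ for all $v\in V$. Let $\Delta^{\mathsf{Dir}}_{\Omega_\theta}$ be this operator for $U=\Omega_\theta$, $\Gamma=\partial\Omega_\theta$,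 and $\Delta^{\mathsf{Mix}}_{\Omega_\theta^+}$ this operator for $U=\Omega_\theta^+$, $\Gamma=\partial\Omega_\theta\cap\partial\Omega_\theta^+$ (so with Neumann conditions on the symmetry axis $x_2=0$). The discrete spectrum $\sigma_{\mathsf{dis}}(A)$ is the set of all $\lambda\in\mathbb{C}$ such that $A-\lambda$ is not bijective from $\mathsf{Dom}(A)$ onto $L^2(U)$ but is Fredholm, i.e. has finite-dimensional kernel and closed range of finite codimension. Then $$\sigma_{\mathsf{dis}}\big(\Delta^{\mathsf{Dir}}_{\Omega_\theta}\big)=\sigma_{\mathsf{dis}}\big(\Delta^{\mathsf{Mix}}_{\Omega_\theta^+}\big).$$ Moreover, all bound states are even in $x_2$: if $\lambda<1$ is real and $\psi\in\mathsf{Dom}(\Delta^{\mathsf{Dir}}_{\Omega_\theta})$ satisfies $\Delta^{\mathsf{Dir}}_{\Omega_\theta}\psi=\lambda\psi$, then $\psi(x_1,-x_2)=\psi(x_1,x_2)$ for almost every $(x_1,x_2)\in\Omega_\theta$. -/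

import Mathlib

open MeasureTheory Set
open scoped ContDiff

noncomputable section

namespace BrokenGuide

/-! ### Spectrum of an unbounded operator -/

section Spectrum

variable {H : Type*} [NormedAddCommGroup H] [InnerProductSpace ℂ H]

/-- The operator `A - z`, as a linear map from the domain of `A` into `H`. -/
def shift (A : H →ₗ.[ℂ] H) (z : ℂ) : A.domain →ₗ[ℂ] H :=
  A.toFun - z • A.domain.subtype

/-- The spectrum: all `z` such that `A - z` is not invertible from its domain onto `H`. -/
def spectrum (A : H →ₗ.[ℂ] H) : Set ℂ :=
  {z | ¬ Function.Bijective (shift A z)}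

/-- `A - z` is Fredholm: its kernel is finite dimensional, its range is closed and of finite
codimension. -/
structure IsFredholmAt (A : H →ₗ.[ℂ] H) (z : ℂ) : Prop where
  finite_ker : FiniteDimensional ℂ (LinearMap.ker (shift A z))
  closed_range : IsClosed (LinearMap.range (shift A z) : Set H)
  finite_coker : FiniteDimensional ℂ (H ⧸ LinearMap.range (shift A z))

/-- The essential spectrum: all `z` such that `A - z` is not Fredholm. -/
def essentialSpectrum (A : H →ₗ.[ℂ] H) : Set ℂ :=
  {z | ¬ IsFredholmAt A z}

/-- The discrete spectrum: the spectrum without the essential spectrum. -/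
def discreteSpectrum (A : H →ₗ.[ℂ] H) : Set ℂ :=
  spectrum A \ essentialSpectrum A

end Spectrum

/-! ### Sobolev spaces on an open subset of the plane -/

/-- The complex Hilbert space `L²(U)` for Lebesgue measure. -/
abbrev L2 (U : Set (ℝ × ℝ)) : Type := Lp ℂ 2 (volume.restrict U)

/-- The first partial derivative. -/
def pd1 (φ : ℝ × ℝ → ℂ) (x : ℝ × ℝ) : ℂ := fderiv ℝ φ x (1, 0)

/-- The second partial derivative. -/
def pd2 (φ : ℝ × ℝ → ℂ) (x : ℝ × ℝ) : ℂ := fderiv ℝ φ x (0, 1)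

/-- `φ` is a smooth function on the plane with compact support contained in `S`. -/
structure IsTest (S : Set (ℝ × ℝ)) (φ : ℝ × ℝ → ℂ) : Prop where
  smooth : ContDiff ℝ ∞ φ
  compact : HasCompactSupport φ
  supp : tsupport φ ⊆ S

namespace IsTest

variable {S : Set (ℝ × ℝ)} {φ ψ : ℝ × ℝ → ℂ}

theorem zero : IsTest S 0 := ⟨contDiff_const, HasCompactSupport.zero, by simp [tsupport]⟩

theorem add (hφ : IsTest S φ) (hψ : IsTest S ψ) : IsTest S (φ + ψ) :=
  ⟨hφ.smooth.add hψ.smooth, hφ.compact.add hψ.compact,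
    (tsupport_add φ ψ).trans (union_subset hφ.supp hψ.supp)⟩

theorem smul (c : ℂ) (hφ : IsTest S φ) : IsTest S (c • φ) :=
  ⟨hφ.smooth.const_smul c, hφ.compact.smul_left (f := fun _ => c),
    (tsupport_smul_subset_right (fun _ => c) φ).trans hφ.supp⟩

theorem differentiable (hφ : IsTest S φ) : Differentiable ℝ φ :=
  hφ.smooth.differentiable (by simp)

theorem continuous_pd (hφ : IsTest S φ) (v : ℝ × ℝ) : Continuous fun x => fderiv ℝ φ x v :=
  (hφ.smooth.continuous_fderiv (by simp)).clm_apply continuous_const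

theorem compact_pd (hφ : IsTest S φ) (v : ℝ × ℝ) : HasCompactSupport fun x => fderiv ℝ φ x v :=
  hφ.compact.fderiv_apply ℝ v

theorem memLp (hφ : IsTest S φ) (μ : Measure (ℝ × ℝ)) [IsFiniteMeasureOnCompacts μ] :
    MemLp φ 2 μ :=
  hφ.smooth.continuous.memLp_of_hasCompactSupport hφ.compact

theorem memLp_pd (hφ : IsTest S φ) (v : ℝ × ℝ) (μ : Measure (ℝ × ℝ))
    [IsFiniteMeasureOnCompacts μ] : MemLp (fun x => fderiv ℝ φ x v) 2 μ :=
  (hφ.continuous_pd v).memLp_of_hasCompactSupport (hφ.compact_pd v)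

theorem integrable_mul {U : Set (ℝ × ℝ)} (hφ : IsTest S φ) (f : L2 U) :
    Integrable (fun x => φ x * f x) (volume.restrict U) :=
  (hφ.memLp _).integrable_mul (Lp.memLp f)

theorem integrable_pd_mul {U : Set (ℝ × ℝ)} (hφ : IsTest S φ) (v : ℝ × ℝ) (f : L2 U) :
    Integrable (fun x => fderiv ℝ φ x v * f x) (volume.restrict U) :=
  (hφ.memLp_pd v _).integrable_mul (Lp.memLp f)

end IsTest

/-- The Sobolev space `H¹(U)`, each function being recorded together with its weak partial
derivatives: the triples `(u, g₁, g₂)` of elements of `L²(U)` such that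
`∫ (∂ⱼφ) u = - ∫ φ gⱼ` for all smooth `φ` with compact support in `U`. -/
def H1 (U : Set (ℝ × ℝ)) : Submodule ℂ (L2 U × L2 U × L2 U) where
  carrier := {p | ∀ φ, IsTest U φ →
    ∫ x in U, pd1 φ x * p.1 x = - ∫ x in U, φ x * p.2.1 x ∧
    ∫ x in U, pd2 φ x * p.1 x = - ∫ x in U, φ x * p.2.2 x}
  zero_mem' := by
    intro φ hφ
    have h0 : ∀ k : ℝ × ℝ → ℂ, ∫ x in U, k x * (0 : L2 U) x = 0 := fun k =>
      integral_eq_zero_of_ae ((Lp.coeFn_zero ℂ 2 (volume.restrict U)).mono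
        fun x hx => by
          simp only [hx, Pi.zero_apply, mul_zero])
    simp only [Prod.fst_zero, Prod.snd_zero, h0, neg_zero, and_self]
  add_mem' := by
    intro p q hp hq φ hφ
    have hadd : ∀ (k : ℝ × ℝ → ℂ) (f g : L2 U),
        Integrable (fun x => k x * f x) (volume.restrict U) →
        Integrable (fun x => k x * g x) (volume.restrict U) →
        ∫ x in U, k x * (f + g) x = (∫ x in U, k x * f x) + ∫ x in U, k x * g x := by
      intro k f g hf hg
      rw [← integral_add hf hg]
      exact integral_congr_ae ((Lp.coeFn_add f g).mono fun x hx => by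
        simp only [hx, Pi.add_apply, mul_add])
    obtain ⟨h1, h2⟩ := hp φ hφ
    obtain ⟨k1, k2⟩ := hq φ hφ
    constructor
    · rw [Prod.fst_add, Prod.snd_add, Prod.fst_add,
        hadd (pd1 φ) _ _ (hφ.integrable_pd_mul _ _) (hφ.integrable_pd_mul _ _),
        hadd _ _ _ (hφ.integrable_mul _) (hφ.integrable_mul _), h1, k1]
      ring
    · rw [Prod.fst_add, Prod.snd_add, Prod.snd_add,
        hadd (pd2 φ) _ _ (hφ.integrable_pd_mul _ _) (hφ.integrable_pd_mul _ _),
        hadd _ _ _ (hφ.integrable_mul _) (hφ.integrable_mul _), h2, k2]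
      ring
  smul_mem' := by
    intro c p hp φ hφ
    have hsmul : ∀ (k : ℝ × ℝ → ℂ) (f : L2 U),
        ∫ x in U, k x * (c • f) x = c * ∫ x in U, k x * f x := by
      intro k f
      rw [← integral_const_mul]
      refine integral_congr_ae ((Lp.coeFn_smul c f).mono fun x hx => ?_)
      simp only [hx, Pi.smul_apply, smul_eq_mul]
      ring
    obtain ⟨h1, h2⟩ := hp φ hφ
    simp only [Prod.smul_fst, Prod.smul_snd, hsmul, h1, h2]
    constructor <;> ring

/-- The triples `(φ, ∂₁φ, ∂₂φ)`, restricted to `U`, where `φ` is smooth on the plane with compact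
support disjoint from `Γ`. -/
def smoothTriples (U Γ : Set (ℝ × ℝ)) : Submodule ℂ (L2 U × L2 U × L2 U) where
  carrier := {p | ∃ φ, IsTest Γᶜ φ ∧ p.1 =ᵐ[volume.restrict U] φ ∧
    p.2.1 =ᵐ[volume.restrict U] pd1 φ ∧ p.2.2 =ᵐ[volume.restrict U] pd2 φ}
  zero_mem' := by
    refine ⟨0, IsTest.zero, Lp.coeFn_zero _ _ _, ?_, ?_⟩
    · exact (Lp.coeFn_zero ℂ 2 (volume.restrict U)).mono fun x hx => by
        simpa [pd1] using hx
    · exact (Lp.coeFn_zero ℂ 2 (volume.restrict U)).mono fun x hx => by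
        simpa [pd2] using hx
  add_mem' := by
    rintro p q ⟨φ, hφ, a0, a1, a2⟩ ⟨ψ, hψ, b0, b1, b2⟩
    refine ⟨φ + ψ, hφ.add hψ, ?_, ?_, ?_⟩
    · filter_upwards [a0, b0, Lp.coeFn_add p.1 q.1] with x h1 h2 h3
      rw [Prod.fst_add, h3, Pi.add_apply, h1, h2, Pi.add_apply]
    · filter_upwards [a1, b1, Lp.coeFn_add p.2.1 q.2.1] with x h1 h2 h3
      rw [Prod.snd_add, Prod.fst_add, h3, Pi.add_apply, h1, h2]
      simp [pd1, fderiv_add (hφ.differentiable x) (hψ.differentiable x)]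
    · filter_upwards [a2, b2, Lp.coeFn_add p.2.2 q.2.2] with x h1 h2 h3
      rw [Prod.snd_add, Prod.snd_add, h3, Pi.add_apply, h1, h2]
      simp [pd2, fderiv_add (hφ.differentiable x) (hψ.differentiable x)]
  smul_mem' := by
    rintro c p ⟨φ, hφ, a0, a1, a2⟩
    refine ⟨c • φ, hφ.smul c, ?_, ?_, ?_⟩
    · filter_upwards [a0, Lp.coeFn_smul c p.1] with x h1 h3
      simp [h1, h3]
    · filter_upwards [a1, Lp.coeFn_smul c p.2.1] with x h1 h3
      simp [h1, h3, pd1, fderiv_const_smul (hφ.differentiable x)]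
    · filter_upwards [a2, Lp.coeFn_smul c p.2.2] with x h1 h3
      simp [h1, h3, pd2, fderiv_const_smul (hφ.differentiable x)]

/-- The space `{u ∈ H¹(U) : u = 0 on Γ}` (with weak gradients recorded): the closure in `H¹(U)` of
the smooth compactly supported functions that vanish near `Γ`. If `U` is open and `Γ` is the whole
boundary of `U`, it is `H¹₀(U)`, the closure of the smooth functions with compact support in `U`. -/
def formDomain (U Γ : Set (ℝ × ℝ)) : Submodule ℂ (L2 U × L2 U × L2 U) :=
  H1 U ⊓ (smoothTriples U Γ).topologicalClosure

/-! ### The Laplacian with Dirichlet conditions on `Γ` and natural conditions elsewhere -/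

/-- The graph of the operator associated with the Dirichlet form `b(u, v) = ∫ ∇u · conj ∇v` on
`V = {u ∈ H¹(U) : u = 0 on Γ}`: the pairs `(u, f)` with `u ∈ V`, `f ∈ L²(U)` and
`b(u, v) = ⟨f, v⟩` for all `v ∈ V`. -/
def laplacianGraph (U Γ : Set (ℝ × ℝ)) : Submodule ℂ (L2 U × L2 U) where
  carrier := {q | ∃ p ∈ formDomain U Γ, p.1 = q.1 ∧
    ∀ v ∈ formDomain U Γ, inner ℂ v.2.1 p.2.1 + inner ℂ v.2.2 p.2.2 = inner ℂ v.1 q.2}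
  zero_mem' := ⟨0, Submodule.zero_mem _, rfl, by simp⟩
  add_mem' := by
    rintro q r ⟨p, hp, h1, h2⟩ ⟨s, hs, k1, k2⟩
    refine ⟨p + s, Submodule.add_mem _ hp hs, by simp [h1, k1], fun v hv => ?_⟩
    simp only [Prod.fst_add, Prod.snd_add, inner_add_right, ← h2 v hv, ← k2 v hv]
    ring
  smul_mem' := by
    rintro c q ⟨p, hp, h1, h2⟩
    refine ⟨c • p, Submodule.smul_mem _ c hp, by simp [h1], fun v hv => ?_⟩
    simp only [Prod.smul_fst, Prod.smul_snd, inner_smul_right, ← h2 v hv]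
    ring

/-- The positive Laplacian on `U`, an unbounded operator on `L²(U)`, with Dirichlet conditions on
`Γ` and Neumann conditions on the rest of the boundary. Its graph is `laplacianGraph U Γ` as soon
as `U` is open and disjoint from `Γ`, see `laplacian_graph`. -/
def laplacian (U Γ : Set (ℝ × ℝ)) : L2 U →ₗ.[ℂ] L2 U :=
  (laplacianGraph U Γ).toLinearPMap

theorem ae_zero_of_test {U : Set (ℝ × ℝ)} (hU : IsOpen U) (f : L2 U)
    (h : ∀ φ, IsTest U φ → ∫ x in U, φ x * f x = 0) : f = 0 := by
  rw [Lp.eq_zero_iff_ae_eq_zero]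
  have hloc : LocallyIntegrableOn f U (volume.restrict U) :=
    ((Lp.memLp f).locallyIntegrable (by norm_num)).locallyIntegrableOn U
  have key := hU.ae_eq_zero_of_integral_contDiff_smul_eq_zero hloc (fun g hg hc hs => by
    have hsub : tsupport (fun x => (g x : ℂ)) ⊆ tsupport g :=
      closure_mono fun x hx => by simpa using hx
    have := h (fun x => (g x : ℂ))
      ⟨Complex.ofRealCLM.contDiff.comp hg, hc.comp_left (g := Complex.ofReal) (by simp),
        hsub.trans hs⟩
    simpa [Complex.real_smul] using this)
  filter_upwards [key, ae_restrict_mem hU.measurableSet] with x hx hxU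
  exact hx hxU

theorem exists_formDomain_of_test {U Γ : Set (ℝ × ℝ)} (hΓ : Disjoint U Γ)
    {φ : ℝ × ℝ → ℂ} (hφ : IsTest U φ) :
    ∃ p ∈ formDomain U Γ, p.1 =ᵐ[volume.restrict U] φ := by
  let μ : Measure (ℝ × ℝ) := volume.restrict U
  let p : L2 U × L2 U × L2 U :=
    ((hφ.memLp μ).toLp φ, (hφ.memLp_pd (1, 0) μ).toLp _, (hφ.memLp_pd (0, 1) μ).toLp _)
  have h0 : p.1 =ᵐ[volume.restrict U] φ := (hφ.memLp μ).coeFn_toLp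
  have h1 : p.2.1 =ᵐ[volume.restrict U] fun x => fderiv ℝ φ x (1, 0) :=
    (hφ.memLp_pd (1, 0) μ).coeFn_toLp
  have h2 : p.2.2 =ᵐ[volume.restrict U] fun x => fderiv ℝ φ x (0, 1) :=
    (hφ.memLp_pd (0, 1) μ).coeFn_toLp
  refine ⟨p, ⟨fun χ hχ => ?_, subset_closure
    ⟨φ, ⟨hφ.smooth, hφ.compact, hφ.supp.trans hΓ.subset_compl_right⟩, h0, h1, h2⟩⟩, h0⟩
  have aux : ∀ (v : ℝ × ℝ) (g : L2 U), g =ᵐ[volume.restrict U] (fun x => fderiv ℝ φ x v) →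
      ∫ x in U, fderiv ℝ χ x v * p.1 x = - ∫ x in U, χ x * g x := by
    intro v g hg
    have e1 : ∫ x in U, fderiv ℝ χ x v * p.1 x = ∫ x, fderiv ℝ χ x v * φ x := by
      rw [← setIntegral_eq_integral_of_forall_compl_eq_zero (s := U)
        (f := fun x => fderiv ℝ χ x v * φ x)]
      · exact integral_congr_ae (h0.mono fun x hx => by simp only [hx])
      · intro x hx
        rw [image_eq_zero_of_notMem_tsupport fun h => hx (hφ.supp h), mul_zero]
    have e2 : ∫ x in U, χ x * g x = ∫ x, χ x * fderiv ℝ φ x v := by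
      rw [← setIntegral_eq_integral_of_forall_compl_eq_zero (s := U)
        (f := fun x => χ x * fderiv ℝ φ x v)]
      · exact integral_congr_ae (hg.mono fun x hx => by simp only [hx])
      · intro x hx
        rw [image_eq_zero_of_notMem_tsupport fun h => hx (hχ.supp h), zero_mul]
    rw [e1, e2, integral_mul_fderiv_eq_neg_fderiv_mul_of_integrable, neg_neg]
    · exact (hχ.memLp_pd v volume).integrable_mul (hφ.memLp volume)
    · exact (hχ.memLp volume).integrable_mul (hφ.memLp_pd v volume)
    · exact (hχ.memLp volume).integrable_mul (hφ.memLp volume)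
    · exact fun x _ => hχ.differentiable x
    · exact fun x _ => hφ.differentiable x
  exact ⟨aux _ _ h1, aux _ _ h2⟩

/-- The operator `laplacian U Γ` is well defined: its graph is the one prescribed. -/
theorem laplacian_graph {U Γ : Set (ℝ × ℝ)} (hU : IsOpen U) (hΓ : Disjoint U Γ) :
    (laplacian U Γ).graph = laplacianGraph U Γ := by
  refine Submodule.toLinearPMap_graph_eq _ ?_
  rintro ⟨u, f⟩ ⟨p, hp, hpu, h⟩ rfl
  have hw := hp.1
  have g0 : ∀ k : ℝ × ℝ → ℂ, ∫ x in U, k x * p.1 x = 0 := by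
    intro k
    rw [hpu]
    exact integral_eq_zero_of_ae ((Lp.coeFn_zero ℂ 2 (volume.restrict U)).mono
      fun x hx => by
          simp only [hx, Pi.zero_apply, mul_zero])
  have z1 : p.2.1 = 0 := ae_zero_of_test hU _ fun φ hφ => by
    have := (hw φ hφ).1
    rw [g0] at this
    exact neg_eq_zero.mp this.symm
  have z2 : p.2.2 = 0 := ae_zero_of_test hU _ fun φ hφ => by
    have := (hw φ hφ).2
    rw [g0] at this
    exact neg_eq_zero.mp this.symm
  refine ae_zero_of_test hU _ fun φ hφ => ?_
  have hconj : IsTest U (fun x => star (φ x)) :=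
    ⟨(Complex.conjCLE.contDiff).comp hφ.smooth, hφ.compact.comp_left (g := star) (by simp),
      (closure_mono fun x hx => by simpa using hx : _ ⊆ tsupport φ).trans hφ.supp⟩
  obtain ⟨v, hv, hvφ⟩ := exists_formDomain_of_test hΓ hconj
  have := h v hv
  rw [z1, z2, inner_zero_right, inner_zero_right, add_zero, L2.inner_def] at this
  rw [this]
  refine integral_congr_ae (hvφ.mono fun x hx => ?_)
  simp [hx, mul_comm]

/-- The positive Dirichlet Laplacian on `U`. -/
def dirichletLaplacian (U : Set (ℝ × ℝ)) : L2 U →ₗ.[ℂ] L2 U :=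
  laplacian U (frontier U)

/-! ### The broken guide -/

/-- The broken guide `Ω_θ`. -/
def guide (θ : ℝ) : Set (ℝ × ℝ) :=
  {x | x.1 * Real.tan θ < |x.2| ∧ |x.2| < (x.1 + Real.pi / Real.sin θ) * Real.tan θ}

/-- The half-guide `Ω_θ⁺`. -/
def halfGuide (θ : ℝ) : Set (ℝ × ℝ) := {x ∈ guide θ | 0 < x.2}

/-- The Dirichlet part `∂Ω_θ ∩ ∂Ω_θ⁺` of the boundary of the half-guide. -/
def dirichletBoundary (θ : ℝ) : Set (ℝ × ℝ) := frontier (guide θ) ∩ frontier (halfGuide θ)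

theorem isOpen_guide (θ : ℝ) : IsOpen (guide θ) :=
  IsOpen.and (isOpen_lt (f := fun x : ℝ × ℝ => x.1 * Real.tan θ) (by fun_prop) (by fun_prop))
    (isOpen_lt (g := fun x : ℝ × ℝ => (x.1 + Real.pi / Real.sin θ) * Real.tan θ)
      (by fun_prop) (by fun_prop))

theorem isOpen_halfGuide (θ : ℝ) : IsOpen (halfGuide θ) :=
  (isOpen_guide θ).inter (isOpen_lt continuous_const continuous_snd)

/-- The positive Laplacian on the half-guide, with Dirichlet conditions on `∂Ω_θ ∩ ∂Ω_θ⁺` and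
Neumann conditions on the remaining part of the boundary, which lies on the axis `x₂ = 0`. -/
def mixedLaplacian (θ : ℝ) : L2 (halfGuide θ) →ₗ.[ℂ] L2 (halfGuide θ) :=
  laplacian (halfGuide θ) (dirichletBoundary θ)

/-- The Dirichlet Laplacian is well defined. -/
theorem dirichletLaplacian_graph (θ : ℝ) :
    (dirichletLaplacian (guide θ)).graph = laplacianGraph (guide θ) (frontier (guide θ)) :=
  laplacian_graph (isOpen_guide θ) (disjoint_iff_inter_eq_empty.mpr (isOpen_guide θ).inter_frontier_eq)

/-- The mixed Laplacian is well defined. -/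
theorem mixedLaplacian_graph (θ : ℝ) :
    (mixedLaplacian θ).graph = laplacianGraph (halfGuide θ) (dirichletBoundary θ) :=
  laplacian_graph (isOpen_halfGuide θ)
    ((disjoint_iff_inter_eq_empty.mpr (isOpen_halfGuide θ).inter_frontier_eq).mono_right
      inter_subset_right)

end BrokenGuide

end

namespace BrokenGuide

open Filter Topology
open scoped ENNReal

/-! ### Operators, their graphs and the Fredholm property -/

section Operators

variable {H K : Type*} [NormedAddCommGroup H] [InnerProductSpace ℂ H]
  [NormedAddCommGroup K] [InnerProductSpace ℂ K]

/-! The reflection `x₂ ↦ -x₂` preserves the guide and commutes with the Dirichlet Laplacian `A`, so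
`L²` of the guide splits into even and odd functions, each reducing `A`. Even extension `J` and
restriction of the even part `P` satisfy `P J = 1` and identify the even summand of `A` with the
mixed Laplacian `B` on the half-guide: a function there extends evenly without a jump, and evenness
is the natural (Neumann) condition on the axis. This is `evenExt_mem_graph` and
`evenPart_mem_graph`.

The odd summand contributes nothing outside `[1, ∞)`. An odd function of the form domain vanishes on
the axis, so its restriction lies in `H¹₀` of the half-guide, which is contained in a strip of width
`π`. The first Dirichlet eigenvalue of `(0, π)` being `1`, Poincaré's inequality gives `‖u‖² ≤
‖∇u‖²` (`poincare_formDomain`, `poincare_oddDomain`). By Lax-Milgram the odd part of `A - z` is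
invertible for every `z` outside `[1, ∞)` (`regularOnKer_evenPart`). For such `z`, being Fredholm
and being bijective mean the same for `A - z` and `B - z`. Moreover the odd part of an eigenfunction
with eigenvalue below `1` must vanish, which is the evenness of bound states.

For real `z = 1 + k² ≥ 1`, wave packets `a β(ℓ s) exp(i k s) sin t` travelling out along the arm,
with `s` along and `t` across, form a Weyl sequence for `B`. Thus `B - z` is not Fredholm
(`not_isFredholmAt_mixedLaplacian`), and neither is `A - z`, because the Fredholm property passes
from `A` to its summand `B`. Neither operator has discrete spectrum there.

The abstract comparison is `discreteSpectrum_eq_of_retract`. All of it is phrased through graphs,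
since the Laplacians are known explicitly only by `laplacian_graph`. -/

theorem mem_range_shift {A : H →ₗ.[ℂ] H} {z : ℂ} {g : H} :
    g ∈ LinearMap.range (shift A z) ↔ ∃ u, (u, g + z • u) ∈ A.graph := by
  constructor
  · rintro ⟨y, rfl⟩
    refine ⟨y, (LinearPMap.mem_graph_iff _).2 ⟨y, rfl, ?_⟩⟩
    simp [shift]
  · rintro ⟨u, hu⟩
    obtain ⟨y, hy, hy'⟩ := (LinearPMap.mem_graph_iff _).1 hu
    refine ⟨y, ?_⟩
    simp only at hy hy'
    simp [shift, hy', hy]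

/-- The eigenspace `ker (A - z)` as a subspace of `H`. -/
def eigenspace (A : H →ₗ.[ℂ] H) (z : ℂ) : Submodule ℂ H :=
  (LinearMap.ker (shift A z)).map A.domain.subtype

theorem mem_eigenspace {A : H →ₗ.[ℂ] H} {z : ℂ} {u : H} :
    u ∈ eigenspace A z ↔ (u, z • u) ∈ A.graph := by
  constructor
  · rintro ⟨y, hy, rfl⟩
    refine (LinearPMap.mem_graph_iff _).2 ⟨y, rfl, ?_⟩
    have : A y - z • (y : H) = 0 := hy
    simpa [sub_eq_zero] using this
  · intro hu
    obtain ⟨y, hy, hy'⟩ := (LinearPMap.mem_graph_iff _).1 hu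
    simp only at hy hy'
    refine ⟨y, ?_, hy⟩
    simp [shift, hy', hy]

theorem finiteDimensional_eigenspace_iff {A : H →ₗ.[ℂ] H} {z : ℂ} :
    FiniteDimensional ℂ (eigenspace A z) ↔ FiniteDimensional ℂ (LinearMap.ker (shift A z)) :=
  (Module.Finite.equiv_iff (Submodule.equivMapOfInjective A.domain.subtype
    A.domain.injective_subtype (LinearMap.ker (shift A z)))).symm

theorem bijective_shift_iff {A : H →ₗ.[ℂ] H} {z : ℂ} :
    Function.Bijective (shift A z) ↔
      (∀ u, (u, z • u) ∈ A.graph → u = 0) ∧ ∀ f, ∃ u, (u, f + z • u) ∈ A.graph := by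
  refine and_congr ?_ ?_
  · have h : LinearMap.ker (shift A z) = ⊥ ↔ eigenspace A z = ⊥ := by
      constructor
      · intro h
        rw [eigenspace, h, Submodule.map_bot]
      · intro h
        exact Submodule.map_injective_of_injective A.domain.injective_subtype
          (by simpa [eigenspace] using h)
    rw [← LinearMap.ker_eq_bot, h, Submodule.eq_bot_iff]
    exact forall_congr' fun u => imp_congr_left mem_eigenspace
  · rw [← LinearMap.range_eq_top, Submodule.eq_top_iff']
    exact forall_congr' fun f => mem_range_shift

/-- The map `f` induces an injection of `K ⧸ f⁻¹(W)` into `H ⧸ W`. -/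
theorem finiteDimensional_quotient_comap (f : K →ₗ[ℂ] H) (W : Submodule ℂ H)
    [FiniteDimensional ℂ (H ⧸ W)] : FiniteDimensional ℂ (K ⧸ W.comap f) := by
  refine Module.Finite.of_injective ((W.comap f).mapQ W f le_rfl) ?_
  rw [← LinearMap.ker_eq_bot, Submodule.ker_mapQ, Submodule.mkQ_map_self]

variable {A : H →ₗ.[ℂ] H} {B : K →ₗ.[ℂ] K} {J : K →L[ℂ] H} {P : H →L[ℂ] K} {z : ℂ}

/-- The range of `B - z` is the preimage under `J` of the range of `A - z`, and `J` embeds the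
kernel of `B - z` into that of `A - z`; each of the three Fredholm conditions pulls back. Nothing is
needed on the complementary summand. -/
theorem IsFredholmAt.of_retract (hPJ : ∀ p, P (J p) = p)
    (hJ : ∀ p q, (p, q) ∈ B.graph → (J p, J q) ∈ A.graph)
    (hP : ∀ u f, (u, f) ∈ A.graph → (P u, P f) ∈ B.graph) (h : IsFredholmAt A z) :
    IsFredholmAt B z := by
  have hr : LinearMap.range (shift B z) = (LinearMap.range (shift A z)).comap J.toLinearMap := by
    ext g
    rw [Submodule.mem_comap, mem_range_shift, mem_range_shift]
    constructor
    · rintro ⟨u, hu⟩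
      exact ⟨J u, by simpa using hJ _ _ hu⟩
    · rintro ⟨u, hu⟩
      exact ⟨P u, by simpa [hPJ] using hP _ _ hu⟩
  have hinj : Function.Injective J := Function.LeftInverse.injective hPJ
  have := h.finite_ker
  have := h.finite_coker
  have := finiteDimensional_eigenspace_iff.2 h.finite_ker
  refine ⟨finiteDimensional_eigenspace_iff.1 ?_, ?_, ?_⟩
  · have hle : (eigenspace B z).map J.toLinearMap ≤ eigenspace A z := by
      rintro _ ⟨u, hu, rfl⟩
      have := hJ _ _ (mem_eigenspace.1 hu)
      exact mem_eigenspace.2 (by simpa using this)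
    have := Submodule.finiteDimensional_of_le hle
    exact (Submodule.equivMapOfInjective J.toLinearMap hinj (eigenspace B z)).symm.finiteDimensional
  · rw [hr]
    exact h.closed_range.preimage J.continuous
  · rw [hr]
    exact finiteDimensional_quotient_comap _ _

/-- The complementary summand `ker P` does not meet the spectrum at `z`. -/
structure RegularOnKer (A : H →ₗ.[ℂ] H) (P : H →L[ℂ] K) (z : ℂ) : Prop where
  surj : ∀ f, P f = 0 → ∃ u, (u, f + z • u) ∈ A.graph
  inj : ∀ u, (u, z • u) ∈ A.graph → P u = 0 → u = 0

/-- Splitting `g = J P g + (g - J P g)`, the second term lies in `ker P`, where the equation is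
solvable by regularity, so only `P g` decides whether `g` is in the range. -/
theorem range_shift_eq_comap (hPJ : ∀ p, P (J p) = p)
    (hJ : ∀ p q, (p, q) ∈ B.graph → (J p, J q) ∈ A.graph)
    (hP : ∀ u f, (u, f) ∈ A.graph → (P u, P f) ∈ B.graph) (hz : RegularOnKer A P z) :
    LinearMap.range (shift A z) = (LinearMap.range (shift B z)).comap P.toLinearMap := by
  ext g
  rw [Submodule.mem_comap, mem_range_shift, mem_range_shift]
  constructor
  · rintro ⟨u, hu⟩
    exact ⟨P u, by simpa using hP _ _ hu⟩
  · rintro ⟨u, hu⟩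
    obtain ⟨w, hw⟩ := hz.surj (g - J (P g)) (by simp [hPJ])
    refine ⟨J u + w, ?_⟩
    have := A.graph.add_mem (hJ _ _ hu) hw
    convert this using 1
    ext
    · simp
    · simp only [ContinuousLinearMap.coe_coe, map_add, map_smul, Prod.snd_add, smul_add]
      abel

/-- For an eigenvector `u`, the difference `u - J P u` is an eigenvector in `ker P`, hence zero. -/
theorem eigenspace_le_map (hPJ : ∀ p, P (J p) = p)
    (hJ : ∀ p q, (p, q) ∈ B.graph → (J p, J q) ∈ A.graph)
    (hP : ∀ u f, (u, f) ∈ A.graph → (P u, P f) ∈ B.graph) (hz : RegularOnKer A P z) :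
    eigenspace A z ≤ (eigenspace B z).map J.toLinearMap := by
  intro u hu
  have hu' := mem_eigenspace.1 hu
  have h1 : (P u, z • P u) ∈ B.graph := by simpa using hP _ _ hu'
  have h2 : (J (P u), z • J (P u)) ∈ A.graph := by simpa using hJ _ _ h1
  have h3 := hz.inj (u - J (P u)) (by simpa [smul_sub] using A.graph.sub_mem hu' h2)
    (by simp [hPJ])
  exact ⟨P u, mem_eigenspace.2 h1, (sub_eq_zero.1 h3).symm⟩

theorem IsFredholmAt.of_regularOnKer (hPJ : ∀ p, P (J p) = p)
    (hJ : ∀ p q, (p, q) ∈ B.graph → (J p, J q) ∈ A.graph)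
    (hP : ∀ u f, (u, f) ∈ A.graph → (P u, P f) ∈ B.graph) (hz : RegularOnKer A P z)
    (h : IsFredholmAt B z) : IsFredholmAt A z := by
  have hr := range_shift_eq_comap hPJ hJ hP hz
  have := h.finite_coker
  have := finiteDimensional_eigenspace_iff.2 h.finite_ker
  refine ⟨finiteDimensional_eigenspace_iff.1 ?_, ?_, ?_⟩
  · have : FiniteDimensional ℂ ((eigenspace B z).map J.toLinearMap) := inferInstance
    exact Submodule.finiteDimensional_of_le (eigenspace_le_map hPJ hJ hP hz)
  · rw [hr]
    exact h.closed_range.preimage P.continuous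
  · rw [hr]
    exact finiteDimensional_quotient_comap _ _

theorem bijective_shift_iff_of_regularOnKer (hPJ : ∀ p, P (J p) = p)
    (hJ : ∀ p q, (p, q) ∈ B.graph → (J p, J q) ∈ A.graph)
    (hP : ∀ u f, (u, f) ∈ A.graph → (P u, P f) ∈ B.graph) (hz : RegularOnKer A P z) :
    Function.Bijective (shift A z) ↔ Function.Bijective (shift B z) := by
  have hr := range_shift_eq_comap hPJ hJ hP hz
  have he := eigenspace_le_map hPJ hJ hP hz
  rw [bijective_shift_iff, bijective_shift_iff]
  simp only [← mem_range_shift, ← mem_eigenspace, hr, Submodule.mem_comap,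
    ContinuousLinearMap.coe_coe]
  refine and_congr ⟨fun h u hu => ?_, fun h u hu => ?_⟩ ⟨fun h f => ?_, fun h f => h _⟩
  · have := hJ _ _ (mem_eigenspace.1 hu)
    have h0 := h (J u) (mem_eigenspace.2 (by simpa using this))
    simpa [hPJ] using congrArg P h0
  · obtain ⟨p, hp, rfl⟩ := he hu
    rw [h p hp, map_zero]
  · simpa [hPJ] using h (J f)

/-- Regularity on `ker P` is demanded only where `B` is Fredholm. This suffices because a point of
the discrete spectrum of either operator is such a point. -/
theorem discreteSpectrum_eq_of_retract (hPJ : ∀ p, P (J p) = p)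
    (hJ : ∀ p q, (p, q) ∈ B.graph → (J p, J q) ∈ A.graph)
    (hP : ∀ u f, (u, f) ∈ A.graph → (P u, P f) ∈ B.graph)
    (hz : ∀ z, IsFredholmAt B z → RegularOnKer A P z) :
    discreteSpectrum A = discreteSpectrum B := by
  ext z
  simp only [discreteSpectrum, spectrum, essentialSpectrum, Set.mem_sdiff, mem_ofPred_eq, not_not]
  constructor
  · rintro ⟨h1, h2⟩
    have hB := h2.of_retract hPJ hJ hP
    rw [bijective_shift_iff_of_regularOnKer hPJ hJ hP (hz z hB)] at h1
    exact ⟨h1, hB⟩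
  · rintro ⟨h1, hB⟩
    rw [← bijective_shift_iff_of_regularOnKer hPJ hJ hP (hz z hB)] at h1
    exact ⟨h1, hB.of_regularOnKer hPJ hJ hP (hz z hB)⟩

/-- Weyl's criterion: an orthonormal sequence of approximate eigenvectors excludes the Fredholm
property. The graph of the operator is described as the image of a closed set. -/
theorem not_isFredholmAt_of_orthonormal [CompleteSpace H] {T : Type*} [NormedAddCommGroup T]
    [NormedSpace ℂ T] [CompleteSpace T] (π : T →L[ℂ] H) (X : Submodule ℂ (T × H))
    (hX : IsClosed (X : Set (T × H)))
    (hXA : ∀ u f, (u, f) ∈ A.graph ↔ ∃ p, (p, f) ∈ X ∧ π p = u)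
    {e r : ℕ → H} (he : Orthonormal ℂ e) (hr : ∀ n, (e n, r n + z • e n) ∈ A.graph)
    (hr0 : Tendsto r atTop (𝓝 0)) : ¬ IsFredholmAt A z := by
  intro hF
  have : CompleteSpace X := hX.completeSpace_coe
  let R := LinearMap.range (shift A z)
  have : CompleteSpace R := hF.closed_range.completeSpace_coe
  -- On the complete space `X` of pairs `(p, f)`, the operator `A - z` becomes the bounded map `(p,
  -- f) ↦ f - z π p`, with the same range.
  let T₀ : X →L[ℂ] H :=
    (ContinuousLinearMap.snd ℂ T H - z • π.comp (ContinuousLinearMap.fst ℂ T H)).comp X.subtypeL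
  have hT₀ : ∀ x, T₀ x ∈ R := fun x => by
    refine mem_range_shift.2 ⟨π x.1.1, (hXA _ _).2 ⟨x.1.1, ?_, rfl⟩⟩
    have : T₀ x + z • π x.1.1 = x.1.2 := by simp [T₀]
    rw [this]
    exact x.2
  let T₁ : X →L[ℂ] R := T₀.codRestrict R hT₀
  have hsurj : Function.Surjective T₁ := by
    rintro ⟨g, hg⟩
    obtain ⟨u, hu⟩ := mem_range_shift.1 hg
    obtain ⟨p, hp, rfl⟩ := (hXA _ _).1 hu
    refine ⟨⟨_, hp⟩, Subtype.ext ?_⟩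
    simp [T₁, T₀]
  -- Open mapping theorem onto the closed range: the small defects `r n` have preimages that are
  -- small too.
  obtain ⟨C, hC, hpre⟩ := T₁.exists_preimage_norm_le hsurj
  have hrR : ∀ n, r n ∈ R := fun n => mem_range_shift.2 ⟨_, hr n⟩
  choose x hx hxn using fun n => hpre ⟨r n, hrR n⟩
  let v : ℕ → H := fun n => π (x n).1.1
  have hv0 : Tendsto v atTop (𝓝 0) := by
    refine squeeze_zero_norm (a := fun n => ‖π‖ * (C * ‖r n‖)) (fun n => ?_) ?_
    · refine (π.le_opNorm _).trans ?_
      gcongr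
      exact (norm_fst_le (x n).1).trans (hxn n)
    · simpa using ((hr0.norm.const_mul C).const_mul ‖π‖)
  -- Correcting `e n` by the small `v n` gives exact eigenvectors, a bounded sequence in a
  -- finite-dimensional space. A convergent subsequence would contradict the mutual distance `√2` of
  -- orthonormal vectors.
  have hvk : ∀ n, e n - v n ∈ eigenspace A z := fun n => by
    have h1 : (v n, r n + z • v n) ∈ A.graph := by
      refine (hXA _ _).2 ⟨(x n).1.1, ?_, rfl⟩
      have h2 : (x n).1.2 - z • v n = r n := congrArg Subtype.val (hx n)
      rw [← h2, sub_add_cancel]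
      exact (x n).2
    refine mem_eigenspace.2 ?_
    have := A.graph.sub_mem (hr n) h1
    convert this using 1
    ext
    · simp
    · simp [smul_sub]
  have := finiteDimensional_eigenspace_iff.2 hF.finite_ker
  have := FiniteDimensional.proper ℂ (eigenspace A z)
  obtain ⟨M, hM⟩ := hv0.norm.bddAbove_range
  let k : ℕ → eigenspace A z := fun n => ⟨e n - v n, hvk n⟩
  have hk : ∀ n, k n ∈ Metric.closedBall 0 (1 + M) := fun n => by
    rw [mem_closedBall_zero_iff]
    refine (norm_sub_le _ _).trans ?_
    rw [he.1 n]
    gcongr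
    exact hM ⟨n, rfl⟩
  obtain ⟨a, -, φ, hφ, ha⟩ := (isCompact_closedBall (0 : eigenspace A z) (1 + M)).tendsto_subseq hk
  have ha' : Tendsto (fun n => e (φ n)) atTop (𝓝 (a : H)) := by
    have h1 := (continuous_subtype_val.tendsto a).comp ha
    have h2 := h1.add (hv0.comp hφ.tendsto_atTop)
    simpa [k, Function.comp_def] using h2
  have hd : Tendsto (fun n => e (φ (n + 1)) - e (φ n)) atTop (𝓝 0) := by
    simpa using (ha'.comp (tendsto_add_atTop_nat 1)).sub ha'
  have hn : ∀ n, ‖e (φ (n + 1)) - e (φ n)‖ ^ 2 = 2 := fun n => by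
    have hne : φ (n + 1) ≠ φ n := (hφ (Nat.lt_succ_self n)).ne'
    have h := norm_sub_sq (𝕜 := ℂ) (e (φ (n + 1))) (e (φ n))
    rw [he.2 hne, he.1, he.1] at h
    rw [h]
    norm_num
  have hl := hd.norm.pow 2
  simp only [hn] at hl
  simpa using tendsto_nhds_unique hl tendsto_const_nhds

end Operators

/-! ### Coercivity and the Lax-Milgram lemma -/

section LaxMilgram

/-- Here `N` and `n` stand for the squared norms in `H¹` and in `L²`, and `2 * n ≤ N` is Poincaré's
inequality. The factor `1 + z` appears because the `H¹` product is the Dirichlet form plus the `L²`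
product. -/
theorem exists_coercivity_const {z : ℂ} (hz : z.im ≠ 0 ∨ z.re < 1) :
    ∃ c : ℝ, 0 < c ∧ ∀ N n : ℝ, 0 ≤ n → 2 * n ≤ N → N * c ≤ ‖(N : ℂ) - (1 + z) * n‖ := by
  rcases hz with hz | hz
  -- Chosen so that `Re w = 1` and `Re (w z) = 0`: multiplication by `w` makes the real part `N - n
  -- ≥ N / 2`.
  · let w : ℂ := ⟨1, z.re / z.im⟩
    have hw : 0 < ‖w‖ := norm_pos_iff.2 fun h => by simpa [w] using congrArg Complex.re h
    refine ⟨1 / (2 * ‖w‖), by positivity, fun N n hn hN => ?_⟩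
    have h1 := Complex.re_le_norm (w * ((N : ℂ) - (1 + z) * n))
    have h2 : (w * ((N : ℂ) - (1 + z) * n)).re = N - n := by
      simp [w, Complex.mul_re]
      field_simp
      ring
    rw [h2, norm_mul] at h1
    rw [mul_one_div, div_le_iff₀ (by positivity)]
    linarith
  -- The real part `N - (1 + Re z) n` is least at `n = N / 2` if `Re z ≥ -1`, and at `n = 0`
  -- otherwise; these give the two entries of the minimum.
  · refine ⟨min 1 ((1 - z.re) / 2), lt_min one_pos (by linarith), fun N n hn hN => ?_⟩
    have h1 := Complex.re_le_norm ((N : ℂ) - (1 + z) * n)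
    have h2 : ((N : ℂ) - (1 + z) * n).re = N - (1 + z.re) * n := by simp
    rw [h2] at h1
    refine le_trans ?_ h1
    have hN0 : 0 ≤ N := by linarith
    rcases le_total (-1) z.re with h | h
    · have := mul_le_mul_of_nonneg_left (min_le_right 1 ((1 - z.re) / 2)) hN0
      nlinarith
    · have := mul_le_mul_of_nonneg_left (min_le_left 1 ((1 - z.re) / 2)) hN0
      nlinarith

/-- The Lax-Milgram lemma for the form `⟪v, u⟫ - (1 + z) ⟪J v, J u⟫`. -/
theorem laxMilgram_shift {V H : Type*} [NormedAddCommGroup V] [InnerProductSpace ℂ V]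
    [CompleteSpace V] [NormedAddCommGroup H] [InnerProductSpace ℂ H] [CompleteSpace H]
    (J : V →L[ℂ] H) (hJ : ∀ u, 2 * ‖J u‖ ^ 2 ≤ ‖u‖ ^ 2) {z : ℂ} (hz : z.im ≠ 0 ∨ z.re < 1) :
    (∀ f : H, ∃ u : V, ∀ v, inner ℂ v u - (1 + z) * inner ℂ (J v) (J u) = inner ℂ (J v) f) ∧
      ∀ u : V, (∀ v, inner ℂ v u - (1 + z) * inner ℂ (J v) (J u) = 0) → u = 0 := by
  obtain ⟨c, hc, hcoer⟩ := exists_coercivity_const hz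
  let M : V →L[ℂ] V := 1 - (1 + z) • (J.adjoint.comp J)
  have hM : ∀ v u, inner ℂ v (M u) = inner ℂ v u - (1 + z) * inner ℂ (J v) (J u) := fun v u => by
    simp [M, ContinuousLinearMap.adjoint_inner_right]
  have hself : ∀ u, ‖u‖ ^ 2 * c ≤ ‖inner ℂ u (M u)‖ := fun u => by
    have := hcoer (‖u‖ ^ 2) (‖J u‖ ^ 2) (by positivity) (hJ u)
    rw [hM, inner_self_eq_norm_sq_to_K, inner_self_eq_norm_sq_to_K]
    simpa using this
  constructor
  · have hu : IsUnit M := by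
      refine ContinuousLinearMap.isUnit_of_forall_le_norm_inner_map M (c := ⟨c, hc.le⟩) hc
        fun u => ?_
      rw [norm_inner_symm]
      exact hself u
    obtain ⟨N, hN⟩ := hu.exists_right_inv
    intro f
    refine ⟨N (J.adjoint f), fun v => ?_⟩
    have : M (N (J.adjoint f)) = J.adjoint f := DFunLike.congr_fun hN _
    rw [← hM, this, ContinuousLinearMap.adjoint_inner_right]
  · intro u h
    have h1 := hself u
    rw [hM, h u, norm_zero] at h1
    have : ‖u‖ ^ 2 ≤ 0 := by
      by_contra! h2
      nlinarith
    simpa using le_antisymm this (sq_nonneg _)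

end LaxMilgram

/-! ### Weighted composition operators on `L²` -/

section WeightedComposition

variable {α β : Type*} [MeasurableSpace α] [MeasurableSpace β] {μ : Measure α} {ν : Measure β}

theorem norm_sq_eq_integral (f : Lp ℂ 2 μ) : ‖f‖ ^ 2 = ∫ x, ‖f x‖ ^ 2 ∂μ := by
  have h := congrArg Complex.re (L2.inner_def (𝕜 := ℂ) f f)
  have h1 : ∀ x, inner ℂ (f x) (f x) = ((‖f x‖ ^ 2 : ℝ) : ℂ) := fun x => by
    rw [inner_self_eq_norm_sq_to_K]
    simp
  simp only [h1] at h
  rw [integral_complex_ofReal, inner_self_eq_norm_sq_to_K] at h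
  have h2 : (((‖f‖ : ℂ)) ^ 2).re = ‖f‖ ^ 2 := by
    rw [← Complex.ofReal_pow, Complex.ofReal_re]
  exact h2.symm.trans (h.trans (Complex.ofReal_re _))

theorem inner_eq_integral {v g : Lp ℂ 2 μ} {φ γ : α → ℂ} (hv : v =ᵐ[μ] φ) (hg : g =ᵐ[μ] γ) :
    inner ℂ v g = ∫ x, star (φ x) * γ x ∂μ := by
  rw [L2.inner_def]
  refine integral_congr_ae ?_
  filter_upwards [hv, hg] with x h1 h2
  simp [h1, h2, mul_comm]

/-- The data of a weighted composition operator `f ↦ m · (f ∘ T)` from `L²(ν)` to `L²(μ)`. -/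
structure IsFold (T : α → β) (m : α → ℂ) (μ : Measure α) (ν : Measure β) : Prop where
  measurable : Measurable T
  map_le : μ.map T ≤ (2 : ℝ≥0∞) • ν
  measurable_weight : Measurable m
  norm_le : ∀ x, ‖m x‖ ≤ 1

namespace IsFold

variable {T : α → β} {m : α → ℂ} (h : IsFold T m μ ν)
include h

theorem quasiMeasurePreserving : Measure.QuasiMeasurePreserving T μ ν :=
  ⟨h.measurable, Measure.absolutelyContinuous_of_le_smul h.map_le⟩

theorem memLp_comp {f : β → ℂ} (hf : MemLp f 2 ν) : MemLp (f ∘ T) 2 μ :=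
  (hf.of_measure_le_smul (by simp) h.map_le).comp_of_map h.measurable.aemeasurable

theorem norm_weight_mul_le (f : β → ℂ) (x : α) : ‖m x * f (T x)‖ ≤ ‖(f ∘ T) x‖ := by
  rw [norm_mul]
  exact mul_le_of_le_one_left (norm_nonneg _) (h.norm_le x)

theorem memLp {f : β → ℂ} (hf : MemLp f 2 ν) : MemLp (fun x => m x * f (T x)) 2 μ :=
  (h.memLp_comp hf).mono
    (h.measurable_weight.aestronglyMeasurable.mul (h.memLp_comp hf).aestronglyMeasurable)
    (Eventually.of_forall (h.norm_weight_mul_le f))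

theorem ae_comp {f g : β → ℂ} (hfg : f =ᵐ[ν] g) : ∀ᵐ x ∂μ, f (T x) = g (T x) :=
  h.quasiMeasurePreserving.ae_eq_comp hfg

end IsFold

/-- The weighted composition operator `f ↦ m · (f ∘ T)`. -/
noncomputable def wcomp {T : α → β} {m : α → ℂ} (h : IsFold T m μ ν) : Lp ℂ 2 ν →L[ℂ] Lp ℂ 2 μ :=
  LinearMap.mkContinuous
    { toFun := fun f => (h.memLp (Lp.memLp f)).toLp _
      map_add' := fun f g => by
        rw [← MemLp.toLp_add, MemLp.toLp_eq_toLp_iff]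
        filter_upwards [h.ae_comp (Lp.coeFn_add f g)] with x hx
        simp only [hx, Pi.add_apply, mul_add]
      map_smul' := fun c f => by
        rw [RingHom.id_apply, ← MemLp.toLp_const_smul, MemLp.toLp_eq_toLp_iff]
        filter_upwards [h.ae_comp (Lp.coeFn_smul c f)] with x hx
        simp only [hx, Pi.smul_apply, smul_eq_mul]
        ring }
    ((2 : ℝ≥0∞) ^ (1 / (2 : ℝ≥0∞)).toReal).toReal (fun f => by
      simp only [LinearMap.coe_mk, AddHom.coe_mk]
      rw [Lp.norm_toLp, Lp.norm_def, ← ENNReal.toReal_mul]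
      refine ENNReal.toReal_mono (ENNReal.mul_ne_top (by simp) (Lp.eLpNorm_ne_top f)) ?_
      calc eLpNorm (fun x => m x * f (T x)) 2 μ ≤ eLpNorm (f ∘ T) 2 μ :=
            eLpNorm_mono (h.norm_weight_mul_le f)
        _ = eLpNorm f 2 (μ.map T) := by
            rw [eLpNorm_map_measure _ h.measurable.aemeasurable]
            exact ((Lp.memLp f).of_measure_le_smul (by simp) h.map_le).aestronglyMeasurable
        _ ≤ eLpNorm f 2 ((2 : ℝ≥0∞) • ν) := eLpNorm_mono_measure _ h.map_le
        _ = _ := eLpNorm_smul_measure_of_ne_top (by simp) _ _)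

theorem wcomp_coeFn {T : α → β} {m : α → ℂ} (h : IsFold T m μ ν) (f : Lp ℂ 2 ν) :
    wcomp h f =ᵐ[μ] fun x => m x * f (T x) :=
  (h.memLp (Lp.memLp f)).coeFn_toLp

theorem wcomp_ae {T : α → β} {m : α → ℂ} (h : IsFold T m μ ν) {f : Lp ℂ 2 ν} {g : β → ℂ}
    (hg : f =ᵐ[ν] g) : wcomp h f =ᵐ[μ] fun x => m x * g (T x) := by
  filter_upwards [wcomp_coeFn h f, h.ae_comp hg] with x h1 h2
  rw [h1, h2]

end WeightedComposition

/-! ### Test functions -/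

namespace IsTest

variable {S U : Set (ℝ × ℝ)} {φ η g : ℝ × ℝ → ℂ}

theorem mono {S' : Set (ℝ × ℝ)} (h : IsTest S φ) (hS : S ⊆ S') : IsTest S' φ :=
  ⟨h.smooth, h.compact, h.supp.trans hS⟩

theorem mul_right (h : IsTest S φ) (hg : ContDiff ℝ ∞ g) : IsTest S (fun x => φ x * g x) :=
  ⟨h.smooth.mul hg, h.compact.mul_right, (tsupport_mul_subset_left).trans h.supp⟩

theorem star (h : IsTest S φ) : IsTest S (fun x => star (φ x)) :=
  ⟨Complex.conjCLE.contDiff.comp h.smooth, h.compact.comp_left (g := Star.star) (by simp),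
    (closure_mono fun x hx => by simpa using hx : _ ⊆ tsupport φ).trans h.supp⟩

/-- A function supported away from the boundary can be cut off to `U` without losing smoothness,
since its support meets the closure of `U` only inside `U`. -/
theorem indicator (hU : IsOpen U) (h : IsTest (frontier U)ᶜ η) : IsTest U (U.indicator η) := by
  have hts : tsupport (U.indicator η) ⊆ tsupport η ∩ closure U := by
    refine subset_inter (closure_mono ?_) (closure_mono ?_)
    · rw [support_indicator]
      exact inter_subset_right
    · exact support_indicator_subset
  refine ⟨contDiff_iff_contDiffAt.2 fun x => ?_, ?_, ?_⟩
  · by_cases hx : x ∈ U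
    · refine (h.smooth.contDiffAt (x := x)).congr_of_eventuallyEq ?_
      filter_upwards [hU.mem_nhds hx] with y hy
      exact indicator_of_mem hy η
    · have : x ∉ tsupport (U.indicator η) := fun hx' => by
        have h2 := hts hx'
        refine h.supp h2.1 ⟨h2.2, ?_⟩
        rwa [hU.interior_eq]
      refine (contDiffAt_const (c := (0 : ℂ))).congr_of_eventuallyEq ?_
      exact notMem_tsupport_iff_eventuallyEq.1 this
  · exact h.compact.mono (by rw [support_indicator]; exact inter_subset_right)
  · intro x hx
    by_contra hxU
    have h2 := hts hx
    refine h.supp h2.1 ⟨h2.2, ?_⟩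
    rwa [hU.interior_eq]

theorem integral_fderiv_eq_zero (h : IsTest S φ) (v : ℝ × ℝ) : ∫ x, fderiv ℝ φ x v = 0 := by
  have := integral_mul_fderiv_eq_neg_fderiv_mul_of_integrable (μ := (volume : Measure (ℝ × ℝ)))
    (f := fun _ => (1 : ℂ)) (g := φ) (v := v) (by simp)
    (by simpa using (h.continuous_pd v).integrable_of_hasCompactSupport (h.compact_pd v))
    (by simpa using h.smooth.continuous.integrable_of_hasCompactSupport h.compact)
    (fun x _ => by fun_prop) (fun x _ => h.differentiable x)
  simpa using this

/-- The divergence theorem without boundary term, obtained by replacing `η` with its cut-off to `U`.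
The weak-derivative identity for smooth triples, the Poincaré inequality and Green's formula for the
modes all rest on it, so no regularity of the boundary is ever needed. -/
theorem setIntegral_fderiv_eq_zero (hU : IsOpen U) (h : IsTest (frontier U)ᶜ η) (v : ℝ × ℝ) :
    ∫ x in U, fderiv ℝ η x v = 0 := by
  have hi := h.indicator hU
  rw [← hi.integral_fderiv_eq_zero v,
    ← setIntegral_eq_integral_of_forall_compl_eq_zero (s := U)
      (f := fun x => fderiv ℝ (U.indicator η) x v)]
  · refine setIntegral_congr_fun hU.measurableSet fun x hx => ?_
    have : U.indicator η =ᶠ[𝓝 x] η := by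
      filter_upwards [hU.mem_nhds hx] with y hy
      exact indicator_of_mem hy η
    simp only [this.fderiv_eq]
  · intro x hx
    have : U.indicator η =ᶠ[𝓝 x] 0 :=
      notMem_tsupport_iff_eventuallyEq.1 fun h' => hx (hi.supp h')
    simp [this.fderiv_eq]

end IsTest

theorem subset_compl_frontier {U : Set (ℝ × ℝ)} (hU : IsOpen U) : U ⊆ (frontier U)ᶜ :=
  fun _ hx hx' => by simpa [hU.inter_frontier_eq] using mem_inter hx hx'

/-! ### The form domain -/

variable {U Γ : Set (ℝ × ℝ)}

/-- The function `χ φ` is supported inside `U`, so the integral of its derivative over `U` vanishes,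
whatever `φ` does at the boundary. -/
theorem smoothTriples_le_H1 (hU : IsOpen U) : smoothTriples U Γ ≤ H1 U := by
  rintro p ⟨φ, hφ, h0, h1, h2⟩ χ hχ
  have aux : ∀ (v : ℝ × ℝ) (g : L2 U), g =ᵐ[volume.restrict U] (fun x => fderiv ℝ φ x v) →
      ∫ x in U, fderiv ℝ χ x v * p.1 x = - ∫ x in U, χ x * g x := by
    intro v g hg
    rw [eq_neg_iff_add_eq_zero, ← integral_add (hχ.integrable_pd_mul _ _) (hχ.integrable_mul _),
      ← ((hχ.mono (subset_compl_frontier hU)).mul_right hφ.smooth).setIntegral_fderiv_eq_zero hU v]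
    refine integral_congr_ae ?_
    filter_upwards [h0, hg] with x hx0 hx1
    rw [fderiv_fun_mul (hχ.differentiable x) (hφ.differentiable x), hx0, hx1]
    simp
    ring
  exact ⟨aux _ _ h1, aux _ _ h2⟩

theorem continuous_integral_mul {k : ℝ × ℝ → ℂ} (hk : MemLp k 2 (volume.restrict U)) :
    Continuous fun f : L2 U => ∫ x in U, k x * f x := by
  have h : (fun f : L2 U => ∫ x in U, k x * f x) = fun f => inner ℂ (hk.star.toLp (star k)) f := by
    ext f
    rw [inner_eq_integral hk.star.coeFn_toLp (ae_eq_refl f)]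
    simp
  rw [h]
  fun_prop

theorem isClosed_H1 : IsClosed (H1 U : Set (L2 U × L2 U × L2 U)) := by
  have : (H1 U : Set (L2 U × L2 U × L2 U)) = ⋂ (φ : ℝ × ℝ → ℂ) (_ : IsTest U φ),
      ({p | ∫ x in U, pd1 φ x * p.1 x = - ∫ x in U, φ x * p.2.1 x} ∩
        {p | ∫ x in U, pd2 φ x * p.1 x = - ∫ x in U, φ x * p.2.2 x}) := by
    ext p
    simp only [mem_iInter]
    rfl
  rw [this]
  refine isClosed_iInter fun φ => isClosed_iInter fun hφ => IsClosed.inter ?_ ?_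
  · exact isClosed_eq ((continuous_integral_mul (hφ.memLp_pd (1, 0) _)).comp continuous_fst)
      ((continuous_integral_mul (hφ.memLp _)).comp (continuous_fst.comp continuous_snd)).neg
  · exact isClosed_eq ((continuous_integral_mul (hφ.memLp_pd (0, 1) _)).comp continuous_fst)
      ((continuous_integral_mul (hφ.memLp _)).comp (continuous_snd.comp continuous_snd)).neg

/-- The intersection with `H1 U` is redundant, as `H1 U` is closed and contains the smooth triples.
Closed conditions on the form domain may therefore be checked on smooth triples alone. -/
theorem formDomain_eq_closure (hU : IsOpen U) :
    formDomain U Γ = (smoothTriples U Γ).topologicalClosure :=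
  inf_eq_right.2 (Submodule.topologicalClosure_minimal _ (smoothTriples_le_H1 hU) isClosed_H1)

/-- A continuous linear map sends one form domain into a closed subspace as soon as it does so for
smooth triples. -/
theorem map_mem_of_mem_formDomain (hU : IsOpen U) {E : Type*} [TopologicalSpace E]
    [AddCommGroup E] [Module ℂ E] {W : Submodule ℂ E} (hW : IsClosed (W : Set E))
    (L : L2 U × L2 U × L2 U →L[ℂ] E)
    (h : ∀ p ∈ smoothTriples U Γ, L p ∈ W) {p : L2 U × L2 U × L2 U} (hp : p ∈ formDomain U Γ) :
    L p ∈ W := by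
  rw [formDomain_eq_closure hU] at hp
  have hle : (smoothTriples U Γ).topologicalClosure ≤ W.comap L.toLinearMap :=
    Submodule.topologicalClosure_minimal _ h (hW.preimage L.continuous)
  exact hle hp

theorem isClosed_formDomain (hU : IsOpen U) :
    IsClosed (formDomain U Γ : Set (L2 U × L2 U × L2 U)) := by
  rw [formDomain_eq_closure hU]
  exact Submodule.isClosed_topologicalClosure _

theorem smoothTriples_le_formDomain (hU : IsOpen U) : smoothTriples U Γ ≤ formDomain U Γ := by
  rw [formDomain_eq_closure hU]
  exact Submodule.le_topologicalClosure _

theorem tendsto_toLp_of_dominated {f : ℕ → ℝ × ℝ → ℂ} (hf : ∀ n, MemLp (f n) 2 (volume.restrict U))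
    {K : Set (ℝ × ℝ)} (hK : IsCompact K) {C : ℝ} (hC : ∀ n x, ‖f n x‖ ≤ C)
    (hsupp : ∀ n, ∀ x ∉ K, f n x = 0) {p : L2 U}
    (hlim : ∀ᵐ x ∂volume.restrict U, Tendsto (fun n => f n x) atTop (𝓝 (p x))) :
    Tendsto (fun n => (hf n).toLp (f n)) atTop (𝓝 p) := by
  rw [tendsto_iff_norm_sub_tendsto_zero]
  have hsq : Tendsto (fun n => ‖(hf n).toLp (f n) - p‖ ^ 2) atTop (𝓝 0) := by
    have hint : ∀ n, ‖(hf n).toLp (f n) - p‖ ^ 2 = ∫ x in U, ‖f n x - p x‖ ^ 2 := fun n => by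
      rw [norm_sq_eq_integral]
      refine integral_congr_ae ?_
      filter_upwards [Lp.coeFn_sub ((hf n).toLp (f n)) p, (hf n).coeFn_toLp] with x h1 h2
      rw [h1, Pi.sub_apply, h2]
    simp only [hint]
    have h0 : (0 : ℝ) = ∫ x in U, (0 : ℝ) := by simp
    rw [h0]
    -- The dominating function comes from `|a - b|² ≤ 2 (|a|² + |b|²)`.
    refine tendsto_integral_of_dominated_convergence
      (fun x => 2 * (K.indicator (fun _ => C ^ 2) x + ‖p x‖ ^ 2)) (fun n => ?_) ?_ (fun n => ?_) ?_
    · exact (((hf n).aestronglyMeasurable.sub (Lp.aestronglyMeasurable p)).norm.pow 2)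
    · refine Integrable.const_mul (Integrable.add ?_ ?_) 2
      · refine (integrable_indicator_iff hK.measurableSet).2 ?_
        have : IsFiniteMeasureOnCompacts (volume.restrict U) := inferInstance
        exact integrableOn_const hK.measure_lt_top.ne
      · exact (Lp.memLp p).norm.integrable_sq
    · refine Eventually.of_forall fun x => ?_
      rw [Real.norm_of_nonneg (by positivity)]
      have h1 : ‖f n x - p x‖ ≤ ‖f n x‖ + ‖p x‖ := norm_sub_le _ _
      have h2 : ‖f n x‖ ^ 2 ≤ K.indicator (fun _ => C ^ 2) x := by
        by_cases hx : x ∈ K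
        · rw [indicator_of_mem hx]
          exact pow_le_pow_left₀ (norm_nonneg _) (hC n x) 2
        · simp [indicator_of_notMem hx, hsupp n x hx]
      nlinarith [sq_nonneg (‖f n x‖ - ‖p x‖), norm_nonneg (f n x - p x)]
    · filter_upwards [hlim] with x hx
      have := ((hx.sub_const (p x)).norm.pow 2)
      simpa using this
  have := (Real.continuous_sqrt.tendsto 0).comp hsq
  simpa [Function.comp_def, Real.sqrt_sq (norm_nonneg _)] using this

/-- Dominated convergence for values and gradients together. Even extensions, cut-offs of odd
functions and modes all enter their form domains in this way. -/
theorem mem_formDomain_of_tendsto (hU : IsOpen U) {ψ : ℕ → ℝ × ℝ → ℂ}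
    (hψ : ∀ n, IsTest Γᶜ (ψ n)) {K : Set (ℝ × ℝ)} (hK : IsCompact K)
    (hsupp : ∀ n, tsupport (ψ n) ⊆ K) {C : ℝ} (h0 : ∀ n x, ‖ψ n x‖ ≤ C)
    (h1 : ∀ n x, ‖pd1 (ψ n) x‖ ≤ C) (h2 : ∀ n x, ‖pd2 (ψ n) x‖ ≤ C)
    {p : L2 U × L2 U × L2 U}
    (l0 : ∀ᵐ x ∂volume.restrict U, Tendsto (fun n => ψ n x) atTop (𝓝 (p.1 x)))
    (l1 : ∀ᵐ x ∂volume.restrict U, Tendsto (fun n => pd1 (ψ n) x) atTop (𝓝 (p.2.1 x)))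
    (l2 : ∀ᵐ x ∂volume.restrict U, Tendsto (fun n => pd2 (ψ n) x) atTop (𝓝 (p.2.2 x))) :
    p ∈ formDomain U Γ := by
  rw [formDomain_eq_closure hU]
  have m0 := fun n => (hψ n).memLp (volume.restrict U)
  have m1 := fun n => (hψ n).memLp_pd (1, 0) (volume.restrict U)
  have m2 := fun n => (hψ n).memLp_pd (0, 1) (volume.restrict U)
  have hz : ∀ n, ∀ x ∉ K, ∀ v, fderiv ℝ (ψ n) x v = 0 := fun n x hx v => by
    have : ψ n =ᶠ[𝓝 x] 0 := notMem_tsupport_iff_eventuallyEq.1 fun h => hx (hsupp n h)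
    simp [this.fderiv_eq]
  refine mem_closure_of_tendsto (f := fun n => ((m0 n).toLp _, (m1 n).toLp _, (m2 n).toLp _))
    (b := atTop) (Tendsto.prodMk_nhds ?_ (Tendsto.prodMk_nhds ?_ ?_)) ?_
  · exact tendsto_toLp_of_dominated m0 hK h0
      (fun n x hx => image_eq_zero_of_notMem_tsupport fun h => hx (hsupp n h)) l0
  · exact tendsto_toLp_of_dominated m1 hK h1 (fun n x hx => hz n x hx _) l1
  · exact tendsto_toLp_of_dominated m2 hK h2 (fun n x hx => hz n x hx _) l2
  · exact Eventually.of_forall fun n =>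
      ⟨ψ n, hψ n, (m0 n).coeFn_toLp, (m1 n).coeFn_toLp, (m2 n).coeFn_toLp⟩

/-! ### Geometry of the guide -/

section Geometry

variable {θ : ℝ}

/-- The coordinate along the upper arm. -/
noncomputable def along (θ : ℝ) (x : ℝ × ℝ) : ℝ := x.1 * Real.cos θ + x.2 * Real.sin θ

/-- The coordinate across the upper arm. -/
noncomputable def across (θ : ℝ) (x : ℝ × ℝ) : ℝ := x.2 * Real.cos θ - x.1 * Real.sin θ

theorem contDiff_along : ContDiff ℝ ∞ (along θ) := by unfold along; fun_prop

theorem contDiff_across : ContDiff ℝ ∞ (across θ) := by unfold across; fun_prop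

/-- The folding of the plane onto the upper half-plane. -/
def fold (x : ℝ × ℝ) : ℝ × ℝ := (x.1, |x.2|)

theorem continuous_fold : Continuous fold := by unfold fold; fun_prop

/-- The reflection across the axis. -/
def reflect : (ℝ × ℝ) ≃ₜ (ℝ × ℝ) := (Homeomorph.refl ℝ).prodCongr (Homeomorph.neg ℝ)

@[simp] theorem reflect_apply (x : ℝ × ℝ) : reflect x = (x.1, -x.2) := rfl

theorem snd_eq (θ : ℝ) (x : ℝ × ℝ) :
    x.2 = along θ x * Real.sin θ + across θ x * Real.cos θ := by
  have := Real.sin_sq_add_cos_sq θ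
  unfold along across
  linear_combination (-x.2) * this

/-- Multiplying by `cos θ > 0` turns the two inequalities into bounds on the coordinate across the
arm: above the axis the guide is a piece of a straight strip of width `π`. -/
theorem mem_guide_iff (hθ : θ ∈ Ioo 0 (Real.pi / 2)) {x : ℝ × ℝ} :
    x ∈ guide θ ↔ 0 < across θ (fold x) ∧ across θ (fold x) < Real.pi := by
  have hs : 0 < Real.sin θ := Real.sin_pos_of_pos_of_lt_pi hθ.1 (by linarith [hθ.2, Real.pi_pos])
  have hc : 0 < Real.cos θ := Real.cos_pos_of_mem_Ioo ⟨by linarith [hθ.1, Real.pi_pos], hθ.2⟩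
  have h1 : x.1 * Real.tan θ = x.1 * Real.sin θ / Real.cos θ := by
    rw [Real.tan_eq_sin_div_cos]; ring
  have h2 : (x.1 + Real.pi / Real.sin θ) * Real.tan θ =
      (x.1 * Real.sin θ + Real.pi) / Real.cos θ := by
    rw [Real.tan_eq_sin_div_cos]; field_simp
  change x.1 * Real.tan θ < |x.2| ∧ |x.2| < (x.1 + Real.pi / Real.sin θ) * Real.tan θ ↔ _
  rw [h1, h2, div_lt_iff₀ hc, lt_div_iff₀ hc]
  simp only [across, fold]
  constructor <;> rintro ⟨a, b⟩ <;> constructor <;> linarith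

theorem fold_mem_guide {x : ℝ × ℝ} : fold x ∈ guide θ ↔ x ∈ guide θ := by
  simp [guide, fold]

theorem reflect_mem_guide {x : ℝ × ℝ} : reflect x ∈ guide θ ↔ x ∈ guide θ := by
  simp [guide]

theorem fold_of_pos {x : ℝ × ℝ} (hx : 0 < x.2) : fold x = x := by
  simp [fold, abs_of_pos hx]

theorem fold_reflect (x : ℝ × ℝ) : fold (reflect x) = fold x := by
  simp [fold]

theorem reflect_reflect (x : ℝ × ℝ) : reflect (reflect x) = x := by
  simp

theorem reflect_preimage_guide : reflect ⁻¹' guide θ = guide θ := by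
  ext x
  exact reflect_mem_guide

theorem halfGuide_subset : halfGuide θ ⊆ guide θ := fun _ hx => hx.1

theorem across_mem_Ioo (hθ : θ ∈ Ioo 0 (Real.pi / 2)) {x : ℝ × ℝ} (hx : x ∈ halfGuide θ) :
    across θ x ∈ Ioo 0 Real.pi := by
  have := (mem_guide_iff hθ).1 hx.1
  rwa [fold_of_pos hx.2] at this

theorem mem_halfGuide_iff (hθ : θ ∈ Ioo 0 (Real.pi / 2)) {x : ℝ × ℝ} :
    x ∈ halfGuide θ ↔ across θ x ∈ Ioo 0 Real.pi ∧ 0 < x.2 := by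
  refine ⟨fun hx => ⟨across_mem_Ioo hθ hx, hx.2⟩, fun hx => ⟨?_, hx.2⟩⟩
  rw [mem_guide_iff hθ, fold_of_pos hx.2]
  exact hx.1

theorem closure_halfGuide_subset (hθ : θ ∈ Ioo 0 (Real.pi / 2)) :
    closure (halfGuide θ) ⊆ {x | across θ x ∈ Icc 0 Real.pi ∧ 0 ≤ x.2} := by
  refine closure_minimal (fun x hx => ?_) ?_
  · have := across_mem_Ioo hθ hx
    exact ⟨Ioo_subset_Icc_self this, hx.2.le⟩
  · exact (isClosed_Icc.preimage contDiff_across.continuous).inter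
      (isClosed_le continuous_const continuous_snd)

theorem subset_closure_halfGuide (hθ : θ ∈ Ioo 0 (Real.pi / 2)) :
    {x | across θ x ∈ Icc 0 Real.pi ∧ 0 ≤ x.2} ⊆ closure (halfGuide θ) := by
  rintro y ⟨⟨h0, h1⟩, h2⟩
  have hpi := Real.pi_pos
  have hc : 0 < Real.cos θ := Real.cos_pos_of_mem_Ioo ⟨by linarith [hθ.1], hθ.2⟩
  -- A point of the half-guide on the centre line of the strip. By convexity the segment from `y` to
  -- `w`, without `y`, stays in the open half-guide.
  let w : ℝ × ℝ := (0, Real.pi / 2 / Real.cos θ)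
  have hw : across θ w = Real.pi / 2 := by
    simp only [across, w]
    field_simp
    ring
  have hw2 : 0 < w.2 := by positivity
  have hlim : Tendsto (fun ε : ℝ => y + ε • (w - y)) (𝓝[>] 0) (𝓝 y) := by
    have : Continuous fun ε : ℝ => y + ε • (w - y) := by fun_prop
    simpa using (this.tendsto 0).mono_left nhdsWithin_le_nhds
  refine mem_closure_of_tendsto hlim ?_
  filter_upwards [Ioo_mem_nhdsGT (zero_lt_one (α := ℝ))] with ε hε
  have ha : across θ (y + ε • (w - y)) = (1 - ε) * across θ y + ε * (Real.pi / 2) := by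
    rw [← hw]
    simp only [across, Prod.fst_add, Prod.snd_add, Prod.smul_fst, Prod.smul_snd, Prod.fst_sub,
      Prod.snd_sub, smul_eq_mul]
    ring
  have hb : (y + ε • (w - y)).2 = (1 - ε) * y.2 + ε * w.2 := by
    simp only [Prod.snd_add, Prod.smul_snd, Prod.snd_sub, smul_eq_mul]
    ring
  have h3 : 0 < 1 - ε := by linarith [hε.2]
  rw [mem_halfGuide_iff hθ, ha, hb]
  have h4 : 0 < ε * (Real.pi / 2) := mul_pos hε.1 (by linarith)
  refine ⟨⟨by positivity, ?_⟩, ?_⟩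
  · have := mul_le_mul_of_nonneg_left h1 h3.le
    linarith
  · have := mul_pos hε.1 hw2
    positivity

/-- This makes the even extension of a function vanishing near the Dirichlet part vanish near the
whole boundary of the guide, including the corners on the axis. -/
theorem fold_mem_dirichletBoundary (hθ : θ ∈ Ioo 0 (Real.pi / 2)) {x : ℝ × ℝ}
    (hx : x ∈ frontier (guide θ)) : fold x ∈ dirichletBoundary θ := by
  rw [(isOpen_guide θ).frontier_eq] at hx
  have hmem : fold x ∉ guide θ := fun h => hx.2 (fold_mem_guide.1 h)
  have hcl : fold x ∈ closure (halfGuide θ) := by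
    refine subset_closure_halfGuide hθ ⟨?_, abs_nonneg _⟩
    have hsub : closure (guide θ) ⊆ {x | across θ (fold x) ∈ Icc 0 Real.pi} :=
      closure_minimal (fun y hy => Ioo_subset_Icc_self ((mem_guide_iff hθ).1 hy))
        (isClosed_Icc.preimage (contDiff_across.continuous.comp continuous_fold))
    exact hsub hx.1
  refine ⟨?_, ?_⟩
  · rw [(isOpen_guide θ).frontier_eq]
    exact ⟨closure_mono halfGuide_subset hcl, hmem⟩
  · rw [(isOpen_halfGuide θ).frontier_eq]
    exact ⟨hcl, fun h => hmem h.1⟩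

/-- The only boundary points of the half-guide that can escape the Dirichlet part lie on the axis.
-/
theorem mem_dirichletBoundary_of_pos {x : ℝ × ℝ} (hx : x ∈ frontier (halfGuide θ)) (h2 : 0 < x.2) :
    x ∈ dirichletBoundary θ := by
  refine ⟨?_, hx⟩
  rw [(isOpen_halfGuide θ).frontier_eq] at hx
  rw [(isOpen_guide θ).frontier_eq]
  exact ⟨closure_mono halfGuide_subset hx.1, fun h => hx.2 ⟨h, h2⟩⟩

theorem isClosed_dirichletBoundary : IsClosed (dirichletBoundary θ) :=
  isClosed_frontier.inter isClosed_frontier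

theorem reflect_mem_frontier {x : ℝ × ℝ} :
    reflect x ∈ frontier (guide θ) ↔ x ∈ frontier (guide θ) := by
  rw [← mem_preimage, reflect.preimage_frontier, reflect_preimage_guide]

end Geometry

/-! ### Restriction, reflection and extensions -/

section Folds

variable (θ : ℝ)

theorem ae_snd_ne_zero : ∀ᵐ x : ℝ × ℝ, x.2 ≠ 0 := by
  have : {x : ℝ × ℝ | ¬ x.2 ≠ 0} = univ ×ˢ {0} := by
    ext x
    simp
  rw [ae_iff, this, Measure.volume_eq_prod, Measure.prod_prod]
  simp

theorem measurePreserving_reflect :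
    MeasurePreserving reflect (volume : Measure (ℝ × ℝ)) volume := by
  exact (MeasurePreserving.id (volume : Measure ℝ)).prod (Measure.measurePreserving_neg volume)

theorem measurePreserving_reflect_guide :
    MeasurePreserving reflect (volume.restrict (guide θ)) (volume.restrict (guide θ)) := by
  have := measurePreserving_reflect.restrict_preimage (isOpen_guide θ).measurableSet
  rwa [reflect_preimage_guide] at this

theorem isFold_restrict : IsFold id (fun _ => 1) (volume.restrict (halfGuide θ))
    (volume.restrict (guide θ)) where
  measurable := measurable_id
  map_le := by
    rw [Measure.map_id, two_smul]
    exact (Measure.restrict_mono halfGuide_subset le_rfl).trans (Measure.le_add_left le_rfl)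
  measurable_weight := measurable_const
  norm_le := by simp

theorem isFold_reflect : IsFold reflect (fun _ => 1) (volume.restrict (guide θ))
    (volume.restrict (guide θ)) where
  measurable := reflect.continuous.measurable
  map_le := by
    rw [(measurePreserving_reflect_guide θ).map_eq, two_smul]
    exact Measure.le_add_left le_rfl
  measurable_weight := measurable_const
  norm_le := by simp

/-- Off the null axis each point of the half-guide has two preimages, itself and its mirror image.
This is the origin of the factor `2` in `IsFold`. -/
theorem map_fold_le : (volume.restrict (guide θ)).map fold ≤
    (2 : ℝ≥0∞) • volume.restrict (halfGuide θ) := by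
  refine Measure.le_iff.2 fun s hs => ?_
  rw [Measure.map_apply continuous_fold.measurable hs,
    Measure.restrict_apply (continuous_fold.measurable hs), Measure.smul_apply,
    Measure.restrict_apply hs, smul_eq_mul, two_mul]
  have hm : MeasurableSet (s ∩ halfGuide θ) := hs.inter (isOpen_halfGuide θ).measurableSet
  have hsub : fold ⁻¹' s ∩ guide θ ⊆
      ((s ∩ halfGuide θ) ∪ reflect ⁻¹' (s ∩ halfGuide θ)) ∪ {x : ℝ × ℝ | ¬ x.2 ≠ 0} := by
    rintro x ⟨hx, hg⟩
    rcases lt_trichotomy 0 x.2 with h | h | h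
    · left; left
      rw [mem_preimage, fold_of_pos h] at hx
      exact ⟨hx, hg, h⟩
    · right
      simp [h.symm]
    · left; right
      have h' : 0 < (reflect x).2 := by simpa using h
      rw [mem_preimage, ← fold_reflect, fold_of_pos h'] at hx
      exact ⟨hx, reflect_mem_guide.2 hg, h'⟩
  refine (measure_mono hsub).trans ((measure_union_le _ _).trans ?_)
  rw [ae_iff.1 ae_snd_ne_zero, add_zero]
  refine (measure_union_le _ _).trans ?_
  rw [measurePreserving_reflect.measure_preimage hm.nullMeasurableSet]

theorem isFold_even : IsFold fold (fun _ => 1) (volume.restrict (guide θ))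
    (volume.restrict (halfGuide θ)) where
  measurable := continuous_fold.measurable
  map_le := map_fold_le θ
  measurable_weight := measurable_const
  norm_le := by simp

/-- The sign of the second coordinate. -/
noncomputable def sgn (t : ℝ) : ℝ := if 0 < t then 1 else -1

theorem isFold_odd : IsFold fold (fun x => (sgn x.2 : ℂ)) (volume.restrict (guide θ))
    (volume.restrict (halfGuide θ)) where
  measurable := continuous_fold.measurable
  map_le := map_fold_le θ
  measurable_weight := by
    unfold sgn
    exact Complex.measurable_ofReal.comp
      (Measurable.ite (measurableSet_lt measurable_const measurable_snd) measurable_const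
        measurable_const)
  norm_le := fun x => by
    unfold sgn
    split_ifs <;> simp

/-- The restriction from the guide to the half-guide. -/
noncomputable def restr : L2 (guide θ) →L[ℂ] L2 (halfGuide θ) := wcomp (isFold_restrict θ)

/-- The reflection of functions on the guide. -/
noncomputable def refl : L2 (guide θ) →L[ℂ] L2 (guide θ) := wcomp (isFold_reflect θ)

/-- The even extension from the half-guide to the guide. -/
noncomputable def evenExt : L2 (halfGuide θ) →L[ℂ] L2 (guide θ) := wcomp (isFold_even θ)

/-- The odd extension from the half-guide to the guide. -/
noncomputable def oddExt : L2 (halfGuide θ) →L[ℂ] L2 (guide θ) := wcomp (isFold_odd θ)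

variable {θ}

theorem ae_halfGuide_of_ae_guide {p : ℝ × ℝ → Prop} (h : ∀ᵐ x ∂volume.restrict (guide θ), p x) :
    ∀ᵐ x ∂volume.restrict (halfGuide θ), p x :=
  ae_mono (Measure.restrict_mono halfGuide_subset le_rfl) h

theorem restr_ae (u : L2 (guide θ)) : restr θ u =ᵐ[volume.restrict (halfGuide θ)] u := by
  filter_upwards [wcomp_coeFn (isFold_restrict θ) u] with x hx
  rw [restr, hx, one_mul, id]

theorem refl_ae (u : L2 (guide θ)) :
    refl θ u =ᵐ[volume.restrict (guide θ)] fun x => u (reflect x) := by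
  filter_upwards [wcomp_coeFn (isFold_reflect θ) u] with x hx
  rw [refl, hx, one_mul]

theorem ae_reflect {p : ℝ × ℝ → Prop} (h : ∀ᵐ x ∂volume.restrict (guide θ), p x) :
    ∀ᵐ x ∂volume.restrict (guide θ), p (reflect x) :=
  (measurePreserving_reflect_guide θ).quasiMeasurePreserving.ae h

theorem refl_refl (u : L2 (guide θ)) : refl θ (refl θ u) = u := by
  refine Lp.ext ?_
  filter_upwards [refl_ae (refl θ u), ae_reflect (refl_ae u)] with x h1 h2
  rw [h1, h2, reflect_reflect]

theorem restr_evenExt (g : L2 (halfGuide θ)) : restr θ (evenExt θ g) = g := by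
  refine Lp.ext ?_
  filter_upwards [restr_ae (evenExt θ g), ae_halfGuide_of_ae_guide (wcomp_coeFn (isFold_even θ) g),
    ae_restrict_mem (isOpen_halfGuide θ).measurableSet] with x h1 h2 h3
  rw [h1, evenExt, h2, one_mul, fold_of_pos h3.2]

theorem restr_oddExt (g : L2 (halfGuide θ)) : restr θ (oddExt θ g) = g := by
  refine Lp.ext ?_
  filter_upwards [restr_ae (oddExt θ g), ae_halfGuide_of_ae_guide (wcomp_coeFn (isFold_odd θ) g),
    ae_restrict_mem (isOpen_halfGuide θ).measurableSet] with x h1 h2 h3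
  rw [h1, oddExt, h2, fold_of_pos h3.2, sgn, if_pos h3.2]
  simp

theorem refl_evenExt (g : L2 (halfGuide θ)) : refl θ (evenExt θ g) = evenExt θ g := by
  refine Lp.ext ?_
  have h := wcomp_coeFn (isFold_even θ) g
  filter_upwards [refl_ae (evenExt θ g), h, ae_reflect h] with x h1 h2 h3
  rw [h1, evenExt, h3, h2, fold_reflect]

theorem refl_oddExt (g : L2 (halfGuide θ)) : refl θ (oddExt θ g) = - oddExt θ g := by
  refine Lp.ext ?_
  have h := wcomp_coeFn (isFold_odd θ) g
  filter_upwards [refl_ae (oddExt θ g), h, ae_reflect h, Lp.coeFn_neg (oddExt θ g),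
    ae_restrict_of_ae ae_snd_ne_zero] with x h1 h2 h3 h4 h5
  rw [h1, h4, Pi.neg_apply, oddExt, h3, h2, fold_reflect, ← neg_mul]
  congr 1
  -- By convention `sgn 0 = -1`, so oddness of `sgn` holds only off the axis.
  rcases lt_or_gt_of_ne h5 with h | h
  · simp [sgn, h, h.not_gt]
  · simp [sgn, h, h.not_gt]

theorem setIntegral_guide {h : ℝ × ℝ → ℂ} (hi : IntegrableOn h (guide θ)) :
    ∫ x in guide θ, h x =
      (∫ x in halfGuide θ, h x) + ∫ x in halfGuide θ, h (reflect x) := by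
  have hae : guide θ =ᵐ[volume] (halfGuide θ ∪ reflect ⁻¹' halfGuide θ : Set (ℝ × ℝ)) := by
    filter_upwards [ae_snd_ne_zero] with x hx
    refine propext ⟨fun hg => ?_, ?_⟩
    · rcases lt_or_gt_of_ne hx with h | h
      · exact Or.inr ⟨reflect_mem_guide.2 hg, by simpa using h⟩
      · exact Or.inl ⟨hg, h⟩
    · rintro (h | h)
      · exact h.1
      · exact reflect_mem_guide.1 h.1
  have hm := (isOpen_halfGuide θ).measurableSet
  have hd : Disjoint (halfGuide θ) (reflect ⁻¹' halfGuide θ) := by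
    rw [Set.disjoint_left]
    rintro x h1 h2
    have h3 : 0 < -x.2 := h2.2
    linarith [h1.2]
  have hsub : reflect ⁻¹' halfGuide θ ⊆ guide θ := fun x hx => reflect_mem_guide.1 hx.1
  rw [setIntegral_congr_set hae, setIntegral_union hd (reflect.continuous.measurable hm)
    (hi.mono_set halfGuide_subset) (hi.mono_set hsub)]
  congr 1
  rw [← measurePreserving_reflect.setIntegral_preimage_emb reflect.measurableEmbedding
    (fun x => h (reflect x))]
  simp only [reflect_reflect]

/-- Up to a null set the guide is the half-guide and its mirror image, and the second integral is
carried back by the reflection. -/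
theorem inner_eq_add (u v : L2 (guide θ)) :
    inner ℂ u v = inner ℂ (restr θ u) (restr θ v) +
      inner ℂ (restr θ (refl θ u)) (restr θ (refl θ v)) := by
  rw [L2.inner_def, setIntegral_guide (L2.integrable_inner u v), L2.inner_def, L2.inner_def]
  congr 1
  · refine integral_congr_ae ?_
    filter_upwards [restr_ae u, restr_ae v] with x h1 h2
    rw [h1, h2]
  · refine integral_congr_ae ?_
    filter_upwards [restr_ae (refl θ u), restr_ae (refl θ v), ae_halfGuide_of_ae_guide (refl_ae u),
      ae_halfGuide_of_ae_guide (refl_ae v)] with x h1 h2 h3 h4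
    rw [h1, h2, h3, h4]

theorem inner_refl_refl (u v : L2 (guide θ)) : inner ℂ (refl θ u) (refl θ v) = inner ℂ u v := by
  rw [inner_eq_add, inner_eq_add u v, refl_refl, refl_refl, add_comm]

/-- The adjoint of even extension is the restriction of `1 + refl`; that of odd extension, below, is
the restriction of `1 - refl`. Forms on the guide and on the half-guide are compared through these
identities. -/
theorem inner_evenExt_right (u : L2 (guide θ)) (g : L2 (halfGuide θ)) :
    inner ℂ u (evenExt θ g) = inner ℂ (restr θ (u + refl θ u)) g := by
  rw [inner_eq_add, refl_evenExt, restr_evenExt, map_add, inner_add_left]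

theorem inner_oddExt_right (u : L2 (guide θ)) (g : L2 (halfGuide θ)) :
    inner ℂ u (oddExt θ g) = inner ℂ (restr θ (u - refl θ u)) g := by
  rw [inner_eq_add, refl_oddExt, map_neg, restr_oddExt, map_sub, inner_sub_left, inner_neg_right]
  ring

theorem inner_evenExt_left (u : L2 (guide θ)) (g : L2 (halfGuide θ)) :
    inner ℂ (evenExt θ g) u = inner ℂ g (restr θ (u + refl θ u)) := by
  rw [← inner_conj_symm, inner_evenExt_right, inner_conj_symm]

theorem inner_oddExt_left (u : L2 (guide θ)) (g : L2 (halfGuide θ)) :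
    inner ℂ (oddExt θ g) u = inner ℂ g (restr θ (u - refl θ u)) := by
  rw [← inner_conj_symm, inner_oddExt_right, inner_conj_symm]

theorem norm_sq_eq_of_refl {u : L2 (guide θ)} (h : refl θ u = u ∨ refl θ u = -u) :
    ‖u‖ ^ 2 = 2 * ‖restr θ u‖ ^ 2 := by
  have h1 := inner_eq_add u u
  have h2 : inner ℂ (restr θ (refl θ u)) (restr θ (refl θ u)) =
      inner ℂ (restr θ u) (restr θ u) := by
    rcases h with h | h <;> simp [h]
  rw [h2, ← two_mul, inner_self_eq_norm_sq_to_K, inner_self_eq_norm_sq_to_K] at h1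
  exact Complex.ofReal_injective (by simpa using h1)

theorem eq_zero_of_restr_eq_zero {u : L2 (guide θ)} (h : refl θ u = u) (h0 : restr θ u = 0) :
    u = 0 := by
  have := norm_sq_eq_of_refl (Or.inl h)
  rw [h0] at this
  simpa using this

end Folds

/-! ### Composition with functions of the second variable -/

section CompSnd

variable {S U Γ : Set (ℝ × ℝ)} {φ : ℝ × ℝ → ℂ} {h : ℝ → ℝ}

theorem tsupport_comp_snd_subset (φ : ℝ × ℝ → ℂ) (hh : Continuous h) :
    tsupport (fun x : ℝ × ℝ => φ (x.1, h x.2)) ⊆ {x | (x.1, h x.2) ∈ tsupport φ} :=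
  closure_minimal (fun _ hx => subset_tsupport φ hx)
    ((isClosed_tsupport φ).preimage (by fun_prop))

theorem IsTest.fderiv_comp_snd (hφ : IsTest S φ) (hh : ContDiff ℝ ∞ h) (x v : ℝ × ℝ) :
    fderiv ℝ (fun x : ℝ × ℝ => φ (x.1, h x.2)) x v =
      fderiv ℝ φ (x.1, h x.2) (v.1, v.2 * deriv h x.2) := by
  have h1 : HasDerivAt h (deriv h x.2) x.2 :=
    (hh.differentiable (by simp) x.2).hasDerivAt
  have h2 := (hasFDerivAt_fst (𝕜 := ℝ) (p := x)).prodMk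
    (h1.hasFDerivAt.comp x (hasFDerivAt_snd (𝕜 := ℝ) (p := x)))
  have h3 := (hφ.differentiable (x.1, h x.2)).hasFDerivAt.comp x h2
  have h4 := h3.fderiv
  simp only [Function.comp_def] at h4
  rw [h4]
  simp

theorem IsTest.pd1_comp_snd (hφ : IsTest S φ) (hh : ContDiff ℝ ∞ h) (x : ℝ × ℝ) :
    pd1 (fun x : ℝ × ℝ => φ (x.1, h x.2)) x = pd1 φ (x.1, h x.2) := by
  simp [pd1, hφ.fderiv_comp_snd hh]

theorem IsTest.pd2_comp_snd (hφ : IsTest S φ) (hh : ContDiff ℝ ∞ h) (x : ℝ × ℝ) :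
    pd2 (fun x : ℝ × ℝ => φ (x.1, h x.2)) x = deriv h x.2 * pd2 φ (x.1, h x.2) := by
  have : ((0 : ℝ), deriv h x.2) = deriv h x.2 • ((0 : ℝ), (1 : ℝ)) := by simp
  rw [pd2, hφ.fderiv_comp_snd hh, one_mul, this, map_smul, pd2, Complex.real_smul]

theorem IsTest.exists_bound (hφ : IsTest S φ) :
    ∃ C, 0 ≤ C ∧ (∀ x, ‖φ x‖ ≤ C) ∧ (∀ x, ‖pd1 φ x‖ ≤ C) ∧ ∀ x, ‖pd2 φ x‖ ≤ C := by
  obtain ⟨C0, h0⟩ := hφ.compact.exists_bound_of_continuous hφ.smooth.continuous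
  obtain ⟨C1, h1⟩ := (hφ.compact_pd (1, 0)).exists_bound_of_continuous (hφ.continuous_pd (1, 0))
  obtain ⟨C2, h2⟩ := (hφ.compact_pd (0, 1)).exists_bound_of_continuous (hφ.continuous_pd (0, 1))
  refine ⟨max C0 (max C1 C2), ((norm_nonneg _).trans (h0 0)).trans (le_max_left _ _),
    fun x => (h0 x).trans (le_max_left _ _),
    fun x => (h1 x).trans ((le_max_left _ _).trans (le_max_right _ _)),
    fun x => (h2 x).trans ((le_max_right _ _).trans (le_max_right _ _))⟩

/-- Deforming only the second variable, through profiles `h n` with uniformly bounded slopes, keeps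
the gradients of `φ (x₁, h n x₂)` bounded. It is used with profiles tending to `|t|` for even
extension, and with profiles vanishing near `0` and tending to `t` on the half-guide for odd
functions. -/
theorem IsTest.comp_snd_mem_formDomain (hU : IsOpen U) (hφ : IsTest S φ) {h : ℕ → ℝ → ℝ}
    (hh : ∀ n, ContDiff ℝ ∞ (h n)) {D : ℝ} (hD : ∀ n t, |deriv (h n) t| ≤ D)
    {K : Set (ℝ × ℝ)} (hK : IsCompact K)
    (hsupp : ∀ n, tsupport (fun x : ℝ × ℝ => φ (x.1, h n x.2)) ⊆ K ∩ Γᶜ) {k d : ℝ → ℝ}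
    (hlim : ∀ᵐ x ∂volume.restrict U, Tendsto (fun n => h n x.2) atTop (𝓝 (k x.2)))
    (hlim' : ∀ᵐ x ∂volume.restrict U, Tendsto (fun n => deriv (h n) x.2) atTop (𝓝 (d x.2)))
    {p : L2 U × L2 U × L2 U}
    (l0 : p.1 =ᵐ[volume.restrict U] fun x => φ (x.1, k x.2))
    (l1 : p.2.1 =ᵐ[volume.restrict U] fun x => pd1 φ (x.1, k x.2))
    (l2 : p.2.2 =ᵐ[volume.restrict U] fun x => d x.2 * pd2 φ (x.1, k x.2)) :
    p ∈ formDomain U Γ := by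
  obtain ⟨C, hC, b0, b1, b2⟩ := hφ.exists_bound
  have hD0 : 0 ≤ D := (abs_nonneg _).trans (hD 0 0)
  have hpair : ∀ x : ℝ × ℝ, Tendsto (fun n => h n x.2) atTop (𝓝 (k x.2)) →
      Tendsto (fun n => (x.1, h n x.2)) atTop (𝓝 (x.1, k x.2)) := fun x hx =>
    tendsto_const_nhds.prodMk_nhds hx
  refine mem_formDomain_of_tendsto hU (ψ := fun n x => φ (x.1, h n x.2)) (C := C * (1 + D))
    (fun n => ⟨?_, ?_, fun x hx => (hsupp n hx).2⟩) hK (fun n x hx => (hsupp n hx).1)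
    (fun n x => ?_) (fun n x => ?_) (fun n x => ?_) ?_ ?_ ?_
  · have := hh n
    exact hφ.smooth.comp (by fun_prop)
  · exact hK.of_isClosed_subset (isClosed_tsupport _) fun x hx => (hsupp n hx).1
  · exact (b0 _).trans (by nlinarith)
  · rw [hφ.pd1_comp_snd (hh n)]
    exact (b1 _).trans (by nlinarith)
  · rw [hφ.pd2_comp_snd (hh n), norm_mul, Complex.norm_real, Real.norm_eq_abs]
    calc |deriv (h n) x.2| * ‖pd2 φ (x.1, h n x.2)‖ ≤ D * C :=
          mul_le_mul (hD _ _) (b2 _) (norm_nonneg _) hD0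
      _ ≤ C * (1 + D) := by nlinarith
  · filter_upwards [hlim, l0] with x h1 h2
    rw [h2]
    exact (hφ.smooth.continuous.tendsto _).comp (hpair x h1)
  · filter_upwards [hlim, l1] with x h1 h2
    rw [h2]
    simp only [hφ.pd1_comp_snd (hh _)]
    exact ((hφ.continuous_pd (1, 0)).tendsto _).comp (hpair x h1)
  · filter_upwards [hlim, hlim', l2] with x h1 h2 h3
    rw [h3]
    simp only [hφ.pd2_comp_snd (hh _)]
    exact ((Complex.continuous_ofReal.tendsto _).comp h2).mul
      (((hφ.continuous_pd (0, 1)).tendsto _).comp (hpair x h1))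

/-- A compact support avoiding a closed set stays away from it. -/
theorem IsTest.exists_dist (hφ : IsTest Γᶜ φ) (hΓ : IsClosed Γ) :
    ∃ δ > 0, ∀ x ∈ tsupport φ, ∀ y ∈ Γ, δ ≤ dist x y := by
  obtain ⟨δ, hδ, hdis⟩ := Disjoint.exists_thickenings
    (disjoint_left.2 fun x hx hx' => hφ.supp hx hx') hφ.compact hΓ
  refine ⟨δ, hδ, fun x hx y hy => ?_⟩
  by_contra! hlt
  exact Set.disjoint_left.1 hdis (Metric.mem_thickening_iff.2 ⟨x, hx, by rwa [dist_comm]⟩)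
    (Metric.self_subset_thickening hδ _ hy)

theorem IsTest.exists_box (hφ : IsTest S φ) :
    ∃ M, 0 ≤ M ∧ ∀ x ∈ tsupport φ, |x.1| ≤ M ∧ |x.2| ≤ M := by
  obtain ⟨M, hM⟩ := hφ.compact.isBounded.exists_norm_le
  refine ⟨max M 0, le_max_right _ _, fun x hx => ?_⟩
  have := (hM x hx).trans (le_max_left M 0)
  exact ⟨(norm_fst_le x).trans this, (norm_snd_le x).trans this⟩

end CompSnd

/-! ### Smooth approximations of the absolute value and of the positive part -/

section Profiles

/-- A smooth approximation of the absolute value. -/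
noncomputable def smoothAbs (ε t : ℝ) : ℝ := Real.sqrt (t ^ 2 + ε ^ 2)

theorem smoothAbs_arg_pos {ε : ℝ} (hε : 0 < ε) (t : ℝ) : 0 < t ^ 2 + ε ^ 2 := by positivity

theorem contDiff_smoothAbs {ε : ℝ} (hε : 0 < ε) : ContDiff ℝ ∞ (smoothAbs ε) :=
  ContDiff.sqrt (by fun_prop) fun t => (smoothAbs_arg_pos hε t).ne'

theorem abs_le_smoothAbs (ε t : ℝ) : |t| ≤ smoothAbs ε t := by
  rw [smoothAbs, ← Real.sqrt_sq_eq_abs]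
  exact Real.sqrt_le_sqrt (by nlinarith [sq_nonneg ε])

theorem smoothAbs_le {ε : ℝ} (hε : 0 < ε) (t : ℝ) : smoothAbs ε t ≤ |t| + ε := by
  refine Real.sqrt_le_iff.2 ⟨by positivity, ?_⟩
  nlinarith [sq_abs t, abs_nonneg t]

theorem deriv_smoothAbs {ε : ℝ} (hε : 0 < ε) (t : ℝ) :
    deriv (smoothAbs ε) t = t / smoothAbs ε t := by
  have h1 : HasDerivAt (fun t : ℝ => t ^ 2 + ε ^ 2) (2 * t) t := by
    simpa using (hasDerivAt_pow 2 t).add_const (ε ^ 2)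
  have h2 := h1.sqrt (smoothAbs_arg_pos hε t).ne'
  rw [show smoothAbs ε = fun t => Real.sqrt (t ^ 2 + ε ^ 2) from rfl, h2.deriv]
  ring

theorem abs_deriv_smoothAbs_le {ε : ℝ} (hε : 0 < ε) (t : ℝ) : |deriv (smoothAbs ε) t| ≤ 1 := by
  have h := abs_le_smoothAbs ε t
  rw [deriv_smoothAbs hε, abs_div, abs_of_nonneg ((abs_nonneg t).trans h)]
  exact div_le_one_of_le₀ h (Real.sqrt_nonneg _)

theorem tendsto_smoothAbs {ε : ℕ → ℝ} (hε : Tendsto ε atTop (𝓝 0)) (t : ℝ) :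
    Tendsto (fun n => smoothAbs (ε n) t) atTop (𝓝 |t|) := by
  have : Continuous fun e : ℝ => smoothAbs e t := by unfold smoothAbs; fun_prop
  simpa [smoothAbs, Real.sqrt_sq_eq_abs, Function.comp_def] using (this.tendsto 0).comp hε

theorem tendsto_deriv_smoothAbs {ε : ℕ → ℝ} (hε0 : ∀ n, 0 < ε n) (hε : Tendsto ε atTop (𝓝 0))
    {t : ℝ} (ht : t ≠ 0) : Tendsto (fun n => deriv (smoothAbs (ε n)) t) atTop (𝓝 (sgn t)) := by
  simp only [deriv_smoothAbs (hε0 _)]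
  have h : t / |t| = sgn t := by
    rcases lt_or_gt_of_ne ht with h | h
    · rw [abs_of_neg h, sgn, if_neg h.not_gt]
      field_simp
    · rw [abs_of_pos h, sgn, if_pos h]
      field_simp
  rw [← h]
  exact tendsto_const_nhds.div (tendsto_smoothAbs hε t) (abs_ne_zero.2 ht)

/-- A smooth approximation of the positive part, vanishing on `(-∞, ε]` and equal to the identity
on `[2ε, ∞)`. -/
noncomputable def ramp (ε t : ℝ) : ℝ := t * Real.smoothTransition (t / ε - 1)

theorem contDiff_ramp (ε : ℝ) : ContDiff ℝ ∞ (ramp ε) := by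
  unfold ramp
  exact contDiff_id.mul (Real.smoothTransition.contDiff.comp (by fun_prop))

theorem ramp_eq_zero {ε t : ℝ} (hε : 0 < ε) (ht : t ≤ ε) : ramp ε t = 0 := by
  rw [ramp, Real.smoothTransition.zero_of_nonpos, mul_zero]
  rw [sub_nonpos, div_le_one hε]
  exact ht

theorem ramp_eq_self {ε t : ℝ} (hε : 0 < ε) (ht : 2 * ε ≤ t) : ramp ε t = t := by
  rw [ramp, Real.smoothTransition.one_of_one_le, mul_one]
  rw [le_sub_iff_add_le, le_div_iff₀ hε]
  linarith

theorem abs_ramp_sub_le {ε t : ℝ} (hε : 0 < ε) (ht : 0 ≤ t) : |ramp ε t - t| ≤ 2 * ε := by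
  rcases le_total (2 * ε) t with h | h
  · rw [ramp_eq_self hε h, sub_self, abs_zero]
    positivity
  · have h0 := Real.smoothTransition.nonneg (t / ε - 1)
    have h1 := Real.smoothTransition.le_one (t / ε - 1)
    rw [ramp, abs_le]
    constructor <;> nlinarith

theorem hasDerivAt_ramp (ε t : ℝ) : HasDerivAt (ramp ε)
    (Real.smoothTransition (t / ε - 1) +
      t / ε * deriv Real.smoothTransition (t / ε - 1)) t := by
  have hd : Differentiable ℝ Real.smoothTransition :=
    (Real.smoothTransition.contDiff (n := 1)).differentiable (by simp)
  have h1 : HasDerivAt (fun t : ℝ => t / ε - 1) (1 / ε) t :=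
    ((hasDerivAt_id t).div_const ε).sub_const 1
  have h2 := (hasDerivAt_id t).mul ((hd (t / ε - 1)).hasDerivAt.comp t h1)
  refine h2.congr_deriv ?_
  simp only [Function.comp_apply, id_eq]
  ring

/-- In the variable `y = t / ε - 1` the derivative is `S y + (y + 1) S' y`, with `S` the smooth
transition: it no longer involves `ε`, and `S'` vanishes off `[0, 1]`. -/
theorem exists_bound_deriv_ramp : ∃ D : ℝ, ∀ ε t, |deriv (ramp ε) t| ≤ D := by
  have hc : Continuous fun y : ℝ => (y + 1) * deriv Real.smoothTransition y :=
    (continuous_id.add continuous_const).mul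
      ((Real.smoothTransition.contDiff (n := 1)).continuous_deriv le_rfl)
  have hs : HasCompactSupport fun y : ℝ => (y + 1) * deriv Real.smoothTransition y := by
    refine HasCompactSupport.intro (isCompact_Icc (a := (0 : ℝ)) (b := 1)) fun y hy => ?_
    have hzero : deriv Real.smoothTransition y = 0 := by
      rcases lt_or_ge y 0 with h | h
      · have : Real.smoothTransition =ᶠ[𝓝 y] fun _ => 0 := by
          filter_upwards [Iio_mem_nhds h] with u hu
          exact Real.smoothTransition.zero_of_nonpos (le_of_lt hu)
        rw [this.deriv_eq, deriv_const]
      · have h1 : 1 < y := by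
          by_contra! h2
          exact hy ⟨h, h2⟩
        have : Real.smoothTransition =ᶠ[𝓝 y] fun _ => 1 := by
          filter_upwards [Ioi_mem_nhds h1] with u hu
          exact Real.smoothTransition.one_of_one_le (le_of_lt hu)
        rw [this.deriv_eq, deriv_const]
    rw [hzero, mul_zero]
  obtain ⟨D, hD⟩ := hs.exists_bound_of_continuous hc
  refine ⟨1 + D, fun ε t => ?_⟩
  rw [(hasDerivAt_ramp ε t).deriv]
  refine (abs_add_le _ _).trans (add_le_add ?_ ?_)
  · rw [abs_of_nonneg (Real.smoothTransition.nonneg _)]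
    exact Real.smoothTransition.le_one _
  · simpa [abs_div] using hD (t / ε - 1)

theorem eventually_two_mul_lt {ε : ℕ → ℝ} (hε : Tendsto ε atTop (𝓝 0)) {t : ℝ} (ht : 0 < t) :
    ∀ᶠ n in atTop, 2 * ε n < t := by
  have := hε.const_mul 2
  rw [mul_zero] at this
  exact this.eventually_lt_const ht

theorem tendsto_ramp {ε : ℕ → ℝ} (hε0 : ∀ n, 0 < ε n) (hε : Tendsto ε atTop (𝓝 0))
    {t : ℝ} (ht : 0 < t) : Tendsto (fun n => ramp (ε n) t) atTop (𝓝 t) := by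
  refine tendsto_const_nhds.congr' ?_
  filter_upwards [eventually_two_mul_lt hε ht] with n hn
  rw [ramp_eq_self (hε0 n) hn.le]

theorem tendsto_deriv_ramp {ε : ℕ → ℝ} (hε0 : ∀ n, 0 < ε n) (hε : Tendsto ε atTop (𝓝 0))
    {t : ℝ} (ht : 0 < t) : Tendsto (fun n => deriv (ramp (ε n)) t) atTop (𝓝 1) := by
  refine tendsto_const_nhds.congr' ?_
  filter_upwards [eventually_two_mul_lt hε ht] with n hn
  have : ramp (ε n) =ᶠ[𝓝 t] id := by
    filter_upwards [Ioi_mem_nhds hn] with u hu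
    exact ramp_eq_self (hε0 n) (le_of_lt hu)
  rw [this.deriv_eq, deriv_id]

/-- A sequence of positive numbers at most `δ` and tending to `0`. -/
noncomputable def scale (δ : ℝ) (n : ℕ) : ℝ := δ / (n + 1)

theorem scale_pos {δ : ℝ} (hδ : 0 < δ) (n : ℕ) : 0 < scale δ n := by
  unfold scale
  positivity

theorem scale_le {δ : ℝ} (hδ : 0 < δ) (n : ℕ) : scale δ n ≤ δ :=
  div_le_self hδ.le (by linarith [n.cast_nonneg (α := ℝ)])

theorem tendsto_scale (δ : ℝ) : Tendsto (scale δ) atTop (𝓝 0) := by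
  have := (tendsto_one_div_add_atTop_nhds_zero_nat (𝕜 := ℝ)).const_mul δ
  simp only [mul_zero, mul_one_div] at this
  exact this

end Profiles

/-! ### Action on the form domains -/

section Triples

variable {U Γ : Set (ℝ × ℝ)} {θ : ℝ}

/-- The triple `p` is given by the function `φ` and its partial derivatives. -/
structure Represents (U : Set (ℝ × ℝ)) (p : L2 U × L2 U × L2 U) (φ : ℝ × ℝ → ℂ) : Prop where
  val : p.1 =ᵐ[volume.restrict U] φ
  pd1 : p.2.1 =ᵐ[volume.restrict U] pd1 φ
  pd2 : p.2.2 =ᵐ[volume.restrict U] pd2 φ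

theorem mem_smoothTriples {p : L2 U × L2 U × L2 U} :
    p ∈ smoothTriples U Γ ↔ ∃ φ, IsTest Γᶜ φ ∧ Represents U p φ :=
  ⟨fun ⟨φ, h, h0, h1, h2⟩ => ⟨φ, h, h0, h1, h2⟩,
    fun ⟨φ, h, h'⟩ => ⟨φ, h, h'.val, h'.pd1, h'.pd2⟩⟩

theorem Represents.sub {S : Set (ℝ × ℝ)} {p q : L2 U × L2 U × L2 U} {φ ψ : ℝ × ℝ → ℂ}
    (hp : Represents U p φ) (hq : Represents U q ψ) (hφ : IsTest S φ) (hψ : IsTest S ψ) :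
    Represents U (p - q) (fun x => φ x - ψ x) := by
  refine ⟨?_, ?_, ?_⟩
  · filter_upwards [hp.val, hq.val, Lp.coeFn_sub p.1 q.1] with x h1 h2 h3
    rw [Prod.fst_sub, h3, Pi.sub_apply, h1, h2]
  · filter_upwards [hp.pd1, hq.pd1, Lp.coeFn_sub p.2.1 q.2.1] with x h1 h2 h3
    rw [Prod.snd_sub, Prod.fst_sub, h3, Pi.sub_apply, h1, h2]
    simp [BrokenGuide.pd1, fderiv_fun_sub (hφ.differentiable x) (hψ.differentiable x)]
  · filter_upwards [hp.pd2, hq.pd2, Lp.coeFn_sub p.2.2 q.2.2] with x h1 h2 h3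
    rw [Prod.snd_sub, Prod.snd_sub, h3, Pi.sub_apply, h1, h2]
    simp [BrokenGuide.pd2, fderiv_fun_sub (hφ.differentiable x) (hψ.differentiable x)]

variable (θ)

/-- The restriction of functions with their gradients. -/
noncomputable def restr3 : L2 (guide θ) × L2 (guide θ) × L2 (guide θ) →L[ℂ]
    L2 (halfGuide θ) × L2 (halfGuide θ) × L2 (halfGuide θ) :=
  (restr θ).prodMap ((restr θ).prodMap (restr θ))

/-- The reflection of functions with their gradients. -/
noncomputable def refl3 : L2 (guide θ) × L2 (guide θ) × L2 (guide θ) →L[ℂ]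
    L2 (guide θ) × L2 (guide θ) × L2 (guide θ) :=
  (refl θ).prodMap ((refl θ).prodMap (-refl θ))

/-- The even extension of functions with their gradients. -/
noncomputable def evenExt3 : L2 (halfGuide θ) × L2 (halfGuide θ) × L2 (halfGuide θ) →L[ℂ]
    L2 (guide θ) × L2 (guide θ) × L2 (guide θ) :=
  (evenExt θ).prodMap ((evenExt θ).prodMap (oddExt θ))

variable {θ}

@[simp] theorem restr3_apply (p : L2 (guide θ) × L2 (guide θ) × L2 (guide θ)) :
    restr3 θ p = (restr θ p.1, restr θ p.2.1, restr θ p.2.2) := rfl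

@[simp] theorem refl3_apply (p : L2 (guide θ) × L2 (guide θ) × L2 (guide θ)) :
    refl3 θ p = (refl θ p.1, refl θ p.2.1, - refl θ p.2.2) := rfl

@[simp] theorem evenExt3_apply (p : L2 (halfGuide θ) × L2 (halfGuide θ) × L2 (halfGuide θ)) :
    evenExt3 θ p = (evenExt θ p.1, evenExt θ p.2.1, oddExt θ p.2.2) := rfl

theorem Represents.restr3 {p : L2 (guide θ) × L2 (guide θ) × L2 (guide θ)} {φ : ℝ × ℝ → ℂ}
    (hp : Represents (guide θ) p φ) : Represents (halfGuide θ) (restr3 θ p) φ :=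
  ⟨(restr_ae p.1).trans (ae_halfGuide_of_ae_guide hp.val),
    (restr_ae p.2.1).trans (ae_halfGuide_of_ae_guide hp.pd1),
    (restr_ae p.2.2).trans (ae_halfGuide_of_ae_guide hp.pd2)⟩

theorem restr3_mem {p : L2 (guide θ) × L2 (guide θ) × L2 (guide θ)}
    (hp : p ∈ formDomain (guide θ) (frontier (guide θ))) :
    restr3 θ p ∈ formDomain (halfGuide θ) (dirichletBoundary θ) := by
  refine map_mem_of_mem_formDomain (isOpen_guide θ) (isClosed_formDomain (isOpen_halfGuide θ))
    _ (fun q hq => ?_) hp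
  obtain ⟨φ, hφ, hq⟩ := mem_smoothTriples.1 hq
  exact smoothTriples_le_formDomain (isOpen_halfGuide θ) (mem_smoothTriples.2
    ⟨φ, hφ.mono (compl_subset_compl.2 inter_subset_left), hq.restr3⟩)

theorem IsTest.reflect {φ : ℝ × ℝ → ℂ} (hφ : IsTest (frontier (guide θ))ᶜ φ) :
    IsTest (frontier (guide θ))ᶜ (fun x => φ (x.1, -x.2)) := by
  refine ⟨hφ.smooth.comp (by fun_prop), ?_, fun x hx => ?_⟩
  · exact hφ.compact.comp_homeomorph BrokenGuide.reflect
  · have := tsupport_comp_snd_subset φ (h := fun t => -t) continuous_neg hx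
    exact fun h => hφ.supp this (reflect_mem_frontier.2 h)

theorem Represents.refl3 {S : Set (ℝ × ℝ)} {p : L2 (guide θ) × L2 (guide θ) × L2 (guide θ)}
    {φ : ℝ × ℝ → ℂ} (hφ : IsTest S φ) (hp : Represents (guide θ) p φ) :
    Represents (guide θ) (refl3 θ p) (fun x => φ (x.1, -x.2)) := by
  have hn : ContDiff ℝ ∞ fun t : ℝ => -t := contDiff_neg
  refine ⟨?_, ?_, ?_⟩
  · filter_upwards [refl_ae p.1, ae_reflect hp.val] with x h1 h2
    rw [refl3_apply, h1, h2, reflect_apply]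
  · filter_upwards [refl_ae p.2.1, ae_reflect hp.pd1] with x h1 h2
    rw [refl3_apply, h1, h2, reflect_apply, hφ.pd1_comp_snd hn]
  · filter_upwards [refl_ae p.2.2, ae_reflect hp.pd2, Lp.coeFn_neg (refl θ p.2.2)] with x h1 h2 h3
    rw [refl3_apply, h3, Pi.neg_apply, h1, h2, reflect_apply, hφ.pd2_comp_snd hn]
    simp

theorem refl3_mem {p : L2 (guide θ) × L2 (guide θ) × L2 (guide θ)}
    (hp : p ∈ formDomain (guide θ) (frontier (guide θ))) :
    refl3 θ p ∈ formDomain (guide θ) (frontier (guide θ)) := by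
  refine map_mem_of_mem_formDomain (isOpen_guide θ) (isClosed_formDomain (isOpen_guide θ))
    _ (fun q hq => ?_) hp
  obtain ⟨φ, hφ, hq⟩ := mem_smoothTriples.1 hq
  exact smoothTriples_le_formDomain (isOpen_guide θ)
    (mem_smoothTriples.2 ⟨_, hφ.reflect, hq.refl3 hφ⟩)

/-- The function `φ (x₁, |x₂|)` is the limit of `φ (x₁, √(x₂² + ε²))`, whose second derivative tends
to `sgn x₂` times the folded `∂₂φ`. Hence the odd extension in the third slot. -/
theorem evenExt3_mem (hθ : θ ∈ Ioo 0 (Real.pi / 2))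
    {p : L2 (halfGuide θ) × L2 (halfGuide θ) × L2 (halfGuide θ)}
    (hp : p ∈ formDomain (halfGuide θ) (dirichletBoundary θ)) :
    evenExt3 θ p ∈ formDomain (guide θ) (frontier (guide θ)) := by
  refine map_mem_of_mem_formDomain (isOpen_halfGuide θ) (isClosed_formDomain (isOpen_guide θ))
    _ (fun q hq => ?_) hp
  obtain ⟨φ, hφ, hq⟩ := mem_smoothTriples.1 hq
  obtain ⟨δ, hδ, hdist⟩ := hφ.exists_dist isClosed_dirichletBoundary
  obtain ⟨M, hM0, hM⟩ := hφ.exists_box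
  -- The smoothed point lies within `ε ≤ δ / 2` of `fold x`, strictly less than the distance `δ` of
  -- the support from the Dirichlet part.
  have hδ2 : 0 < δ / 2 := by positivity
  have hε := scale_pos hδ2
  have hne := ae_restrict_of_ae (s := guide θ) ae_snd_ne_zero
  refine hφ.comp_snd_mem_formDomain (isOpen_guide θ) (h := fun n => smoothAbs (scale (δ / 2) n))
    (fun n => contDiff_smoothAbs (hε n)) (fun n => abs_deriv_smoothAbs_le (hε n))
    (K := Icc (-M) M ×ˢ Icc (-M) M) (isCompact_Icc.prod isCompact_Icc) (fun n x hx => ?_)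
    (k := fun t => |t|) (d := sgn)
    (Eventually.of_forall fun x => tendsto_smoothAbs (tendsto_scale _) x.2) ?_ ?_ ?_ ?_
  · have hx' := tsupport_comp_snd_subset φ (contDiff_smoothAbs (hε n)).continuous hx
    have hb := hM _ hx'
    refine ⟨⟨abs_le.1 hb.1, abs_le.1 ?_⟩, fun hfr => ?_⟩
    · exact ((abs_le_smoothAbs _ _).trans (le_abs_self _)).trans hb.2
    · have hd := hdist _ hx' _ (fold_mem_dirichletBoundary hθ hfr)
      have h1 := abs_le_smoothAbs (scale (δ / 2) n) x.2
      have h2 := smoothAbs_le (hε n) x.2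
      have h3 := scale_le hδ2 n
      simp only [fold, Prod.dist_eq, dist_self, Real.dist_eq] at hd
      have h4 : |smoothAbs (scale (δ / 2) n) x.2 - (|x.2|)| ≤ δ / 2 := by
        rw [abs_le]
        constructor <;> linarith
      have : max 0 |smoothAbs (scale (δ / 2) n) x.2 - (|x.2|)| ≤ δ / 2 := max_le hδ2.le h4
      linarith
  · filter_upwards [hne] with x hx
    exact tendsto_deriv_smoothAbs hε (tendsto_scale _) hx
  · filter_upwards [wcomp_ae (isFold_even θ) hq.val] with x hx
    rw [evenExt3_apply, evenExt, hx, one_mul, fold]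
  · filter_upwards [wcomp_ae (isFold_even θ) hq.pd1] with x hx
    rw [evenExt3_apply, evenExt, hx, one_mul, fold]
  · filter_upwards [wcomp_ae (isFold_odd θ) hq.pd2] with x hx
    rw [evenExt3_apply, oddExt, hx, fold]

/-- The restriction of an odd function vanishes on the whole boundary of the half-guide. -/
theorem restr3_sub_mem {p : L2 (guide θ) × L2 (guide θ) × L2 (guide θ)}
    (hp : p ∈ formDomain (guide θ) (frontier (guide θ))) :
    restr3 θ (p - refl3 θ p) ∈ formDomain (halfGuide θ) (frontier (halfGuide θ)) := by
  let L := (restr3 θ).comp (ContinuousLinearMap.id ℂ _ - refl3 θ)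
  have hL : ∀ q, L q = restr3 θ (q - refl3 θ q) := fun q => by
    rw [ContinuousLinearMap.comp_apply, sub_apply,
      ContinuousLinearMap.id_apply]
  rw [← hL]
  refine map_mem_of_mem_formDomain (isOpen_guide θ) (isClosed_formDomain (isOpen_halfGuide θ))
    L (fun q hq => ?_) hp
  rw [hL]
  obtain ⟨φ₀, hφ₀, hq₀⟩ := mem_smoothTriples.1 hq
  let φ : ℝ × ℝ → ℂ := fun x => φ₀ x - φ₀ (x.1, -x.2)
  have hφ : IsTest (frontier (guide θ))ᶜ φ := by
    have := hφ₀.add (hφ₀.reflect.smul (-1))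
    convert this using 1
    ext x
    simp [φ, sub_eq_add_neg]
  -- Vanishing on the axis is what allows the cut-off: `φ (x₁, ramp ε x₂)` is zero for `x₂ ≤ ε`, and
  -- its gradient stays bounded as `ε → 0`.
  have hodd : ∀ a, φ (a, 0) = 0 := fun a => by simp [φ]
  have hq : Represents (halfGuide θ) (restr3 θ (q - refl3 θ q)) φ :=
    (hq₀.sub (hq₀.refl3 hφ₀) hφ₀ hφ₀.reflect).restr3
  obtain ⟨δ, hδ, hdist⟩ := hφ.exists_dist isClosed_frontier
  obtain ⟨M, hM0, hM⟩ := hφ.exists_box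
  obtain ⟨D, hD⟩ := exists_bound_deriv_ramp
  -- The ramp moves a point by at most `2 ε ≤ δ / 2 < δ`.
  have hδ4 : 0 < δ / 4 := by positivity
  have hε := scale_pos hδ4
  have hpos : ∀ᵐ x ∂volume.restrict (halfGuide θ), 0 < x.2 := by
    filter_upwards [ae_restrict_mem (isOpen_halfGuide θ).measurableSet] with x hx
    exact hx.2
  refine hφ.comp_snd_mem_formDomain (isOpen_halfGuide θ) (h := fun n => ramp (scale (δ / 4) n))
    (fun n => contDiff_ramp _) (fun n => hD _)
    (K := Icc (-M) M ×ˢ Icc (-(M + δ)) (M + δ)) (isCompact_Icc.prod isCompact_Icc)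
    (fun n x hx => ?_) (k := fun t => t) (d := fun _ => 1) ?_ ?_ hq.val hq.pd1 ?_
  · have hx' := tsupport_comp_snd_subset φ (contDiff_ramp _).continuous hx
    have hx2 : scale (δ / 4) n ≤ x.2 := by
      refine closure_minimal (t := {x : ℝ × ℝ | scale (δ / 4) n ≤ x.2}) (fun y hy => ?_)
        (isClosed_le continuous_const continuous_snd) hx
      by_contra! hlt
      refine hy ?_
      simp only [ramp_eq_zero (hε n) (not_le.1 hlt).le, hodd]
    have hx0 : 0 < x.2 := (hε n).trans_le hx2
    have h1 := abs_ramp_sub_le (hε n) hx0.le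
    have h3 := scale_le hδ4 n
    have h4 : |ramp (scale (δ / 4) n) x.2 - x.2| ≤ δ / 2 := by linarith
    have hb := hM _ hx'
    refine ⟨⟨abs_le.1 hb.1, abs_le.1 ?_⟩, fun hfr => ?_⟩
    · have := abs_sub_abs_le_abs_sub x.2 (ramp (scale (δ / 4) n) x.2)
      rw [abs_sub_comm] at this
      linarith [hb.2]
    · have hd := hdist _ hx' _ (mem_dirichletBoundary_of_pos hfr hx0).1
      simp only [Prod.dist_eq, dist_self, Real.dist_eq] at hd
      have : max 0 |ramp (scale (δ / 4) n) x.2 - x.2| ≤ δ / 2 := max_le (by positivity) h4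
      linarith
  · filter_upwards [hpos] with x hx
    exact tendsto_ramp hε (tendsto_scale _) hx
  · filter_upwards [hpos] with x hx
    exact tendsto_deriv_ramp hε (tendsto_scale _) hx
  · filter_upwards [hq.pd2] with x hx
    rw [hx, Complex.ofReal_one, one_mul]

end Triples

/-! ### The Poincaré inequality in the half-guide -/

section Poincare

variable {θ : ℝ} {φ : ℝ × ℝ → ℂ}

theorem IsTest.contDiff_mul_of_contDiffAt {S : Set (ℝ × ℝ)} {w : ℝ × ℝ → ℂ} (hφ : IsTest S φ)
    (hw : ∀ x ∈ S, ContDiffAt ℝ ∞ w x) : IsTest S (fun x => φ x * w x) := by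
  refine ⟨contDiff_iff_contDiffAt.2 fun x => ?_, hφ.compact.mul_right,
    tsupport_mul_subset_left.trans hφ.supp⟩
  by_cases hx : x ∈ tsupport φ
  · exact hφ.smooth.contDiffAt.mul (hw x (hφ.supp hx))
  · refine (contDiffAt_const (c := (0 : ℂ))).congr_of_eventuallyEq ?_
    filter_upwards [notMem_tsupport_iff_eventuallyEq.1 hx] with y hy
    simp [hy]

theorem IsTest.hasDerivAt_line {S : Set (ℝ × ℝ)} (hφ : IsTest S φ) (x v : ℝ × ℝ) :
    HasDerivAt (fun s : ℝ => φ (x + s • v)) (fderiv ℝ φ x v) 0 :=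
  (hφ.differentiable x).hasFDerivAt.hasLineDerivAt v

/-- This is `|D - w a|² ≥ 0` expanded, with `a = φ`, `D` its derivative across the arm and `w` the
cotangent below. -/
theorem poincare_pointwise (a D : ℂ) (w : ℝ) :
    ((D * star a + a * star D) * w + a * star a * (-(1 + w ^ 2) : ℝ)).re ≤
      ‖D‖ ^ 2 - ‖a‖ ^ 2 := by
  have h : 0 ≤ ‖D - w * a‖ ^ 2 := by positivity
  rw [Complex.sq_norm, Complex.normSq_apply] at *
  rw [Complex.sq_norm, Complex.normSq_apply]
  simp only [Complex.sub_re, Complex.sub_im, Complex.mul_re, Complex.mul_im, Complex.ofReal_re,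
    Complex.ofReal_im, Complex.add_re, Complex.add_im, Complex.star_def, Complex.conj_re,
    Complex.conj_im] at *
  nlinarith

/-- Jacobi's argument. The function `w = cot`, the logarithmic derivative of the ground state `sin`
on `(0, π)`, satisfies `w' = -(1 + w²)`. Integrating the derivative of `|φ|² w` across the arm gives
zero, and `poincare_pointwise` bounds its integrand by `|∂ᵥφ|² - |φ|²`. -/
theorem poincare_test (hθ : θ ∈ Ioo 0 (Real.pi / 2)) (hφ : IsTest (halfGuide θ) φ) :
    ∫ x in halfGuide θ, ‖φ x‖ ^ 2 ≤
      (∫ x in halfGuide θ, ‖pd1 φ x‖ ^ 2) + ∫ x in halfGuide θ, ‖pd2 φ x‖ ^ 2 := by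
  let μ := volume.restrict (halfGuide θ)
  -- The unit vector across the arm.
  let v : ℝ × ℝ := (-Real.sin θ, Real.cos θ)
  let w : ℝ × ℝ → ℝ := fun x => Real.cos (across θ x) / Real.sin (across θ x)
  have hsin : ∀ x ∈ halfGuide θ, 0 < Real.sin (across θ x) := fun x hx =>
    Real.sin_pos_of_mem_Ioo (across_mem_Ioo hθ hx)
  -- The poles of the cotangent lie on the edges of the strip, away from the support of `φ`.
  have hη : IsTest (halfGuide θ) (fun x => φ x * star (φ x) * (w x : ℂ)) := by
    refine (hφ.mul_right hφ.star.smooth).contDiff_mul_of_contDiffAt fun x hx => ?_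
    have h1 : ContDiffAt ℝ ∞ w x :=
      ((Real.contDiff_cos.comp contDiff_across).contDiffAt).div
        ((Real.contDiff_sin.comp contDiff_across).contDiffAt) (hsin x hx).ne'
    exact Complex.ofRealCLM.contDiff.contDiffAt.comp x h1
  have hd : ∀ x ∈ halfGuide θ, fderiv ℝ (fun x => φ x * star (φ x) * (w x : ℂ)) x v =
      (fderiv ℝ φ x v * star (φ x) + φ x * star (fderiv ℝ φ x v)) * w x +
        φ x * star (φ x) * (-(1 + w x ^ 2) : ℝ) := fun x hx => by
    have h1 := hφ.hasDerivAt_line x v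
    have hac : ∀ s : ℝ, across θ (x + s • v) = across θ x + s := fun s => by
      simp only [across, v, Prod.fst_add, Prod.snd_add, Prod.smul_mk, smul_eq_mul]
      linear_combination s * Real.sin_sq_add_cos_sq θ
    have h2 : HasDerivAt (fun s : ℝ => w (x + s • v)) (-(1 + w x ^ 2)) 0 := by
      have hlin : HasDerivAt (fun s : ℝ => across θ x + s) 1 0 := (hasDerivAt_id 0).const_add _
      have hs : Real.sin (across θ x + 0) ≠ 0 := by rw [add_zero]; exact (hsin x hx).ne'
      have h3 := hlin.cos.div hlin.sin hs
      simp only [w, hac]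
      refine h3.congr_deriv ?_
      have := Real.sin_sq_add_cos_sq (across θ x)
      have hs' := (hsin x hx).ne'
      simp only [add_zero]
      field_simp
      ring
    have h4 := (h1.mul h1.star).mul h2.ofReal_comp
    have h5 := (hη.hasDerivAt_line x v).unique h4
    rw [h5]
    simp only [Pi.mul_apply, zero_smul, add_zero]
  have hzero := (hη.mono (subset_compl_frontier (isOpen_halfGuide θ))).setIntegral_fderiv_eq_zero
    (isOpen_halfGuide θ) v
  have hiη : Integrable (fun x => fderiv ℝ (fun x => φ x * star (φ x) * (w x : ℂ)) x v) μ :=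
    (hη.continuous_pd v).integrable_of_hasCompactSupport (hη.compact_pd v)
  have hre : ∫ x in halfGuide θ,
      (fderiv ℝ (fun x => φ x * star (φ x) * (w x : ℂ)) x v).re = 0 := by
    have := integral_re (𝕜 := ℂ) hiη
    simp only [RCLike.re_eq_complex_re] at this
    rw [this, hzero, Complex.zero_re]
  have i0 : Integrable (fun x => ‖φ x‖ ^ 2) μ := (hφ.memLp μ).norm.integrable_sq
  have iv : Integrable (fun x => ‖fderiv ℝ φ x v‖ ^ 2) μ := (hφ.memLp_pd v μ).norm.integrable_sq
  have i1 : Integrable (fun x => ‖pd1 φ x‖ ^ 2) μ := (hφ.memLp_pd (1, 0) μ).norm.integrable_sq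
  have i2 : Integrable (fun x => ‖pd2 φ x‖ ^ 2) μ := (hφ.memLp_pd (0, 1) μ).norm.integrable_sq
  have key : 0 ≤ ∫ x in halfGuide θ, (‖fderiv ℝ φ x v‖ ^ 2 - ‖φ x‖ ^ 2) := by
    rw [← hre]
    refine setIntegral_mono_on hiη.re (iv.sub i0) (isOpen_halfGuide θ).measurableSet
      fun x hx => ?_
    rw [hd x hx]
    exact poincare_pointwise _ _ _
  rw [integral_sub iv i0] at key
  -- Cauchy-Schwarz: a derivative along a unit vector is at most the length of the gradient.
  have hle : ∫ x in halfGuide θ, ‖fderiv ℝ φ x v‖ ^ 2 ≤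
      ∫ x in halfGuide θ, (‖pd1 φ x‖ ^ 2 + ‖pd2 φ x‖ ^ 2) := by
    refine integral_mono iv (i1.add i2) fun x => ?_
    have hv : v = (-Real.sin θ) • ((1 : ℝ), (0 : ℝ)) + Real.cos θ • ((0 : ℝ), (1 : ℝ)) := by
      simp [v]
    have h1 : fderiv ℝ φ x v = -(Real.sin θ : ℂ) * pd1 φ x + Real.cos θ * pd2 φ x := by
      rw [hv, map_add, map_smul, map_smul, pd1, pd2, Complex.real_smul, Complex.real_smul]
      push_cast
      ring
    simp only [h1]
    have h2 : ‖-(Real.sin θ : ℂ) * pd1 φ x + Real.cos θ * pd2 φ x‖ ≤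
        |Real.sin θ| * ‖pd1 φ x‖ + |Real.cos θ| * ‖pd2 φ x‖ := by
      refine (norm_add_le _ _).trans (le_of_eq ?_)
      rw [norm_mul, norm_mul, norm_neg, Complex.norm_real, Complex.norm_real, Real.norm_eq_abs,
        Real.norm_eq_abs]
    refine (pow_le_pow_left₀ (norm_nonneg _) h2 2).trans ?_
    have h3 := Real.sin_sq_add_cos_sq θ
    rw [← sq_abs (Real.sin θ), ← sq_abs (Real.cos θ)] at h3
    nlinarith [sq_nonneg (|Real.cos θ| * ‖pd1 φ x‖ - |Real.sin θ| * ‖pd2 φ x‖)]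
  rw [integral_add i1 i2] at hle
  linarith

theorem poincare_formDomain (hθ : θ ∈ Ioo 0 (Real.pi / 2))
    {p : L2 (halfGuide θ) × L2 (halfGuide θ) × L2 (halfGuide θ)}
    (hp : p ∈ formDomain (halfGuide θ) (frontier (halfGuide θ))) :
    ‖p.1‖ ^ 2 ≤ ‖p.2.1‖ ^ 2 + ‖p.2.2‖ ^ 2 := by
  have hU := isOpen_halfGuide θ
  rw [formDomain_eq_closure hU] at hp
  refine closure_minimal
    (t := {p : L2 (halfGuide θ) × L2 (halfGuide θ) × L2 (halfGuide θ) |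
      ‖p.1‖ ^ 2 ≤ ‖p.2.1‖ ^ 2 + ‖p.2.2‖ ^ 2}) (fun q hq => ?_)
    (isClosed_le (by fun_prop) (by fun_prop)) hp
  obtain ⟨φ, hφ, hq⟩ := mem_smoothTriples.1 hq
  have h := poincare_test hθ (hφ.indicator hU)
  have heq : ∀ x ∈ halfGuide θ, (halfGuide θ).indicator φ =ᶠ[𝓝 x] φ := fun x hx => by
    filter_upwards [hU.mem_nhds hx] with y hy
    exact indicator_of_mem hy φ
  simp only [mem_ofPred_eq, norm_sq_eq_integral]
  have e0 : ∫ x in halfGuide θ, ‖q.1 x‖ ^ 2 =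
      ∫ x in halfGuide θ, ‖(halfGuide θ).indicator φ x‖ ^ 2 := by
    refine integral_congr_ae ?_
    filter_upwards [hq.val, ae_restrict_mem hU.measurableSet] with x h1 h2
    rw [h1, indicator_of_mem h2]
  have e1 : ∫ x in halfGuide θ, ‖q.2.1 x‖ ^ 2 =
      ∫ x in halfGuide θ, ‖pd1 ((halfGuide θ).indicator φ) x‖ ^ 2 := by
    refine integral_congr_ae ?_
    filter_upwards [hq.pd1, ae_restrict_mem hU.measurableSet] with x h1 h2
    rw [h1, pd1, pd1, (heq x h2).fderiv_eq]
  have e2 : ∫ x in halfGuide θ, ‖q.2.2 x‖ ^ 2 =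
      ∫ x in halfGuide θ, ‖pd2 ((halfGuide θ).indicator φ) x‖ ^ 2 := by
    refine integral_congr_ae ?_
    filter_upwards [hq.pd2, ae_restrict_mem hU.measurableSet] with x h1 h2
    rw [h1, pd2, pd2, (heq x h2).fderiv_eq]
  rw [e0, e1, e2]
  exact h

end Poincare

/-! ### Even and odd parts of the Dirichlet Laplacian -/

section Symmetry

variable {θ : ℝ}

theorem mem_graph_dirichlet {u f : L2 (guide θ)} :
    (u, f) ∈ (dirichletLaplacian (guide θ)).graph ↔
      ∃ p ∈ formDomain (guide θ) (frontier (guide θ)), p.1 = u ∧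
        ∀ v ∈ formDomain (guide θ) (frontier (guide θ)),
          inner ℂ v.2.1 p.2.1 + inner ℂ v.2.2 p.2.2 = inner ℂ v.1 f := by
  rw [dirichletLaplacian_graph]
  rfl

theorem mem_graph_mixed {u f : L2 (halfGuide θ)} :
    (u, f) ∈ (mixedLaplacian θ).graph ↔
      ∃ p ∈ formDomain (halfGuide θ) (dirichletBoundary θ), p.1 = u ∧
        ∀ v ∈ formDomain (halfGuide θ) (dirichletBoundary θ),
          inner ℂ v.2.1 p.2.1 + inner ℂ v.2.2 p.2.2 = inner ℂ v.1 f := by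
  rw [mixedLaplacian_graph]
  rfl

/-- The restriction of the even part to the half-guide. -/
noncomputable def evenPart (θ : ℝ) : L2 (guide θ) →L[ℂ] L2 (halfGuide θ) :=
  (1 / 2 : ℂ) • (restr θ).comp (ContinuousLinearMap.id ℂ _ + refl θ)

theorem evenPart_apply (u : L2 (guide θ)) :
    evenPart θ u = (1 / 2 : ℂ) • restr θ (u + refl θ u) := rfl

theorem evenPart_evenExt (g : L2 (halfGuide θ)) : evenPart θ (evenExt θ g) = g := by
  rw [evenPart_apply, refl_evenExt, map_add, restr_evenExt, smul_add, ← add_smul]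
  norm_num

theorem evenPart_eq_zero_iff {u : L2 (guide θ)} : evenPart θ u = 0 ↔ u + refl θ u = 0 := by
  rw [evenPart_apply]
  constructor
  · intro h
    refine eq_zero_of_restr_eq_zero ?_ ((smul_eq_zero.1 h).resolve_left (by norm_num))
    rw [map_add, refl_refl, add_comm]
  · intro h
    rw [h, map_zero, smul_zero]

/-- A test function `v` on the guide is paired with an even extension through the restriction of `v
+ refl3 θ v`, an admissible test function for the mixed problem. -/
theorem evenExt_mem_graph (hθ : θ ∈ Ioo 0 (Real.pi / 2)) {p q : L2 (halfGuide θ)}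
    (h : (p, q) ∈ (mixedLaplacian θ).graph) :
    (evenExt θ p, evenExt θ q) ∈ (dirichletLaplacian (guide θ)).graph := by
  obtain ⟨w, hw, rfl, hb⟩ := mem_graph_mixed.1 h
  refine mem_graph_dirichlet.2 ⟨evenExt3 θ w, evenExt3_mem hθ hw, rfl, fun v hv => ?_⟩
  have hv' := restr3_mem (Submodule.add_mem _ hv (refl3_mem hv))
  have := hb _ hv'
  simp only [restr3_apply, refl3_apply, Prod.fst_add, Prod.snd_add] at this
  simp only [evenExt3_apply, inner_evenExt_right, inner_oddExt_right]
  rw [← this, sub_eq_add_neg]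

/-- Dual to the preceding argument: test functions of the mixed problem are extended evenly and
inserted in the Dirichlet problem. -/
theorem evenPart_mem_graph (hθ : θ ∈ Ioo 0 (Real.pi / 2)) {u f : L2 (guide θ)}
    (h : (u, f) ∈ (dirichletLaplacian (guide θ)).graph) :
    (evenPart θ u, evenPart θ f) ∈ (mixedLaplacian θ).graph := by
  obtain ⟨w, hw, rfl, hb⟩ := mem_graph_dirichlet.1 h
  refine mem_graph_mixed.2 ⟨(1 / 2 : ℂ) • restr3 θ (w + refl3 θ w), Submodule.smul_mem _ _
    (restr3_mem (Submodule.add_mem _ hw (refl3_mem hw))), rfl, fun v hv => ?_⟩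
  have := hb _ (evenExt3_mem hθ hv)
  simp only [evenExt3_apply, inner_evenExt_left, inner_oddExt_left] at this
  simp only [restr3_apply, refl3_apply, Prod.fst_add, Prod.snd_add, Prod.smul_fst, Prod.smul_snd,
    evenPart_apply, inner_smul_right, ← sub_eq_add_neg]
  rw [← this]
  ring

/-- The odd functions of the form domain. -/
noncomputable def oddDomain (θ : ℝ) : Submodule ℂ (L2 (guide θ) × L2 (guide θ) × L2 (guide θ)) :=
  formDomain (guide θ) (frontier (guide θ)) ⊓
    LinearMap.ker (refl3 θ + ContinuousLinearMap.id ℂ _).toLinearMap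

theorem mem_oddDomain {p : L2 (guide θ) × L2 (guide θ) × L2 (guide θ)} :
    p ∈ oddDomain θ ↔ p ∈ formDomain (guide θ) (frontier (guide θ)) ∧ refl3 θ p = -p := by
  rw [oddDomain, Submodule.mem_inf, LinearMap.mem_ker, ContinuousLinearMap.coe_coe, add_apply,
    ContinuousLinearMap.id_apply, eq_neg_iff_add_eq_zero]

theorem isClosed_oddDomain :
    IsClosed (oddDomain θ : Set (L2 (guide θ) × L2 (guide θ) × L2 (guide θ))) :=
  (isClosed_formDomain (isOpen_guide θ)).inter (ContinuousLinearMap.isClosed_ker _)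

theorem refl3_refl3 (p : L2 (guide θ) × L2 (guide θ) × L2 (guide θ)) :
    refl3 θ (refl3 θ p) = p := by
  simp [refl_refl]

theorem sub_refl3_mem_oddDomain {p : L2 (guide θ) × L2 (guide θ) × L2 (guide θ)}
    (hp : p ∈ formDomain (guide θ) (frontier (guide θ))) : p - refl3 θ p ∈ oddDomain θ := by
  refine mem_oddDomain.2 ⟨Submodule.sub_mem _ hp (refl3_mem hp), ?_⟩
  rw [map_sub, refl3_refl3, neg_sub]

/-- For odd `p` the restriction of `p - refl3 θ p` is twice that of `p`, so `restr3_sub_mem` puts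
the restriction in `H¹₀` of the half-guide. By symmetry every squared norm on the guide is twice the
one on the half-guide. -/
theorem poincare_oddDomain (hθ : θ ∈ Ioo 0 (Real.pi / 2))
    {p : L2 (guide θ) × L2 (guide θ) × L2 (guide θ)} (hp : p ∈ oddDomain θ) :
    ‖p.1‖ ^ 2 ≤ ‖p.2.1‖ ^ 2 + ‖p.2.2‖ ^ 2 := by
  obtain ⟨hp, hodd⟩ := mem_oddDomain.1 hp
  have h1 := restr3_sub_mem hp
  rw [hodd, sub_neg_eq_add, ← two_smul ℂ, map_smul] at h1
  have h2 : restr3 θ p ∈ formDomain (halfGuide θ) (frontier (halfGuide θ)) := by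
    have := Submodule.smul_mem _ (2⁻¹ : ℂ) h1
    rwa [smul_smul, inv_mul_cancel₀ two_ne_zero, one_smul] at this
  have h3 := poincare_formDomain hθ h2
  have e0 : refl θ p.1 = -p.1 := congrArg Prod.fst hodd
  have e1 : refl θ p.2.1 = -p.2.1 := congrArg (fun q => q.2.1) hodd
  have e2 : refl θ p.2.2 = p.2.2 := by
    have : -refl θ p.2.2 = -p.2.2 := congrArg (fun q => q.2.2) hodd
    exact neg_injective this
  rw [norm_sq_eq_of_refl (Or.inr e0), norm_sq_eq_of_refl (Or.inr e1),
    norm_sq_eq_of_refl (Or.inl e2)]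
  simp only [restr3_apply] at h3
  linarith

/-- The identification of the Hilbert sum of three copies of `L²` with the space of triples. -/
noncomputable def toTriple (U : Set (ℝ × ℝ)) :
    WithLp 2 (L2 U × WithLp 2 (L2 U × L2 U)) ≃L[ℂ] L2 U × L2 U × L2 U :=
  (WithLp.prodContinuousLinearEquiv 2 ℂ (L2 U) (WithLp 2 (L2 U × L2 U))).trans
    ((ContinuousLinearEquiv.refl ℂ (L2 U)).prodCongr
      (WithLp.prodContinuousLinearEquiv 2 ℂ (L2 U) (L2 U)))

theorem inner_eq_toTriple {U : Set (ℝ × ℝ)} (x y : WithLp 2 (L2 U × WithLp 2 (L2 U × L2 U))) :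
    inner ℂ x y = inner ℂ (toTriple U x).1 (toTriple U y).1 +
      (inner ℂ (toTriple U x).2.1 (toTriple U y).2.1 +
        inner ℂ (toTriple U x).2.2 (toTriple U y).2.2) := by
  rw [WithLp.prod_inner_apply, WithLp.prod_inner_apply]
  rfl

theorem norm_sq_eq_toTriple {U : Set (ℝ × ℝ)} (x : WithLp 2 (L2 U × WithLp 2 (L2 U × L2 U))) :
    ‖x‖ ^ 2 = ‖(toTriple U x).1‖ ^ 2 +
      (‖(toTriple U x).2.1‖ ^ 2 + ‖(toTriple U x).2.2‖ ^ 2) := by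
  rw [WithLp.prod_norm_sq_eq_of_L2, WithLp.prod_norm_sq_eq_of_L2]
  rfl

/-- Unique solvability of the resolvent equation in the odd functions, in weak form. -/
theorem oddDomain_solvable (hθ : θ ∈ Ioo 0 (Real.pi / 2)) {z : ℂ} (hz : z.im ≠ 0 ∨ z.re < 1) :
    (∀ f : L2 (guide θ), ∃ p ∈ oddDomain θ, ∀ v ∈ oddDomain θ,
      inner ℂ v.2.1 p.2.1 + inner ℂ v.2.2 p.2.2 - z * inner ℂ v.1 p.1 = inner ℂ v.1 f) ∧
    ∀ p ∈ oddDomain θ, (∀ v ∈ oddDomain θ,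
      inner ℂ v.2.1 p.2.1 + inner ℂ v.2.2 p.2.2 - z * inner ℂ v.1 p.1 = 0) → p = 0 := by
  -- The plain product carries the sup norm; Lax-Milgram needs the Hilbert structure, so the odd
  -- domain is transported to the Hilbert sum.
  let e := toTriple (guide θ)
  let V := (oddDomain θ).comap e.toLinearMap
  have hV : IsClosed (V : Set (WithLp 2 (L2 (guide θ) × WithLp 2 (L2 (guide θ) × L2 (guide θ))))) :=
    isClosed_oddDomain.preimage e.continuous
  have : CompleteSpace V := hV.completeSpace_coe
  let J : V →L[ℂ] L2 (guide θ) :=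
    (ContinuousLinearMap.fst ℂ _ _).comp (e.toContinuousLinearMap.comp V.subtypeL)
  have hJ : ∀ u : V, J u = (e u).1 := fun u => rfl
  obtain ⟨h1, h2⟩ := laxMilgram_shift (V := V) (H := L2 (guide θ)) J (fun u => by
    rw [hJ, Submodule.coe_norm, norm_sq_eq_toTriple]
    have := poincare_oddDomain hθ u.2
    change ‖(e u).1‖ ^ 2 ≤ ‖(e u).2.1‖ ^ 2 + ‖(e u).2.2‖ ^ 2 at this
    linarith) hz
  have hform : ∀ v u : V, inner ℂ v u - (1 + z) * inner ℂ (J v) (J u) =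
      inner ℂ (e v).2.1 (e u).2.1 + inner ℂ (e v).2.2 (e u).2.2 -
        z * inner ℂ (e v).1 (e u).1 := fun v u => by
    rw [Submodule.coe_inner, inner_eq_toTriple, hJ, hJ]
    ring
  have hlift : ∀ p ∈ oddDomain θ, ∃ u : V, e u = p := fun p hp =>
    ⟨⟨e.symm p, by
      change e (e.symm p) ∈ oddDomain θ
      rwa [e.apply_symm_apply]⟩, e.apply_symm_apply p⟩
  constructor
  · intro f
    obtain ⟨u, hu⟩ := h1 f
    refine ⟨e u, u.2, fun v hv => ?_⟩
    obtain ⟨w, rfl⟩ := hlift v hv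
    rw [← hform, hu, hJ]
  · intro p hp h
    obtain ⟨u, rfl⟩ := hlift p hp
    have : u = 0 := h2 u fun v => by
      rw [hform]
      exact h _ v.2
    rw [this]
    simp

/-- The kernel of `evenPart` consists of the odd functions. Solving against odd test functions is
enough, because even test functions pair to zero with odd data. -/
theorem regularOnKer_evenPart (hθ : θ ∈ Ioo 0 (Real.pi / 2)) {z : ℂ}
    (hz : z.im ≠ 0 ∨ z.re < 1) :
    RegularOnKer (dirichletLaplacian (guide θ)) (evenPart θ) z := by
  obtain ⟨h1, h2⟩ := oddDomain_solvable hθ hz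
  refine ⟨fun f hf => ?_, fun u hu hPu => ?_⟩
  · have hf' : refl θ f = -f := by
      rw [evenPart_eq_zero_iff] at hf
      exact (neg_eq_of_add_eq_zero_right hf).symm
    obtain ⟨p, hp, hp'⟩ := h1 f
    obtain ⟨hpV, hpo⟩ := mem_oddDomain.1 hp
    refine ⟨p.1, mem_graph_dirichlet.2 ⟨p, hpV, rfl, fun v hv => ?_⟩⟩
    -- By oddness of `p` and `f`, testing with `v - refl3 θ v` doubles each pairing with `v`.
    have h := hp' _ (sub_refl3_mem_oddDomain hv)
    have e0 : refl θ p.1 = -p.1 := congrArg Prod.fst hpo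
    have e1 : refl θ p.2.1 = -p.2.1 := congrArg (fun q => q.2.1) hpo
    have e2 : -refl θ p.2.2 = -p.2.2 := congrArg (fun q => q.2.2) hpo
    have a0 : inner ℂ (refl θ v.1) p.1 = -inner ℂ v.1 p.1 := by
      rw [← inner_refl_refl, refl_refl, e0, inner_neg_right]
    have a1 : inner ℂ (refl θ v.2.1) p.2.1 = -inner ℂ v.2.1 p.2.1 := by
      rw [← inner_refl_refl, refl_refl, e1, inner_neg_right]
    have a2 : inner ℂ (refl θ v.2.2) p.2.2 = inner ℂ v.2.2 p.2.2 := by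
      rw [← inner_refl_refl, refl_refl, neg_injective e2]
    have a3 : inner ℂ (refl θ v.1) f = -inner ℂ v.1 f := by
      rw [← inner_refl_refl, refl_refl, hf', inner_neg_right]
    simp only [refl3_apply, Prod.fst_sub, Prod.snd_sub, inner_sub_left, inner_neg_left, a0, a1,
      a2, a3] at h
    rw [inner_add_right, inner_smul_right]
    linear_combination (1 / 2 : ℂ) * h
  · have hu' : refl θ u = -u := by
      rw [evenPart_eq_zero_iff] at hPu
      exact (neg_eq_of_add_eq_zero_right hPu).symm
    obtain ⟨w, hw, rfl, hb⟩ := mem_graph_dirichlet.1 hu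
    -- Only the first component of `w` is known to be odd at this point, so the odd combination,
    -- with first component `2 u`, is used instead of `w`.
    have h0 : w - refl3 θ w = 0 := by
      refine h2 _ (sub_refl3_mem_oddDomain hw) fun v hv => ?_
      obtain ⟨hvV, hvo⟩ := mem_oddDomain.1 hv
      have h := hb v hvV
      have e1 : refl θ v.2.1 = -v.2.1 := congrArg (fun q => q.2.1) hvo
      have e2 : -refl θ v.2.2 = -v.2.2 := congrArg (fun q => q.2.2) hvo
      have a1 : inner ℂ v.2.1 (refl θ w.2.1) = -inner ℂ v.2.1 w.2.1 := by
        rw [← inner_refl_refl, refl_refl, e1, inner_neg_left]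
      have a2 : inner ℂ v.2.2 (refl θ w.2.2) = inner ℂ v.2.2 w.2.2 := by
        rw [← inner_refl_refl, refl_refl, neg_injective e2]
      rw [inner_smul_right] at h
      simp only [refl3_apply, Prod.fst_sub, Prod.snd_sub, inner_sub_right, inner_neg_right, a1,
        a2, hu']
      linear_combination 2 * h
    have h3 : w.1 - refl θ w.1 = 0 := congrArg Prod.fst h0
    rw [hu', sub_neg_eq_add, ← two_smul ℂ] at h3
    simpa using h3

/-- Bound states below the threshold are even. -/
theorem refl_eq_of_mem_graph (hθ : θ ∈ Ioo 0 (Real.pi / 2)) {z : ℝ} (hz : z < 1)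
    {u : L2 (guide θ)} (hu : (u, (z : ℂ) • u) ∈ (dirichletLaplacian (guide θ)).graph) :
    refl θ u = u := by
  -- The even projection of `u` is again an eigenvector, so the odd remainder is one too and
  -- vanishes by regularity.
  have h1 := evenExt_mem_graph hθ (evenPart_mem_graph hθ hu)
  have h2 := Submodule.sub_mem _ hu h1
  have h3 := (regularOnKer_evenPart hθ (z := z) (Or.inr (by simpa using hz))).inj
    (u - evenExt θ (evenPart θ u))
    (by rw [smul_sub]; simpa only [Prod.mk_sub_mk, map_smul] using h2)
    (by rw [map_sub, evenPart_evenExt, sub_self])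
  rw [sub_eq_zero] at h3
  rw [h3, refl_evenExt]

end Symmetry

/-! ### Product functions along the upper arm -/

section Modes

variable {θ : ℝ}

/-- The rotation to the coordinates along and across the upper arm. -/
noncomputable def rot (θ : ℝ) : (ℝ × ℝ) ≃ₜ (ℝ × ℝ) where
  toFun x := (along θ x, across θ x)
  invFun y := (y.1 * Real.cos θ - y.2 * Real.sin θ, y.1 * Real.sin θ + y.2 * Real.cos θ)
  left_inv x := by
    have := Real.sin_sq_add_cos_sq θ
    ext
    · simp only [along, across]
      linear_combination x.1 * this
    · simp only [along, across]
      linear_combination x.2 * this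
  right_inv y := by
    have := Real.sin_sq_add_cos_sq θ
    ext
    · simp only [along]
      linear_combination y.1 * this
    · simp only [across]
      linear_combination y.2 * this
  continuous_toFun := contDiff_along.continuous.prodMk contDiff_across.continuous
  continuous_invFun := by fun_prop

theorem rot_apply (x : ℝ × ℝ) : rot θ x = (along θ x, across θ x) := rfl

theorem measurePreserving_rot : MeasurePreserving (rot θ) (volume : Measure (ℝ × ℝ)) volume := by
  refine ⟨(rot θ).continuous.measurable, ?_⟩
  let f : ℝ × ℝ →ₗ[ℝ] ℝ × ℝ := Matrix.toLin (Module.Basis.finTwoProd ℝ) (Module.Basis.finTwoProd ℝ)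
    !![Real.cos θ, Real.sin θ; -Real.sin θ, Real.cos θ]
  have hf : ⇑f = rot θ := by
    ext x
    · simp [f, Matrix.toLin_finTwoProd_apply, rot_apply, along]
      ring
    · simp [f, Matrix.toLin_finTwoProd_apply, rot_apply, across]
      ring
  have hdet : LinearMap.det f = 1 := by
    rw [LinearMap.det_toLin, Matrix.det_fin_two_of]
    linear_combination Real.sin_sq_add_cos_sq θ
  have := Measure.map_linearMap_addHaar_eq_smul_addHaar (volume : Measure (ℝ × ℝ)) (f := f)
    (by rw [hdet]; exact one_ne_zero)
  rw [hf, hdet] at this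
  simpa using this

/-- The product of a function of the coordinate along the arm and of a function of the coordinate
across the arm. -/
noncomputable def mode (θ : ℝ) (ρ γ : ℝ → ℂ) (x : ℝ × ℝ) : ℂ := ρ (along θ x) * γ (across θ x)

theorem contDiff_mode {ρ γ : ℝ → ℂ} (hρ : ContDiff ℝ ∞ ρ) (hγ : ContDiff ℝ ∞ γ) :
    ContDiff ℝ ∞ (mode θ ρ γ) :=
  (hρ.comp contDiff_along).mul (hγ.comp contDiff_across)

theorem fderiv_mode {ρ γ : ℝ → ℂ} (hρ : ContDiff ℝ ∞ ρ) (hγ : ContDiff ℝ ∞ γ) (x v : ℝ × ℝ) :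
    fderiv ℝ (mode θ ρ γ) x v =
      along θ v * mode θ (deriv ρ) γ x + across θ v * mode θ ρ (deriv γ) x := by
  have hd : Differentiable ℝ (mode θ ρ γ) := (contDiff_mode hρ hγ).differentiable (by simp)
  have h1 : HasDerivAt (fun s : ℝ => mode θ ρ γ (x + s • v)) (fderiv ℝ (mode θ ρ γ) x v) 0 :=
    (hd x).hasFDerivAt.hasLineDerivAt v
  have ha : ∀ s : ℝ, along θ (x + s • v) = along θ x + s * along θ v := fun s => by
    simp only [along, Prod.fst_add, Prod.snd_add, Prod.smul_fst, Prod.smul_snd, smul_eq_mul]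
    ring
  have hb : ∀ s : ℝ, across θ (x + s • v) = across θ x + s * across θ v := fun s => by
    simp only [across, Prod.fst_add, Prod.snd_add, Prod.smul_fst, Prod.smul_snd, smul_eq_mul]
    ring
  have hlin : ∀ a b : ℝ, HasDerivAt (fun s : ℝ => a + s * b) b 0 := fun a b => by
    simpa using ((hasDerivAt_id (0 : ℝ)).mul_const b).const_add a
  have hρ' : HasDerivAt (fun s : ℝ => ρ (along θ (x + s • v)))
      (along θ v • deriv ρ (along θ x)) 0 := by
    simp only [ha]
    have h := (hρ.differentiable (by simp) (along θ x + 0 * along θ v)).hasDerivAt.scomp 0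
      (hlin (along θ x) (along θ v))
    simpa [Function.comp_def] using h
  have hγ' : HasDerivAt (fun s : ℝ => γ (across θ (x + s • v)))
      (across θ v • deriv γ (across θ x)) 0 := by
    simp only [hb]
    have h := (hγ.differentiable (by simp) (across θ x + 0 * across θ v)).hasDerivAt.scomp 0
      (hlin (across θ x) (across θ v))
    simpa [Function.comp_def] using h
  rw [h1.unique (hρ'.mul hγ')]
  simp only [zero_smul, add_zero, Complex.real_smul, mode]
  ring

theorem pd1_mode {ρ γ : ℝ → ℂ} (hρ : ContDiff ℝ ∞ ρ) (hγ : ContDiff ℝ ∞ γ) (x : ℝ × ℝ) :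
    pd1 (mode θ ρ γ) x =
      Real.cos θ * mode θ (deriv ρ) γ x - Real.sin θ * mode θ ρ (deriv γ) x := by
  rw [pd1, fderiv_mode hρ hγ]
  simp [along, across]
  ring

theorem pd2_mode {ρ γ : ℝ → ℂ} (hρ : ContDiff ℝ ∞ ρ) (hγ : ContDiff ℝ ∞ γ) (x : ℝ × ℝ) :
    pd2 (mode θ ρ γ) x =
      Real.sin θ * mode θ (deriv ρ) γ x + Real.cos θ * mode θ ρ (deriv γ) x := by
  rw [pd2, fderiv_mode hρ hγ]
  simp [along, across]

theorem tsupport_mode_subset (ρ γ : ℝ → ℂ) :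
    tsupport (mode θ ρ γ) ⊆ {x | along θ x ∈ tsupport ρ ∧ across θ x ∈ tsupport γ} :=
  closure_minimal
    (fun _ hx => ⟨subset_tsupport ρ (left_ne_zero_of_mul hx),
      subset_tsupport γ (right_ne_zero_of_mul hx)⟩)
    (((isClosed_tsupport ρ).preimage contDiff_along.continuous).inter
      ((isClosed_tsupport γ).preimage contDiff_across.continuous))

/-- The part of the strip above the support of `ρ`. -/
def stripOver (θ : ℝ) (ρ : ℝ → ℂ) : Set (ℝ × ℝ) :=
  rot θ ⁻¹' (tsupport ρ ×ˢ Icc 0 Real.pi)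

theorem isCompact_stripOver {ρ : ℝ → ℂ} (hρ : HasCompactSupport ρ) :
    IsCompact (stripOver θ ρ) :=
  (rot θ).isCompact_preimage.2 (IsCompact.prod hρ isCompact_Icc)

/-- No decay of `γ` is needed: within the half-guide the coordinate across the arm is bounded, so
the mode vanishes there outside a compact set. -/
theorem memLp_mode (hθ : θ ∈ Ioo 0 (Real.pi / 2)) {ρ γ : ℝ → ℂ} (hρ : Continuous ρ)
    (hc : HasCompactSupport ρ) (hγ : Continuous γ) :
    MemLp (mode θ ρ γ) 2 (volume.restrict (halfGuide θ)) := by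
  have hK : IsCompact (stripOver θ ρ) := isCompact_stripOver hc
  have hcont : Continuous (mode θ ρ γ) :=
    (hρ.comp contDiff_along.continuous).mul (hγ.comp contDiff_across.continuous)
  obtain ⟨C, hC⟩ := hK.exists_bound_of_continuousOn hcont.continuousOn
  have : IsFiniteMeasure ((volume.restrict (halfGuide θ)).restrict (stripOver θ ρ)) :=
    ⟨by rw [Measure.restrict_apply_univ]; exact hK.measure_lt_top⟩
  have h1 : MemLp (mode θ ρ γ) 2 ((volume.restrict (halfGuide θ)).restrict (stripOver θ ρ)) :=
    MemLp.of_bound hcont.aestronglyMeasurable C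
      ((ae_restrict_mem hK.measurableSet).mono fun x hx => hC x hx)
  refine ((memLp_indicator_iff_restrict hK.measurableSet).2 h1).ae_eq ?_
  filter_upwards [ae_restrict_mem (isOpen_halfGuide θ).measurableSet] with x hx
  by_cases hxK : x ∈ stripOver θ ρ
  · rw [indicator_of_mem hxK]
  · have : ρ (along θ x) = 0 := image_eq_zero_of_notMem_tsupport fun h =>
      hxK ⟨h, Ioo_subset_Icc_self (across_mem_Ioo hθ hx)⟩
    rw [indicator_of_notMem hxK, mode, this, zero_mul]

/-- This is why profiles are supported in `(0, ∞)`: such modes stay away from the axis, where the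
Neumann condition is imposed. -/
theorem snd_pos_of_along_pos (hθ : θ ∈ Ioo 0 (Real.pi / 2)) {x : ℝ × ℝ} (h : 0 < along θ x)
    (h' : 0 ≤ across θ x) : 0 < x.2 := by
  have hs : 0 < Real.sin θ := Real.sin_pos_of_pos_of_lt_pi hθ.1 (by linarith [hθ.2, Real.pi_pos])
  have hc : 0 < Real.cos θ := Real.cos_pos_of_mem_Ioo ⟨by linarith [hθ.1, Real.pi_pos], hθ.2⟩
  rw [snd_eq θ x]
  have := mul_pos h hs
  have := mul_nonneg h' hc.le
  linarith

/-- The sine as a complex valued function. -/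
noncomputable def csin (t : ℝ) : ℂ := (Real.sin t : ℂ)

/-- The cosine as a complex valued function. -/
noncomputable def ccos (t : ℝ) : ℂ := (Real.cos t : ℂ)

theorem contDiff_csin : ContDiff ℝ ∞ csin := Complex.ofRealCLM.contDiff.comp Real.contDiff_sin

theorem contDiff_ccos : ContDiff ℝ ∞ ccos := Complex.ofRealCLM.contDiff.comp Real.contDiff_cos

theorem deriv_csin : deriv csin = ccos := by
  ext t
  exact (Real.hasDerivAt_sin t).ofReal_comp.deriv

theorem deriv_ccos : deriv ccos = fun t => - csin t := by
  ext t
  rw [show ccos = fun t : ℝ => (Real.cos t : ℂ) from rfl, (Real.hasDerivAt_cos t).ofReal_comp.deriv]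
  simp [csin]

/-- A smooth approximation of the sine on `(0, π)`, vanishing near `0` and `π`. -/
noncomputable def cutSin (ε t : ℝ) : ℝ :=
  2 * Real.sin (ramp ε t / 2) * Real.sin (ramp ε (Real.pi - t) / 2)

theorem contDiff_cutSin (ε : ℝ) : ContDiff ℝ ∞ (cutSin ε) := by
  have h := contDiff_ramp ε
  have h' : ContDiff ℝ ∞ fun t => ramp ε (Real.pi - t) := h.comp (by fun_prop)
  unfold cutSin
  fun_prop

theorem hasDerivAt_cutSin (ε t : ℝ) : HasDerivAt (cutSin ε)
    (Real.cos (ramp ε t / 2) * deriv (ramp ε) t * Real.sin (ramp ε (Real.pi - t) / 2) -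
      Real.sin (ramp ε t / 2) * (Real.cos (ramp ε (Real.pi - t) / 2) *
        deriv (ramp ε) (Real.pi - t))) t := by
  have hd : Differentiable ℝ (ramp ε) := (contDiff_ramp ε).differentiable (by simp)
  have h1 := (((hd t).hasDerivAt.div_const 2).sin.const_mul 2)
  have h0 : HasDerivAt (fun t : ℝ => Real.pi - t) (-1) t := by
    simpa using (hasDerivAt_id t).const_sub Real.pi
  have h2 := (((hd (Real.pi - t)).hasDerivAt.comp t h0).div_const 2).sin
  refine (h1.mul h2).congr_deriv ?_
  simp only [Function.comp_apply]
  ring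

theorem cutSin_eq_zero {ε t : ℝ} (hε : 0 < ε) (ht : t ∉ Icc ε (Real.pi - ε)) :
    cutSin ε t = 0 := by
  rw [mem_Icc, not_and_or, not_le, not_le] at ht
  rcases ht with h | h
  · rw [cutSin, ramp_eq_zero hε h.le]
    simp
  · rw [cutSin, ramp_eq_zero hε (t := Real.pi - t) (by linarith)]
    simp

theorem abs_cutSin_le (ε t : ℝ) : |cutSin ε t| ≤ 2 := by
  rw [cutSin, abs_mul, abs_mul, abs_two]
  have h1 := Real.abs_sin_le_one (ramp ε t / 2)
  have h2 := Real.abs_sin_le_one (ramp ε (Real.pi - t) / 2)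
  have h3 := mul_le_one₀ h1 (abs_nonneg _) h2
  linarith

theorem abs_deriv_cutSin_le {D : ℝ} (hD : ∀ ε t, |deriv (ramp ε) t| ≤ D) (ε t : ℝ) :
    |deriv (cutSin ε) t| ≤ 2 * D := by
  rw [(hasDerivAt_cutSin ε t).deriv]
  have hD0 : 0 ≤ D := (abs_nonneg _).trans (hD 0 0)
  have aux : ∀ a b c : ℝ, |a| ≤ 1 → |b| ≤ D → |c| ≤ 1 → |a * b * c| ≤ D := fun a b c ha hb hc => by
    rw [abs_mul, abs_mul]
    calc |a| * |b| * |c| ≤ 1 * D * 1 := by gcongr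
      _ = D := by ring
  refine (abs_sub _ _).trans ?_
  have h1 := aux _ _ _ (Real.abs_cos_le_one (ramp ε t / 2)) (hD ε t)
    (Real.abs_sin_le_one (ramp ε (Real.pi - t) / 2))
  have h2 := aux _ _ _ (Real.abs_sin_le_one (ramp ε t / 2)) (hD ε (Real.pi - t))
    (Real.abs_cos_le_one (ramp ε (Real.pi - t) / 2))
  rw [mul_assoc, mul_comm (deriv (ramp ε) (Real.pi - t))] at h2
  linarith

/-- The limit is `2 sin (t / 2) sin ((π - t) / 2) = sin t`. Each factor vanishes at one end of `(0,
π)`, so each end gets its own ramp. -/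
theorem tendsto_cutSin {ε : ℕ → ℝ} (hε0 : ∀ n, 0 < ε n) (hε : Tendsto ε atTop (𝓝 0)) {t : ℝ}
    (ht : t ∈ Ioo 0 Real.pi) : Tendsto (fun n => cutSin (ε n) t) atTop (𝓝 (Real.sin t)) := by
  have h1 := tendsto_ramp hε0 hε ht.1
  have h2 := tendsto_ramp hε0 hε (sub_pos.2 ht.2)
  have h3 := (((Real.continuous_sin.tendsto _).comp (h1.div_const 2)).const_mul 2).mul
    ((Real.continuous_sin.tendsto _).comp (h2.div_const 2))
  rw [sub_div, Real.sin_pi_div_two_sub, ← Real.sin_two_mul, mul_div_cancel₀ t two_ne_zero] at h3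
  exact h3

theorem tendsto_deriv_cutSin {ε : ℕ → ℝ} (hε0 : ∀ n, 0 < ε n) (hε : Tendsto ε atTop (𝓝 0)) {t : ℝ}
    (ht : t ∈ Ioo 0 Real.pi) :
    Tendsto (fun n => deriv (cutSin (ε n)) t) atTop (𝓝 (Real.cos t)) := by
  have h1 := tendsto_ramp hε0 hε ht.1
  have h2 := tendsto_ramp hε0 hε (sub_pos.2 ht.2)
  have d1 := tendsto_deriv_ramp hε0 hε ht.1
  have d2 := tendsto_deriv_ramp hε0 hε (sub_pos.2 ht.2)
  have s1 := (Real.continuous_sin.tendsto _).comp (h1.div_const 2)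
  have s2 := (Real.continuous_sin.tendsto _).comp (h2.div_const 2)
  have c1 := (Real.continuous_cos.tendsto _).comp (h1.div_const 2)
  have c2 := (Real.continuous_cos.tendsto _).comp (h2.div_const 2)
  simp only [(hasDerivAt_cutSin _ t).deriv]
  have h3 := ((c1.mul d1).mul s2).sub (s1.mul (c2.mul d2))
  have := Real.cos_add (t / 2) (t / 2)
  rw [add_halves] at this
  rw [sub_div, Real.sin_pi_div_two_sub, Real.cos_pi_div_two_sub, mul_one, mul_one, ← this] at h3
  exact h3

/-- The conditions on the longitudinal profile of a mode. -/
structure IsProfile (ρ : ℝ → ℂ) : Prop where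
  smooth : ContDiff ℝ ∞ ρ
  compact : HasCompactSupport ρ
  supp : tsupport ρ ⊆ Ioi 0

theorem IsProfile.deriv {ρ : ℝ → ℂ} (hρ : IsProfile ρ) : IsProfile (deriv ρ) :=
  ⟨hρ.smooth.deriv' , hρ.compact.deriv, tsupport_deriv_subset.trans hρ.supp⟩

/-- The element of `L²` of the half-guide given by a mode. -/
noncomputable def modeL2 (hθ : θ ∈ Ioo 0 (Real.pi / 2)) {ρ : ℝ → ℂ} (hρ : IsProfile ρ) {γ : ℝ → ℂ}
    (hγ : Continuous γ) : L2 (halfGuide θ) :=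
  (memLp_mode hθ hρ.smooth.continuous hρ.compact hγ).toLp _

theorem modeL2_ae (hθ : θ ∈ Ioo 0 (Real.pi / 2)) {ρ : ℝ → ℂ} (hρ : IsProfile ρ) {γ : ℝ → ℂ}
    (hγ : Continuous γ) : modeL2 hθ hρ hγ =ᵐ[volume.restrict (halfGuide θ)] mode θ ρ γ :=
  MemLp.coeFn_toLp _

/-- The mode with transverse profile `sin` and its gradient. -/
noncomputable def modeTriple (hθ : θ ∈ Ioo 0 (Real.pi / 2)) {ρ : ℝ → ℂ} (hρ : IsProfile ρ) :
    L2 (halfGuide θ) × L2 (halfGuide θ) × L2 (halfGuide θ) :=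
  (modeL2 hθ hρ contDiff_csin.continuous,
    (Real.cos θ : ℂ) • modeL2 hθ hρ.deriv contDiff_csin.continuous -
      (Real.sin θ : ℂ) • modeL2 hθ hρ contDiff_ccos.continuous,
    (Real.sin θ : ℂ) • modeL2 hθ hρ.deriv contDiff_csin.continuous +
      (Real.cos θ : ℂ) • modeL2 hθ hρ contDiff_ccos.continuous)

theorem represents_modeTriple (hθ : θ ∈ Ioo 0 (Real.pi / 2)) {ρ : ℝ → ℂ} (hρ : IsProfile ρ) :
    Represents (halfGuide θ) (modeTriple hθ hρ) (mode θ ρ csin) := by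
  have h1 := modeL2_ae hθ hρ.deriv contDiff_csin.continuous
  have h2 := modeL2_ae hθ hρ contDiff_ccos.continuous
  have s : ∀ (c : ℂ) (f : L2 (halfGuide θ)), _ := fun c f => Lp.coeFn_smul c f
  refine ⟨modeL2_ae hθ hρ contDiff_csin.continuous, ?_, ?_⟩
  · filter_upwards [h1, h2, s (Real.cos θ) (modeL2 hθ hρ.deriv contDiff_csin.continuous),
      s (Real.sin θ) (modeL2 hθ hρ contDiff_ccos.continuous),
      Lp.coeFn_sub ((Real.cos θ : ℂ) • modeL2 hθ hρ.deriv contDiff_csin.continuous)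
        ((Real.sin θ : ℂ) • modeL2 hθ hρ contDiff_ccos.continuous)] with x a1 a2 a3 a4 a5
    rw [modeTriple, a5, Pi.sub_apply, a3, a4, Pi.smul_apply, Pi.smul_apply, a1, a2,
      pd1_mode hρ.smooth contDiff_csin, deriv_csin, smul_eq_mul, smul_eq_mul]
  · filter_upwards [h1, h2, s (Real.sin θ) (modeL2 hθ hρ.deriv contDiff_csin.continuous),
      s (Real.cos θ) (modeL2 hθ hρ contDiff_ccos.continuous),
      Lp.coeFn_add ((Real.sin θ : ℂ) • modeL2 hθ hρ.deriv contDiff_csin.continuous)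
        ((Real.cos θ : ℂ) • modeL2 hθ hρ contDiff_ccos.continuous)] with x a1 a2 a3 a4 a5
    rw [modeTriple, a5, Pi.add_apply, a3, a4, Pi.smul_apply, Pi.smul_apply, a1, a2,
      pd2_mode hρ.smooth contDiff_csin, deriv_csin, smul_eq_mul, smul_eq_mul]

/-- The sine is replaced by `cutSin`, whose modes have compact support inside the open half-guide
and hence avoid the Dirichlet part. -/
theorem modeTriple_mem (hθ : θ ∈ Ioo 0 (Real.pi / 2)) {ρ : ℝ → ℂ} (hρ : IsProfile ρ) :
    modeTriple hθ hρ ∈ formDomain (halfGuide θ) (dirichletBoundary θ) := by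
  have hε := scale_pos (δ := 1) one_pos
  have hlim := tendsto_scale 1
  let γ : ℕ → ℝ → ℂ := fun n t => (cutSin (scale 1 n) t : ℂ)
  have hγ : ∀ n, ContDiff ℝ ∞ (γ n) := fun n =>
    Complex.ofRealCLM.contDiff.comp (contDiff_cutSin (scale 1 n))
  have hdγ : ∀ n t, deriv (γ n) t = ((deriv (cutSin (scale 1 n)) t : ℝ) : ℂ) := fun n t => by
    have := (hasDerivAt_cutSin (scale 1 n) t).ofReal_comp.deriv
    rw [(hasDerivAt_cutSin (scale 1 n) t).deriv, ← this]
  have hts : ∀ n, tsupport (γ n) ⊆ Icc (scale 1 n) (Real.pi - scale 1 n) := fun n => by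
    refine closure_minimal (fun t ht => ?_) isClosed_Icc
    by_contra h
    exact ht (by simp [γ, cutSin_eq_zero (hε n) h])
  obtain ⟨D, hD⟩ := exists_bound_deriv_ramp
  have hD0 : 0 ≤ D := (abs_nonneg _).trans (hD 0 0)
  obtain ⟨C0, hC0⟩ := hρ.compact.exists_bound_of_continuous hρ.smooth.continuous
  obtain ⟨C1, hC1⟩ := hρ.deriv.compact.exists_bound_of_continuous hρ.deriv.smooth.continuous
  have hC0' : 0 ≤ C0 := (norm_nonneg _).trans (hC0 0)
  have hC1' : 0 ≤ C1 := (norm_nonneg _).trans (hC1 0)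
  have b1 : ∀ n x, ‖mode θ (deriv ρ) (γ n) x‖ ≤ C1 * 2 := fun n x => by
    rw [mode, norm_mul]
    refine mul_le_mul (hC1 _) ?_ (norm_nonneg _) hC1'
    rw [Complex.norm_real]
    exact abs_cutSin_le _ _
  have b2 : ∀ n x, ‖mode θ ρ (deriv (γ n)) x‖ ≤ C0 * (2 * D) := fun n x => by
    rw [mode, norm_mul, hdγ]
    refine mul_le_mul (hC0 _) ?_ (norm_nonneg _) hC0'
    rw [Complex.norm_real]
    exact abs_deriv_cutSin_le hD _ _
  have trig : ∀ (r : ℝ) (a : ℂ) (B : ℝ), |r| ≤ 1 → ‖a‖ ≤ B → ‖(r : ℂ) * a‖ ≤ B :=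
    fun r a B hr ha => by
      rw [norm_mul, Complex.norm_real]
      exact (mul_le_of_le_one_left (norm_nonneg _) hr).trans ha
  have hrep := represents_modeTriple hθ hρ
  have hin : ∀ᵐ x ∂volume.restrict (halfGuide θ), across θ x ∈ Ioo 0 Real.pi := by
    filter_upwards [ae_restrict_mem (isOpen_halfGuide θ).measurableSet] with x hx
    exact across_mem_Ioo hθ hx
  have t0 : ∀ x, across θ x ∈ Ioo 0 Real.pi → ∀ σ : ℝ → ℂ,
      Tendsto (fun n => mode θ σ (γ n) x) atTop (𝓝 (mode θ σ csin x)) := fun x hx σ =>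
    tendsto_const_nhds.mul ((Complex.continuous_ofReal.tendsto _).comp
      (tendsto_cutSin hε hlim hx))
  have t1 : ∀ x, across θ x ∈ Ioo 0 Real.pi → ∀ σ : ℝ → ℂ,
      Tendsto (fun n => mode θ σ (deriv (γ n)) x) atTop (𝓝 (mode θ σ ccos x)) := fun x hx σ => by
    simp only [mode, hdγ]
    exact tendsto_const_nhds.mul ((Complex.continuous_ofReal.tendsto _).comp
      (tendsto_deriv_cutSin hε hlim hx))
  refine mem_formDomain_of_tendsto (isOpen_halfGuide θ) (ψ := fun n => mode θ ρ (γ n))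
    (K := stripOver θ ρ) (C := C0 * 2 + (C1 * 2 + C0 * (2 * D))) (fun n => ⟨?_, ?_, ?_⟩)
    (isCompact_stripOver hρ.compact) (fun n x hx => ?_) (fun n x => ?_) (fun n x => ?_)
    (fun n x => ?_) ?_ ?_ ?_
  · exact contDiff_mode hρ.smooth (hγ n)
  · refine (isCompact_stripOver (θ := θ) hρ.compact).of_isClosed_subset (isClosed_tsupport _)
      fun x hx => ?_
    obtain ⟨h1, h2⟩ := tsupport_mode_subset _ _ hx
    have h3 := hts n h2
    exact ⟨h1, (hε n).le.trans h3.1, h3.2.trans (by linarith [hε n])⟩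
  · intro x hx hxΓ
    obtain ⟨h1, h2⟩ := tsupport_mode_subset _ _ hx
    have h3 := hts n h2
    have h4 : 0 < across θ x := (hε n).trans_le h3.1
    have h5 : x ∈ halfGuide θ := (mem_halfGuide_iff hθ).2
      ⟨⟨h4, h3.2.trans_lt (by linarith [hε n])⟩, snd_pos_of_along_pos hθ (hρ.supp h1) h4.le⟩
    exact subset_compl_frontier (isOpen_halfGuide θ) h5 hxΓ.2
  · obtain ⟨h1, h2⟩ := tsupport_mode_subset _ _ hx
    have h3 := hts n h2
    exact ⟨h1, (hε n).le.trans h3.1, h3.2.trans (by linarith [hε n])⟩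
  · have : ‖mode θ ρ (γ n) x‖ ≤ C0 * 2 := by
      rw [mode, norm_mul]
      refine mul_le_mul (hC0 _) ?_ (norm_nonneg _) hC0'
      rw [Complex.norm_real]
      exact abs_cutSin_le _ _
    have : 0 ≤ C1 * 2 + C0 * (2 * D) := by positivity
    linarith
  · rw [pd1_mode hρ.smooth (hγ n)]
    have := (norm_sub_le _ _).trans (add_le_add (trig _ _ _ (Real.abs_cos_le_one θ) (b1 n x))
      (trig _ _ _ (Real.abs_sin_le_one θ) (b2 n x)))
    linarith
  · rw [pd2_mode hρ.smooth (hγ n)]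
    have := (norm_add_le _ _).trans (add_le_add (trig _ _ _ (Real.abs_sin_le_one θ) (b1 n x))
      (trig _ _ _ (Real.abs_cos_le_one θ) (b2 n x)))
    linarith
  · filter_upwards [hrep.val, hin] with x h1 h2
    rw [h1]
    exact t0 x h2 ρ
  · filter_upwards [hrep.pd1, hin] with x h1 h2
    rw [h1, pd1_mode hρ.smooth contDiff_csin, deriv_csin]
    simp only [pd1_mode hρ.smooth (hγ _)]
    exact ((t0 x h2 _).const_mul _).sub ((t1 x h2 _).const_mul _)
  · filter_upwards [hrep.pd2, hin] with x h1 h2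
    rw [h1, pd2_mode hρ.smooth contDiff_csin, deriv_csin]
    simp only [pd2_mode hρ.smooth (hγ _)]
    exact ((t0 x h2 _).const_mul _).add ((t1 x h2 _).const_mul _)

end Modes

/-! ### Modes as approximate eigenfunctions of the mixed Laplacian -/

section Weyl

variable {θ : ℝ}

/-- In rotated coordinates `-Δ (ρ(s) sin t) = (ρ - ρ'')(s) sin t`. Green's formula has no boundary
term, since test functions vanish near the Dirichlet part and the mode vanishes near the rest of the
boundary. -/
theorem mode_mem_graph (hθ : θ ∈ Ioo 0 (Real.pi / 2)) {ρ σ : ℝ → ℂ} (hρ : IsProfile ρ)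
    (hσ : IsProfile σ) (h : ∀ s, σ s = ρ s - deriv (deriv ρ) s) :
    (modeL2 hθ hρ contDiff_csin.continuous, modeL2 hθ hσ contDiff_csin.continuous) ∈
      (mixedLaplacian θ).graph := by
  have hU := isOpen_halfGuide θ
  refine mem_graph_mixed.2 ⟨modeTriple hθ hρ, modeTriple_mem hθ hρ, rfl, fun v hv => ?_⟩
  rw [formDomain_eq_closure hU] at hv
  refine closure_minimal
    (t := {v : L2 (halfGuide θ) × L2 (halfGuide θ) × L2 (halfGuide θ) |
      inner ℂ v.2.1 (modeTriple hθ hρ).2.1 + inner ℂ v.2.2 (modeTriple hθ hρ).2.2 =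
        inner ℂ v.1 (modeL2 hθ hσ contDiff_csin.continuous)}) (fun w hw => ?_)
    (isClosed_eq (by fun_prop) (by fun_prop)) hv
  obtain ⟨φ, hφ, hw⟩ := mem_smoothTriples.1 hw
  have hrep := represents_modeTriple hθ hρ
  rw [mem_ofPred_eq, inner_eq_integral hw.pd1 hrep.pd1, inner_eq_integral hw.pd2 hrep.pd2,
    inner_eq_integral hw.val (modeL2_ae hθ hσ contDiff_csin.continuous)]
  let g₁ : ℝ × ℝ → ℂ := pd1 (mode θ ρ csin)
  let g₂ : ℝ × ℝ → ℂ := pd2 (mode θ ρ csin)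
  have e₁ : g₁ = fun x => Real.cos θ * mode θ (deriv ρ) csin x - Real.sin θ * mode θ ρ ccos x := by
    ext x
    rw [← deriv_csin]
    exact pd1_mode hρ.smooth contDiff_csin x
  have e₂ : g₂ = fun x => Real.sin θ * mode θ (deriv ρ) csin x + Real.cos θ * mode θ ρ ccos x := by
    ext x
    rw [← deriv_csin]
    exact pd2_mode hρ.smooth contDiff_csin x
  have c1 := contDiff_mode (θ := θ) hρ.deriv.smooth contDiff_csin
  have c2 := contDiff_mode (θ := θ) hρ.smooth contDiff_ccos
  have s₁ : ContDiff ℝ ∞ g₁ := by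
    rw [e₁]
    exact (contDiff_const.mul c1).sub (contDiff_const.mul c2)
  have s₂ : ContDiff ℝ ∞ g₂ := by
    rw [e₂]
    exact (contDiff_const.mul c1).add (contDiff_const.mul c2)
  have d1 := c1.differentiable (by simp)
  have d2 := c2.differentiable (by simp)
  have hdiv : ∀ x, pd1 g₁ x + pd2 g₂ x = - mode θ σ csin x := fun x => by
    have h1 : pd1 g₁ x = Real.cos θ * pd1 (mode θ (deriv ρ) csin) x -
        Real.sin θ * pd1 (mode θ ρ ccos) x := by
      rw [e₁]
      simp only [pd1]
      rw [fderiv_fun_sub ((d1 x).const_mul _) ((d2 x).const_mul _), fderiv_const_mul (d1 x),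
        fderiv_const_mul (d2 x)]
      rfl
    have h2 : pd2 g₂ x = Real.sin θ * pd2 (mode θ (deriv ρ) csin) x +
        Real.cos θ * pd2 (mode θ ρ ccos) x := by
      rw [e₂]
      simp only [pd2]
      rw [fderiv_fun_add ((d1 x).const_mul _) ((d2 x).const_mul _), fderiv_const_mul (d1 x),
        fderiv_const_mul (d2 x)]
      rfl
    rw [h1, h2, pd1_mode hρ.deriv.smooth contDiff_csin, pd2_mode hρ.deriv.smooth contDiff_csin,
      pd1_mode hρ.smooth contDiff_ccos, pd2_mode hρ.smooth contDiff_ccos, deriv_csin, deriv_ccos]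
    have ht : (Real.sin θ : ℂ) ^ 2 + (Real.cos θ : ℂ) ^ 2 = 1 := by
      exact_mod_cast Real.sin_sq_add_cos_sq θ
    simp only [mode, h]
    linear_combination (deriv (deriv ρ) (along θ x) * csin (across θ x) -
      ρ (along θ x) * csin (across θ x)) * ht
  -- The product avoids the whole boundary: a boundary point in the support of the mode has `x₂ >
  -- 0`, hence lies in the Dirichlet part, which the support of `φ` does not meet.
  have hg : ∀ g : ℝ × ℝ → ℂ, ContDiff ℝ ∞ g → tsupport g ⊆ tsupport (mode θ ρ csin) →
      IsTest (frontier (halfGuide θ))ᶜ (fun x => star (φ x) * g x) := fun g hg hs => by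
    refine ⟨(hφ.star.mul_right hg).smooth, (hφ.star.mul_right hg).compact, fun x hx hfr => ?_⟩
    have h1 := hφ.star.supp (tsupport_mul_subset_left hx)
    have h2 := (tsupport_mode_subset _ _ (hs (tsupport_mul_subset_right hx))).1
    have h3 := closure_halfGuide_subset hθ hfr.1
    exact h1 (mem_dirichletBoundary_of_pos hfr (snd_pos_of_along_pos hθ (hρ.supp h2) h3.1.1))
  have hsub : ∀ v : ℝ × ℝ, tsupport (fun x => fderiv ℝ (mode θ ρ csin) x v) ⊆
      tsupport (mode θ ρ csin) := fun v => tsupport_fderiv_apply_subset ℝ v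
  have t₁ := hg g₁ s₁ (hsub (1, 0))
  have t₂ := hg g₂ s₂ (hsub (0, 1))
  have z₁ := t₁.setIntegral_fderiv_eq_zero hU (1, 0)
  have z₂ := t₂.setIntegral_fderiv_eq_zero hU (0, 1)
  have hφd := hφ.star.differentiable
  have hstar : ∀ x v, fderiv ℝ (fun y => star (φ y)) x v = star (fderiv ℝ φ x v) := fun x v => by
    have h1 := (hφ.hasDerivAt_line x v).star
    exact (hφ.star.hasDerivAt_line x v).unique h1
  have l₁ : ∀ x, fderiv ℝ (fun y => star (φ y) * g₁ y) x (1, 0) =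
      star (pd1 φ x) * g₁ x + star (φ x) * pd1 g₁ x := fun x => by
    rw [fderiv_fun_mul (hφd x) (s₁.differentiable (by simp) x)]
    simp only [add_apply, FunLike.coe_smul, Pi.smul_apply, smul_eq_mul, hstar, pd1]
    ring
  have l₂ : ∀ x, fderiv ℝ (fun y => star (φ y) * g₂ y) x (0, 1) =
      star (pd2 φ x) * g₂ x + star (φ x) * pd2 g₂ x := fun x => by
    rw [fderiv_fun_mul (hφd x) (s₂.differentiable (by simp) x)]
    simp only [add_apply, FunLike.coe_smul, Pi.smul_apply, smul_eq_mul, hstar, pd2]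
    ring
  let μ := volume.restrict (halfGuide θ)
  have i₁ : Integrable (fun x => star (pd1 φ x) * g₁ x) μ :=
    ((hφ.memLp_pd (1, 0) μ).star).integrable_mul ((Lp.memLp _).ae_eq hrep.pd1)
  have i₂ : Integrable (fun x => star (pd2 φ x) * g₂ x) μ :=
    ((hφ.memLp_pd (0, 1) μ).star).integrable_mul ((Lp.memLp _).ae_eq hrep.pd2)
  have i₀ : Integrable (fun x => star (φ x) * mode θ σ csin x) μ :=
    ((hφ.memLp μ).star).integrable_mul
      (memLp_mode hθ hσ.smooth.continuous hσ.compact contDiff_csin.continuous)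
  have j₁ := ((t₁.continuous_pd (1, 0)).integrable_of_hasCompactSupport (μ := μ)
    (t₁.compact_pd (1, 0)))
  have j₂ := ((t₂.continuous_pd (0, 1)).integrable_of_hasCompactSupport (μ := μ)
    (t₂.compact_pd (0, 1)))
  have hsum := integral_add j₁ j₂
  rw [z₁, z₂, add_zero] at hsum
  rw [← sub_eq_zero]
  change (∫ x, star (pd1 φ x) * g₁ x ∂μ) + (∫ x, star (pd2 φ x) * g₂ x ∂μ) - _ = 0
  have i₃ : Integrable (fun x => star (pd1 φ x) * g₁ x + star (pd2 φ x) * g₂ x) μ := i₁.add i₂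
  rw [← integral_add i₁ i₂, ← integral_sub i₃ i₀, ← hsum]
  refine integral_congr_ae (Eventually.of_forall fun x => ?_)
  simp only [l₁, l₂]
  linear_combination (-star (φ x)) * hdiv x

/-- The squared norm of the sine on `(0, π)`. -/
noncomputable def sinMass : ℝ := ∫ t in Ioo 0 Real.pi, Real.sin t ^ 2

theorem sinMass_pos : 0 < sinMass := by
  have h : sinMass = ∫ t in (0 : ℝ)..Real.pi, Real.sin t ^ 2 := by
    rw [sinMass, intervalIntegral.integral_of_le Real.pi_pos.le, integral_Ioc_eq_integral_Ioo]
  rw [h, integral_sin_sq]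
  simp [Real.pi_pos]

/-- As `ρ` lives on `(0, ∞)`, the half-guide may be replaced by the full strip, where Fubini applies
after rotation. -/
theorem norm_modeL2_sq (hθ : θ ∈ Ioo 0 (Real.pi / 2)) {ρ : ℝ → ℂ} (hρ : IsProfile ρ) :
    ‖modeL2 hθ hρ contDiff_csin.continuous‖ ^ 2 = sinMass * ∫ s, ‖ρ s‖ ^ 2 := by
  rw [norm_sq_eq_integral]
  have h1 : ∫ x in halfGuide θ, ‖modeL2 hθ hρ contDiff_csin.continuous x‖ ^ 2 =
      ∫ x in halfGuide θ, ‖mode θ ρ csin x‖ ^ 2 := by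
    refine integral_congr_ae ?_
    filter_upwards [modeL2_ae hθ hρ contDiff_csin.continuous] with x hx
    rw [hx]
  have h2 : ∫ x in halfGuide θ, ‖mode θ ρ csin x‖ ^ 2 =
      ∫ x in rot θ ⁻¹' (univ ×ˢ Ioo 0 Real.pi), ‖mode θ ρ csin x‖ ^ 2 := by
    refine (setIntegral_eq_of_subset_of_forall_sdiff_eq_zero
      ((rot θ).continuous.measurable (MeasurableSet.univ.prod measurableSet_Ioo))
      (fun x hx => ⟨mem_univ _, across_mem_Ioo hθ hx⟩) fun x hx => ?_).symm
    have hρ0 : ρ (along θ x) = 0 := image_eq_zero_of_notMem_tsupport fun h => hx.2 <|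
      (mem_halfGuide_iff hθ).2 ⟨hx.1.2, snd_pos_of_along_pos hθ (hρ.supp h) hx.1.2.1.le⟩
    simp [mode, hρ0]
  have h3 : ∀ x, ‖mode θ ρ csin x‖ ^ 2 =
      (fun y : ℝ × ℝ => ‖ρ y.1‖ ^ 2 * Real.sin y.2 ^ 2) (rot θ x) := fun x => by
    simp only [rot_apply, mode, csin, norm_mul, Complex.norm_real, Real.norm_eq_abs, mul_pow,
      sq_abs]
  rw [h1, h2]
  simp only [h3]
  rw [measurePreserving_rot.setIntegral_preimage_emb (rot θ).measurableEmbedding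
    (fun y : ℝ × ℝ => ‖ρ y.1‖ ^ 2 * Real.sin y.2 ^ 2), Measure.volume_eq_prod,
    setIntegral_prod_mul (fun s => ‖ρ s‖ ^ 2) (fun t => Real.sin t ^ 2), Measure.restrict_univ,
    mul_comm, sinMass]

theorem inner_modeL2_eq_zero (hθ : θ ∈ Ioo 0 (Real.pi / 2)) {ρ σ : ℝ → ℂ} (hρ : IsProfile ρ)
    (hσ : IsProfile σ) (h : ∀ s, ρ s = 0 ∨ σ s = 0) :
    inner ℂ (modeL2 hθ hρ contDiff_csin.continuous) (modeL2 hθ hσ contDiff_csin.continuous) =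
      0 := by
  rw [inner_eq_integral (modeL2_ae hθ hρ contDiff_csin.continuous)
    (modeL2_ae hθ hσ contDiff_csin.continuous)]
  refine integral_eq_zero_of_ae (Eventually.of_forall fun x => ?_)
  rcases h (along θ x) with h | h <;> simp [mode, h]

theorem modeL2_eq_add_smul (hθ : θ ∈ Ioo 0 (Real.pi / 2)) {ρ σ τ : ℝ → ℂ} (hρ : IsProfile ρ)
    (hσ : IsProfile σ) (hτ : IsProfile τ) {c : ℂ} (h : ∀ s, σ s = τ s + c * ρ s) :
    modeL2 hθ hσ contDiff_csin.continuous = modeL2 hθ hτ contDiff_csin.continuous +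
      c • modeL2 hθ hρ contDiff_csin.continuous := by
  refine Lp.ext ?_
  filter_upwards [modeL2_ae hθ hρ contDiff_csin.continuous,
    modeL2_ae hθ hσ contDiff_csin.continuous, modeL2_ae hθ hτ contDiff_csin.continuous,
    Lp.coeFn_add (modeL2 hθ hτ contDiff_csin.continuous)
      (c • modeL2 hθ hρ contDiff_csin.continuous),
    Lp.coeFn_smul c (modeL2 hθ hρ contDiff_csin.continuous)] with x h1 h2 h3 h4 h5
  rw [h4, Pi.add_apply, h5, Pi.smul_apply, h1, h2, h3, smul_eq_mul, mode, mode, mode, h]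
  ring

/-! ### Wave packets -/

/-- A bump function supported in `[1, 2]`. -/
noncomputable def unitBump : ContDiffBump (3 / 2 : ℝ) where
  rIn := 1 / 4
  rOut := 1 / 2
  rIn_pos := by norm_num
  rIn_lt_rOut := by norm_num

/-- The bump function as a complex valued function. -/
noncomputable def cbump (s : ℝ) : ℂ := (unitBump s : ℂ)

theorem contDiff_cbump : ContDiff ℝ ∞ cbump :=
  Complex.ofRealCLM.contDiff.comp unitBump.contDiff

theorem cbump_eq_zero {s : ℝ} (hs : s ∉ Ioo (1 : ℝ) 2) : cbump s = 0 := by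
  have : (unitBump : ℝ → ℝ) s = 0 := unitBump.zero_of_le_dist (by
    rw [Real.dist_eq]
    change 1 / 2 ≤ _
    rw [mem_Ioo, not_and_or, not_lt, not_lt] at hs
    rw [le_abs]
    rcases hs with h | h
    · right; linarith
    · left; linarith)
  rw [cbump, this, Complex.ofReal_zero]

theorem tsupport_cbump : tsupport cbump ⊆ Icc 1 2 :=
  closure_minimal (fun s hs => by
    by_contra h
    exact hs (cbump_eq_zero fun h' => h (Ioo_subset_Icc_self h'))) isClosed_Icc

theorem hasCompactSupport_cbump : HasCompactSupport cbump :=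
  isCompact_Icc.of_isClosed_subset (isClosed_tsupport _) tsupport_cbump

theorem integral_cbump_pos : 0 < ∫ s, ‖cbump s‖ ^ 2 := by
  have hc : Continuous fun s => ‖cbump s‖ ^ 2 := contDiff_cbump.continuous.norm.pow 2
  refine hc.integral_pos_of_hasCompactSupport_nonneg_nonzero
    (HasCompactSupport.intro (isCompact_Icc (a := (1 : ℝ)) (b := 2)) fun s hs => ?_)
    (fun s => by positivity) (x := 3 / 2) ?_
  · rw [cbump_eq_zero fun h => hs (Ioo_subset_Icc_self h)]
    simp
  · have : (unitBump : ℝ → ℝ) (3 / 2) = 1 := unitBump.one_of_mem_closedBall (by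
      simp [unitBump])
    simp [cbump, this]

/-- The plane wave of wave number `k`. -/
noncomputable def wave (k s : ℝ) : ℂ := Complex.exp (Complex.I * k * s)

theorem hasDerivAt_wave (k s : ℝ) : HasDerivAt (wave k) (Complex.I * k * wave k s) s := by
  have h1 : HasDerivAt (fun s : ℝ => Complex.I * k * (s : ℂ)) (Complex.I * k) s := by
    simpa using (Complex.ofRealCLM.hasDerivAt (x := s)).const_mul (Complex.I * k)
  exact h1.cexp.congr_deriv (by rw [wave]; ring)

theorem contDiff_wave (k : ℝ) : ContDiff ℝ ∞ (wave k) := by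
  have : ContDiff ℝ ∞ fun s : ℝ => (s : ℂ) := Complex.ofRealCLM.contDiff
  unfold wave
  fun_prop

theorem norm_wave (k s : ℝ) : ‖wave k s‖ = 1 := by
  rw [wave, show Complex.I * k * s = ((k * s : ℝ) : ℂ) * Complex.I by push_cast; ring,
    Complex.norm_exp_ofReal_mul_I]

theorem deriv_mul_wave {β : ℝ → ℂ} (hβ : Differentiable ℝ β) (k : ℝ) :
    deriv (fun s => β s * wave k s) = fun s => (deriv β s + Complex.I * k * β s) * wave k s := by
  ext s
  have h := ((hβ s).hasDerivAt.mul (hasDerivAt_wave k s)).deriv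
  refine Eq.trans h ?_
  ring

/-- The wave packet of amplitude `a`, wave number `k` and inverse length `ℓ`. -/
noncomputable def packet (a k ℓ s : ℝ) : ℂ := a * cbump (ℓ * s) * wave k s

theorem isProfile_packet (a k : ℝ) {ℓ : ℝ} (hℓ : 0 < ℓ) : IsProfile (packet a k ℓ) := by
  have hts : tsupport (packet a k ℓ) ⊆ Icc (1 / ℓ) (2 / ℓ) :=
    closure_minimal (fun s hs => by
      by_contra h
      refine hs ?_
      have : cbump (ℓ * s) = 0 := cbump_eq_zero fun h' => h
        ⟨by rw [div_le_iff₀ hℓ]; linarith [h'.1], by rw [le_div_iff₀ hℓ]; linarith [h'.2]⟩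
      rw [packet, this, mul_zero, zero_mul]) isClosed_Icc
  refine ⟨?_, isCompact_Icc.of_isClosed_subset (isClosed_tsupport _) hts, fun s hs => ?_⟩
  · have h1 : ContDiff ℝ ∞ fun s : ℝ => cbump (ℓ * s) := contDiff_cbump.comp (by fun_prop)
    exact (contDiff_const.mul h1).mul (contDiff_wave k)
  · exact lt_of_lt_of_le (by positivity) (hts hs).1

/-- The term without a factor `ℓ` is `-k²` times the packet; the rest is the defect and is small for
long packets. -/
theorem deriv_deriv_packet (a k ℓ s : ℝ) :
    deriv (deriv (packet a k ℓ)) s = (a * (ℓ * (ℓ * deriv (deriv cbump) (ℓ * s) +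
      2 * Complex.I * k * deriv cbump (ℓ * s))) - a * k ^ 2 * cbump (ℓ * s)) * wave k s := by
  have hb : Differentiable ℝ cbump := contDiff_cbump.differentiable (by simp)
  have hb' : Differentiable ℝ (deriv cbump) :=
    (contDiff_cbump.deriv' (n := ∞)).differentiable (by simp)
  have aux : ∀ β : ℝ → ℂ, Differentiable ℝ β → ∀ s,
      HasDerivAt (fun s => β (ℓ * s)) (ℓ * deriv β (ℓ * s)) s := fun β hβ s => by
    have h := (hβ (ℓ * s)).hasDerivAt.scomp s ((hasDerivAt_id s).const_mul ℓ)
    simpa [Function.comp_def] using h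
  have d1 : ∀ s, HasDerivAt (fun s => a * cbump (ℓ * s)) (a * (ℓ * deriv cbump (ℓ * s))) s :=
    fun s => (aux _ hb s).const_mul _
  have e1 : deriv (packet a k ℓ) = fun s =>
      (a * (ℓ * deriv cbump (ℓ * s)) + Complex.I * k * (a * cbump (ℓ * s))) * wave k s := by
    have h := deriv_mul_wave (β := fun s => a * cbump (ℓ * s))
      (fun s => (d1 s).differentiableAt) k
    have h' : packet a k ℓ = fun s => a * cbump (ℓ * s) * wave k s := rfl
    rw [h', h]
    ext s
    rw [(d1 s).deriv]
  have d2 : ∀ s, HasDerivAt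
      (fun s => a * (ℓ * deriv cbump (ℓ * s)) + Complex.I * k * (a * cbump (ℓ * s)))
      (a * (ℓ * (ℓ * deriv (deriv cbump) (ℓ * s))) +
        Complex.I * k * (a * (ℓ * deriv cbump (ℓ * s)))) s := fun s =>
    (((aux _ hb' s).const_mul _).const_mul _).add ((d1 s).const_mul _)
  rw [e1, deriv_mul_wave (fun s => (d2 s).differentiableAt) k]
  simp only [(d2 s).deriv]
  linear_combination (a * k ^ 2 * cbump (ℓ * s) * wave k s) * Complex.I_sq

theorem integral_norm_packet_sq (a k : ℝ) {ℓ : ℝ} (hℓ : 0 < ℓ) :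
    ∫ s, ‖packet a k ℓ s‖ ^ 2 = a ^ 2 / ℓ * ∫ s, ‖cbump s‖ ^ 2 := by
  have h : ∀ s, ‖packet a k ℓ s‖ ^ 2 = a ^ 2 * (fun s => ‖cbump s‖ ^ 2) (ℓ * s) := fun s => by
    rw [packet, norm_mul, norm_mul, norm_wave, Complex.norm_real, mul_one, mul_pow,
      Real.norm_eq_abs, sq_abs]
  simp only [h]
  rw [integral_const_mul, Measure.integral_comp_mul_left (fun s => ‖cbump s‖ ^ 2),
    abs_of_pos (inv_pos.2 hℓ), smul_eq_mul]
  ring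

/-- A bound for the defect of the wave packets. -/
theorem exists_defect_bound (k : ℝ) : ∃ M : ℝ, ∀ a ℓ : ℝ, 0 < ℓ → ℓ ≤ 1 →
    ∫ s, ‖-(deriv (deriv (packet a k ℓ)) s + k ^ 2 * packet a k ℓ s)‖ ^ 2 ≤
      a ^ 2 * ℓ * M := by
  let G : ℝ → ℝ := fun s => (‖deriv (deriv cbump) s‖ + 2 * |k| * ‖deriv cbump s‖) ^ 2
  have hc1 : Continuous (deriv cbump) := (contDiff_cbump.deriv' (n := ∞)).continuous
  have hc2 : Continuous (deriv (deriv cbump)) :=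
    ((contDiff_cbump.deriv' (n := ∞)).deriv' (n := ∞)).continuous
  have hG : Continuous G := by fun_prop
  have hs1 := hasCompactSupport_cbump.deriv
  have hGs : HasCompactSupport G := by
    refine HasCompactSupport.intro (K := tsupport (deriv cbump)) hs1 fun s hs => ?_
    have h1 : deriv cbump s = 0 := image_eq_zero_of_notMem_tsupport hs
    have h2 : deriv (deriv cbump) s = 0 := image_eq_zero_of_notMem_tsupport fun h =>
      hs (tsupport_deriv_subset h)
    simp [G, h1, h2]
  have hGi : Integrable G := hG.integrable_of_hasCompactSupport hGs
  refine ⟨∫ s, G s, fun a ℓ hℓ hℓ1 => ?_⟩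
  -- The defect carries a factor `a ℓ`, hence `a² ℓ²` after squaring; the change of variable `ℓ s`
  -- then costs one power of `ℓ`.
  have hpt : ∀ s, ‖-(deriv (deriv (packet a k ℓ)) s + k ^ 2 * packet a k ℓ s)‖ ^ 2 ≤
      a ^ 2 * ℓ ^ 2 * G (ℓ * s) := fun s => by
    have e : -(deriv (deriv (packet a k ℓ)) s + k ^ 2 * packet a k ℓ s) =
        -((a * ℓ : ℝ) * (ℓ * deriv (deriv cbump) (ℓ * s) +
          2 * Complex.I * k * deriv cbump (ℓ * s)) * wave k s) := by
      rw [deriv_deriv_packet, packet]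
      push_cast
      ring
    have hn : ‖(ℓ : ℂ) * deriv (deriv cbump) (ℓ * s) +
        2 * Complex.I * k * deriv cbump (ℓ * s)‖ ≤
        ‖deriv (deriv cbump) (ℓ * s)‖ + 2 * |k| * ‖deriv cbump (ℓ * s)‖ := by
      refine (norm_add_le _ _).trans (add_le_add ?_ (le_of_eq ?_))
      · rw [norm_mul, Complex.norm_real, Real.norm_eq_abs, abs_of_pos hℓ]
        exact mul_le_of_le_one_left (norm_nonneg _) hℓ1
      · simp
    rw [e, norm_neg, norm_mul, norm_wave, mul_one, norm_mul, mul_pow, Complex.norm_real,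
      Real.norm_eq_abs, sq_abs, mul_pow]
    gcongr
    exact pow_le_pow_left₀ (norm_nonneg _) hn 2
  have hGℓ : Integrable fun s => G (ℓ * s) := hGi.comp_mul_left' hℓ.ne'
  calc _ ≤ ∫ s, a ^ 2 * ℓ ^ 2 * G (ℓ * s) :=
        integral_mono_of_nonneg (Eventually.of_forall fun s => by positivity)
          (hGℓ.const_mul _) (Eventually.of_forall hpt)
    _ = a ^ 2 * ℓ * ∫ s, G s := by
        rw [integral_const_mul, Measure.integral_comp_mul_left G, abs_of_pos (inv_pos.2 hℓ),
          smul_eq_mul]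
        field_simp

/-! ### Failure of the Fredholm property above the threshold -/

/-- The graph of the operator together with the gradients. -/
def gradientGraph (U Γ : Set (ℝ × ℝ)) : Submodule ℂ ((L2 U × L2 U × L2 U) × L2 U) where
  carrier := {q | q.1 ∈ formDomain U Γ ∧ ∀ v ∈ formDomain U Γ,
    inner ℂ v.2.1 q.1.2.1 + inner ℂ v.2.2 q.1.2.2 = inner ℂ v.1 q.2}
  zero_mem' := ⟨Submodule.zero_mem _, by simp⟩
  add_mem' := by
    rintro p q ⟨hp, h⟩ ⟨hq, k⟩
    refine ⟨Submodule.add_mem _ hp hq, fun v hv => ?_⟩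
    simp only [Prod.fst_add, Prod.snd_add, inner_add_right, ← h v hv, ← k v hv]
    ring
  smul_mem' := by
    rintro c p ⟨hp, h⟩
    refine ⟨Submodule.smul_mem _ c hp, fun v hv => ?_⟩
    simp only [Prod.smul_fst, Prod.smul_snd, inner_smul_right, ← h v hv]
    ring

/-- With the gradient recorded, the weak equation is a family of continuous conditions on a closed
space. This supplies the complete space for the open mapping argument in
`not_isFredholmAt_of_orthonormal`. -/
theorem isClosed_gradientGraph {U Γ : Set (ℝ × ℝ)} (hU : IsOpen U) :
    IsClosed (gradientGraph U Γ : Set ((L2 U × L2 U × L2 U) × L2 U)) := by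
  have : (gradientGraph U Γ : Set ((L2 U × L2 U × L2 U) × L2 U)) =
      Prod.fst ⁻¹' (formDomain U Γ : Set (L2 U × L2 U × L2 U)) ∩
        ⋂ (v : L2 U × L2 U × L2 U) (_ : v ∈ formDomain U Γ),
          {q | inner ℂ v.2.1 q.1.2.1 + inner ℂ v.2.2 q.1.2.2 = inner ℂ v.1 q.2} := by
    ext q
    simp only [mem_inter_iff, mem_iInter]
    rfl
  rw [this]
  refine ((isClosed_formDomain hU).preimage continuous_fst).inter
    (isClosed_iInter fun v => isClosed_iInter fun _ => isClosed_eq (by fun_prop) (by fun_prop))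

/-- Above the threshold the mixed Laplacian is not Fredholm. -/
theorem not_isFredholmAt_mixedLaplacian (hθ : θ ∈ Ioo 0 (Real.pi / 2)) {z : ℂ} (him : z.im = 0)
    (hre : 1 ≤ z.re) : ¬ IsFredholmAt (mixedLaplacian θ) z := by
  -- The energy `z` is shared between the transverse sine, which takes `1`, and the longitudinal
  -- wave, which takes `k²`.
  let k : ℝ := Real.sqrt (z.re - 1)
  have hz : z = 1 + (k : ℂ) ^ 2 := by
    refine Complex.ext ?_ ?_
    · rw [← Complex.ofReal_pow, Complex.add_re, Complex.ofReal_re, Real.sq_sqrt (by linarith)]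
      simp
    · rw [← Complex.ofReal_pow, Complex.add_im, Complex.ofReal_im, him]
      simp
  let m : ℝ := sinMass * ∫ s, ‖cbump s‖ ^ 2
  have hm : 0 < m := mul_pos sinMass_pos integral_cbump_pos
  -- The `n`-th packet can be nonzero only on `(2ⁿ, 2ⁿ⁺¹)`, so different packets are orthogonal.
  let ℓ : ℕ → ℝ := fun n => (1 / 2) ^ n
  have hℓ : ∀ n, 0 < ℓ n := fun n => by positivity
  have hℓ1 : ∀ n, ℓ n ≤ 1 := fun n => pow_le_one₀ (by norm_num) (by norm_num)
  -- Normalisation: the squared norm of the mode is `a² m / ℓ`.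
  let a : ℕ → ℝ := fun n => Real.sqrt (ℓ n / m)
  have ha : ∀ n, a n ^ 2 = ℓ n / m := fun n => Real.sq_sqrt (div_nonneg (hℓ n).le hm.le)
  let ρ : ℕ → ℝ → ℂ := fun n => packet (a n) k (ℓ n)
  have hρ : ∀ n, IsProfile (ρ n) := fun n => isProfile_packet _ _ (hℓ n)
  have hσ : ∀ n, IsProfile fun s => ρ n s - deriv (deriv (ρ n)) s := fun n =>
    ⟨(hρ n).smooth.sub (hρ n).deriv.deriv.smooth, (hρ n).compact.sub (hρ n).deriv.deriv.compact,
      (tsupport_sub _ _).trans (union_subset (hρ n).supp (hρ n).deriv.deriv.supp)⟩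
  -- The profile of the defect: `(ρ - ρ'') - (1 + k²) ρ = -(ρ'' + k² ρ)`.
  have hτ : ∀ n, IsProfile fun s => -(deriv (deriv (ρ n)) s + k ^ 2 * ρ n s) := fun n => by
    refine ⟨((hρ n).deriv.deriv.smooth.add (contDiff_const.mul (hρ n).smooth)).neg, ?_, ?_⟩
    · exact ((hρ n).deriv.deriv.compact.add ((hρ n).compact.mul_left)).neg
    · refine (tsupport_neg _).subset.trans ((tsupport_add _ _).trans (union_subset
        (hρ n).deriv.deriv.supp (tsupport_mul_subset_right.trans (hρ n).supp)))
  let e : ℕ → L2 (halfGuide θ) := fun n => modeL2 hθ (hρ n) contDiff_csin.continuous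
  let r : ℕ → L2 (halfGuide θ) := fun n => modeL2 hθ (hτ n) contDiff_csin.continuous
  have hgraph : ∀ n, (e n, r n + z • e n) ∈ (mixedLaplacian θ).graph := fun n => by
    have h1 := mode_mem_graph hθ (hρ n) (hσ n) fun s => rfl
    rwa [modeL2_eq_add_smul hθ (hρ n) (hσ n) (hτ n) (c := z) fun s => by rw [hz]; ring] at h1
  have hdisj : ∀ i j, i < j → ∀ s, ρ i s = 0 ∨ ρ j s = 0 := fun i j hij s => by
    by_contra! h
    have aux : ∀ n, ρ n s ≠ 0 → ℓ n * s ∈ Ioo (1 : ℝ) 2 := fun n hn => by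
      by_contra h'
      refine hn ?_
      change (a n : ℂ) * cbump (ℓ n * s) * wave k s = 0
      rw [cbump_eq_zero h', mul_zero, zero_mul]
    have h1 := aux i h.1
    have h2 := aux j h.2
    have h3 : ℓ j ≤ ℓ i * (1 / 2) := by
      rw [← pow_succ]
      exact pow_le_pow_of_le_one (by norm_num) (by norm_num) hij
    have hs : 0 < s := by
      by_contra! hs
      have := mul_nonpos_of_nonneg_of_nonpos (hℓ i).le hs
      linarith [h1.1]
    have := mul_le_mul_of_nonneg_right h3 hs.le
    linarith [h1.2, h2.1]
  have horth : Orthonormal ℂ e := by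
    refine ⟨fun n => ?_, fun i j hij => ?_⟩
    · have h1 := norm_modeL2_sq hθ (hρ n)
      have h2 : ‖e n‖ ^ 2 = 1 := by
        rw [h1, integral_norm_packet_sq _ _ (hℓ n), ha]
        have := (hℓ n).ne'
        have hm' := hm.ne'
        change sinMass * (ℓ n / m / ℓ n * ∫ s, ‖cbump s‖ ^ 2) = 1
        rw [div_right_comm, div_self this, mul_left_comm, one_div]
        exact inv_mul_cancel₀ hm'
      exact (pow_eq_one_iff_of_nonneg (norm_nonneg _) two_ne_zero).1 h2
    · refine inner_modeL2_eq_zero hθ (hρ i) (hρ j) fun s => ?_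
      rcases lt_or_gt_of_ne hij with h | h
      · exact hdisj i j h s
      · exact (hdisj j i h s).symm
  have hr : Tendsto r atTop (𝓝 0) := by
    obtain ⟨M, hM⟩ := exists_defect_bound k
    rw [tendsto_zero_iff_norm_tendsto_zero]
    have hsq : Tendsto (fun n => ‖r n‖ ^ 2) atTop (𝓝 0) := by
      have hℓ0 : Tendsto ℓ atTop (𝓝 0) :=
        tendsto_pow_atTop_nhds_zero_of_lt_one (by norm_num) (by norm_num)
      -- With `a² = ℓ / m` the squared defect is of order `ℓ²`.
      refine squeeze_zero (g := fun n => sinMass * (ℓ n / m * ℓ n * M)) (fun n => by positivity)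
        (fun n => ?_) ?_
      · rw [norm_modeL2_sq hθ (hτ n), ← ha]
        exact mul_le_mul_of_nonneg_left (hM (a n) (ℓ n) (hℓ n) (hℓ1 n)) sinMass_pos.le
      · have := ((((hℓ0.div_const m).mul hℓ0).mul_const M).const_mul sinMass)
        simpa using this
    have := (Real.continuous_sqrt.tendsto 0).comp hsq
    simpa [Function.comp_def, Real.sqrt_sq (norm_nonneg _)] using this
  refine not_isFredholmAt_of_orthonormal
    (ContinuousLinearMap.fst ℂ (L2 (halfGuide θ)) (L2 (halfGuide θ) × L2 (halfGuide θ)))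
    (gradientGraph (halfGuide θ) (dirichletBoundary θ))
    (isClosed_gradientGraph (isOpen_halfGuide θ)) (fun u f => ?_) horth hgraph hr
  rw [mem_graph_mixed]
  constructor
  · rintro ⟨p, hp, hpu, h⟩
    exact ⟨p, ⟨hp, h⟩, hpu⟩
  · rintro ⟨p, ⟨hp, h⟩, hpu⟩
    exact ⟨p, hp, hpu, h⟩

end Weyl

end BrokenGuide

/-! ### Conclusion -/

theorem proposition2p2 (θ : ℝ) (hθ : θ ∈ Set.Ioo 0 (Real.pi / 2)) :
    BrokenGuide.discreteSpectrum (BrokenGuide.dirichletLaplacian (BrokenGuide.guide θ)) =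
      BrokenGuide.discreteSpectrum (BrokenGuide.mixedLaplacian θ) ∧
    ∀ (z : ℝ), z < 1 →
      ∀ ψ : (BrokenGuide.dirichletLaplacian (BrokenGuide.guide θ)).domain,
        BrokenGuide.dirichletLaplacian (BrokenGuide.guide θ) ψ =
            (z : ℂ) • (ψ : BrokenGuide.L2 (BrokenGuide.guide θ)) →
          ∀ᵐ x ∂(MeasureTheory.volume.restrict (BrokenGuide.guide θ)),
            (ψ : BrokenGuide.L2 (BrokenGuide.guide θ)) (x.1, -x.2) =
              (ψ : BrokenGuide.L2 (BrokenGuide.guide θ)) x := by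
  refine ⟨BrokenGuide.discreteSpectrum_eq_of_retract BrokenGuide.evenPart_evenExt
    (fun _ _ => BrokenGuide.evenExt_mem_graph hθ) (fun _ _ => BrokenGuide.evenPart_mem_graph hθ)
    fun z hz => BrokenGuide.regularOnKer_evenPart hθ ?_, fun z hz ψ hψ => ?_⟩
  -- The only points where regularity in the odd sector is not available are real and at least `1`,
  -- and there the mixed Laplacian is not Fredholm.
  · by_contra! h
    exact BrokenGuide.not_isFredholmAt_mixedLaplacian hθ h.1 h.2 hz
  · have hgraph : ((ψ : BrokenGuide.L2 (BrokenGuide.guide θ)),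
        (z : ℂ) • (ψ : BrokenGuide.L2 (BrokenGuide.guide θ))) ∈
          (BrokenGuide.dirichletLaplacian (BrokenGuide.guide θ)).graph :=
      (LinearPMap.mem_graph_iff _).2 ⟨ψ, rfl, hψ⟩
    have h := BrokenGuide.refl_eq_of_mem_graph hθ hz hgraph
    filter_upwards [BrokenGuide.refl_ae (θ := θ) ψ] with x hx
    rw [h] at hx
    exact hx.symm
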